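/- **The calculus $\lambda_{cl}$.** Qualifiers: $rq::=\mathsf s\mid\mathsf w$ (strong, weak), $aq::=\mathsf U\mid\mathsf R\mid\mathsf A\mid\mathsf L$ (unlimited, relevant, affine, linear); $K::=\mathsf{Dup}\mid\mathsf{Drop}$. Types: $\tau::=\alpha\mid\tau_1\xrightarrow{aq}\tau_2\mid\tau_1\times\tau_2\mid\tau_1+\tau_2\mid\mathsf{Unit}\mid\mathsf{ref}^{rq}\,\tau\mid\forall\bar\alpha.\,P\Rightarrow\tau$, where a constraint $P=(K_1\tau_1,\dots,K_n\tau_n)$ denotes a set (types that differ only in the listing of such sets are identified). Terms: $e::=x\mid v\mid e_1\,e_2\mid e\,[\bar\tau]\mid(e_1,e_2)\mid\mathbf{let}\,(x_1,x_2)=e_1\,\mathbf{in}\,e_2\mid\mathsf{inl}\,e\mid\mathsf{inr}\,e\mid\mathbf{case}\,e\,\mathbf{of}\,\mathsf{inl}\,x_1\to e_1;\mathsf{inr}\,x_2\to e_2\mid\mathbf{new}^{rq}e\mid\mathbf{release}^{rq}e\mid\mathbf{swap}^{rq}e_1\,e_2\mid\mathbf{dup}\,e_1\,\mathbf{as}\,x_1,x_2\,\mathbf{in}\,e_2\mid\mathbf{drop}\,e_1\,\mathbf{in}\,e_2$.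 Values: $v::=\lambda^{aq}x{:}\tau.\,e\mid\Lambda\bar\alpha.\,P\Rightarrow v\mid(v_1,v_2)\mid\mathsf{inl}\,v\mid\mathsf{inr}\,v\mid\ell\mid()$, with $\ell$ a location. Terms and types are taken up to renaming of bound variables. **Evaluation.** A store $\mu$ is a finite map $\ell\mapsto^i v$ from locations to a reference count $i$ and a value. $\mathrm{locs}(e)$ is the multiset of location occurrences in $e$ (of the two branches of a $\mathbf{case}$, only the first is counted). The partial operation $\mathrm{incr}_\ell$ increases the count of $\ell$ by $1$. The partial operation $\mathrm{decr}_\ell$ lowers the count of $\ell$ by $1$ if it is $>1$; if it is $1$ and $\ell$ contains $v$, it removes $\ell$ and then applies $\mathrm{decr}_{\mathrm{locs}(v)}$. Both are extended to multisets by iteration. Evaluation is left-to-right call-by-value, with the relation $\longmapsto$ closed under evaluation contexts: - $(\lambda^{aq}x{:}\tau.e)\,v\longmapsto e[v/x]$; $(\Lambda\bar\alpha.P\Rightarrow v)[\bar\tau]\longmapsto v[\bar\tau/\bar\alpha]$ when $|\bar\alpha|=|\bar\tau|$; the usual rules for $\mathbf{let}$ and $\mathbf{case}$ (all with the store unchanged);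 - $(\mu,\mathbf{new}^{rq}v)\longmapsto(\mu\uplus\{\ell\mapsto^1v\},\ell)$ for any $\ell\notin\operatorname{dom}\mu$; - $(\mu\uplus\{\ell\mapsto^iv_1\},\mathbf{swap}^{rq}\ell\,v_2)\longmapsto(\mu\uplus\{\ell\mapsto^iv_2\},(\ell,v_1))$; - $(\mu\uplus\{\ell\mapsto^1v\},\mathbf{release}^{\mathsf w}\ell)\longmapsto(\mu,\mathsf{inl}\,v)$, and $(\mu\uplus\{\ell\mapsto^iv\},\mathbf{release}^{\mathsf w}\ell)\longmapsto(\mu\uplus\{\ell\mapsto^{i-1}v\},\mathsf{inr}\,())$ if $i>1$; - $(\mu\uplus\{\ell\mapsto^1v\},\mathbf{release}^{\mathsf s}\ell)\longmapsto(\mu,v)$; - $(\mu,\mathbf{dup}\,v\,\mathbf{as}\,x_1,x_2\,\mathbf{in}\,e)\longmapsto(\mathrm{incr}_{\mathrm{locs}(v)}\mu,\;e[v/x_1][v/x_2])$ and $(\mu,\mathbf{drop}\,v\,\mathbf{in}\,e)\longmapsto(\mathrm{decr}_{\mathrm{locs}(v)}\mu,\;e)$. **Entailment.** $P\Vdash K\tau$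 is generated by membership in $P$ and the instances: $K\tau_1,K\tau_2\Rightarrow K(\tau_1\times\tau_2)$ and $K(\tau_1+\tau_2)$; $K\,\mathsf{Unit}$; $K(\tau_1\xrightarrow{\mathsf U}\tau_2)$; $\mathsf{Dup}(\tau_1\xrightarrow{\mathsf R}\tau_2)$; $\mathsf{Drop}(\tau_1\xrightarrow{\mathsf A}\tau_2)$; $\mathsf{Dup}(\mathsf{ref}^{\mathsf w}\tau)$; $\mathsf{Drop}\,\tau\Rightarrow\mathsf{Drop}(\mathsf{ref}^{rq}\tau)$. A set of constraints is entailed if each of its members is. **Typing.** A variable context $\Gamma$ is a finite map $x:\tau$. A location context $\Sigma$ is a finite map with entries $\ell\mapsto_{\mathsf s}\tau$ or $\ell\mapsto_{\mathsf w}^k\tau$. $\Gamma_1+\Gamma_2$ is the union, defined when the domains are disjoint. $\Sigma_1+\Sigma_2$ is defined when every location in both domains is weak in both, with the same type; the counts of such locations are added. The rules for $P;\Gamma;\Sigma\vdash e:\tau$ are as follows; $P$ is carried unchanged where not shown, a rule with two subterms splits $\Gamma=\Gamma_1+\Gamma_2$ and $\Sigma=\Sigma_1+\Sigma_2$ between them,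 both branches of a $\mathbf{case}$ share $\Gamma_2,\Sigma_2$, and leaves use exactly the shown context. - $x:\tau;\cdot\vdash x:\tau$; $\ \cdot;\cdot\vdash():\mathsf{Unit}$; $\ \cdot;\ell\mapsto^1_{\mathsf w}\tau\vdash\ell:\mathsf{ref}^{\mathsf w}\tau$; $\ \cdot;\ell\mapsto_{\mathsf s}\tau\vdash\ell:\mathsf{ref}^{\mathsf s}\tau$. - $P;\Gamma;\Sigma\vdash\lambda^{aq}x{:}\tau_1.e:\tau_1\xrightarrow{aq}\tau_2$ if $P;\Gamma,x{:}\tau_1;\Sigma\vdash e:\tau_2$ and $P$ entails $K\tau$ for all types $\tau$ in $\Gamma$ and all reference types $\tau$ of locations in $\Sigma$, where $K$ ranges over $\mathsf{Dup},\mathsf{Drop}$ for $aq=\mathsf U$, over $\mathsf{Dup}$ for $\mathsf R$, over $\mathsf{Drop}$ for $\mathsf A$, and over nothing for $\mathsf L$. - $P_1;\Gamma;\Sigma\vdash\Lambda\bar\alpha.P_2\Rightarrow v:\forall\bar\alpha.P_2\Rightarrow\tau$ if $P_1,P_2;\Gamma;\Sigma\vdash v:\tau$, every constraint in $P_2$ is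 of the form $K\alpha_i$, and $\bar\alpha$ is not free in $P_1,\Gamma,\Sigma$. $\ P_1;\Gamma;\Sigma\vdash e[\bar\tau]:\tau[\bar\tau/\bar\alpha]$ if $e:\forall\bar\alpha.P_2\Rightarrow\tau$, $|\bar\tau|=|\bar\alpha|$ and $P_1\Vdash P_2[\bar\tau/\bar\alpha]$. - Application, pairs, $\mathbf{let}$, $\mathsf{inl}$, $\mathsf{inr}$, $\mathbf{case}$: as usual, with split contexts. - $\mathbf{dup}\,e_1\,\mathbf{as}\,x_1,x_2\,\mathbf{in}\,e_2:\tau_2$ if $e_1:\tau_1$, $P\Vdash\mathsf{Dup}\,\tau_1$, and $e_2:\tau_2$ under $\Gamma_2,x_1{:}\tau_1,x_2{:}\tau_1$. $\ \mathbf{drop}\,e_1\,\mathbf{in}\,e_2:\tau_2$ if $e_1:\tau_1$, $P\Vdash\mathsf{Drop}\,\tau_1$ and $e_2:\tau_2$. - $\mathbf{new}^{rq}e:\mathsf{ref}^{rq}\tau$ if $e:\tau$; $\ \mathbf{release}^{\mathsf w}e:\tau+\mathsf{Unit}$ if $e:\mathsf{ref}^{rq}\tau$ (either $rq$); $\ \mathbf{release}^{\mathsf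 s}e:\tau$ if $e:\mathsf{ref}^{\mathsf s}\tau$; $\ \mathbf{swap}^{\mathsf w}e_1e_2:\mathsf{ref}^{rq}\tau\times\tau$ if $e_1:\mathsf{ref}^{rq}\tau$ (either $rq$) and $e_2:\tau$; $\ \mathbf{swap}^{\mathsf s}e_1e_2:\mathsf{ref}^{\mathsf s}\tau_2\times\tau_1$ if $e_1:\mathsf{ref}^{\mathsf s}\tau_1$ and $e_2:\tau_2$. Store typing: $\cdot\vdash\cdot:\cdot$; and if $\Sigma_1\vdash\mu:\Sigma_2$, $\ \cdot;\cdot;\Sigma_v\vdash v:\tau$ and $\ell$ is new, then $\Sigma_1+\Sigma_v\vdash\mu,\ell\mapsto^iv:\Sigma_2,\ell\mapsto^i_{\mathsf w}\tau$ and $\Sigma_1+\Sigma_v\vdash\mu,\ell\mapsto^1v:\Sigma_2,\ell\mapsto_{\mathsf s}\tau$. Configuration typing: $\vdash(\mu,e):\tau$ iff there are $\Sigma_1,\Sigma_2$ with $\Sigma_1\vdash\mu:\Sigma_1+\Sigma_2$ and $\cdot;\cdot;\Sigma_2\vdash e:\tau$. **Theorem (Type soundness).** Suppose $\vdash(\cdot,e):\tau$,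 where $\cdot$ is the empty store. Then either $(\cdot,e)$ diverges (has an infinite reduction sequence), or $(\cdot,e)\longmapsto^*(\mu,v)$ for some store $\mu$ and value $v$ with $\vdash(\mu,v):\tau$. Moreover, whatever choices of fresh locations are made, no reduction gets stuck: every configuration $(\mu,e')$ with $(\cdot,e)\longmapsto^*(\mu,e')$ that cannot take a further step is a value configuration, and $\vdash(\mu,e'):\tau$. -/

import Mathlib

namespace LambdaCl

/-! ## Syntax

Variables are de Bruijn indices, so terms and types are taken up to renaming of bound variables.
Locations are natural numbers. -/

abbrev Loc : Type := ℕ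

/-- Reference qualifiers: strong and weak. -/
inductive RefQual : Type
  | s
  | w
  deriving DecidableEq

/-- Arrow qualifiers: unlimited, relevant, affine, linear. -/
inductive ArrowQual : Type
  | U
  | R
  | A
  | L
  deriving DecidableEq

/-- Predicate constructors. -/
inductive PredCon : Type
  | Dup
  | Drop
  deriving DecidableEq

/-- Types. `all n P τ` is the qualified universal type `∀ α₀ … αₙ₋₁. P ⇒ τ`; inside `P` and `τ` the
index `i < n` refers to `αᵢ`, and the index `n + j` refers to the variable `j` of the outside. -/
inductive Ty : Type
  | var (i : ℕ)
  | arrow (aq : ArrowQual) (τ₁ τ₂ : Ty)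
  | prod (τ₁ τ₂ : Ty)
  | sum (τ₁ τ₂ : Ty)
  | unit
  | ref (rq : RefQual) (τ : Ty)
  | all (n : ℕ) (P : List (PredCon × Ty)) (τ : Ty)

/-- A constraint `(K₁ τ₁, …, Kₘ τₘ)`. It is listed, but stands for the set of its members:
entailment uses membership only, and types are identified accordingly (see `TyEq`). -/
abbrev Constraint : Type := List (PredCon × Ty)

/-- Terms. Binders: `lam aq τ e` binds index `0` in `e`; `tabs n P v` binds `n` type variables in
`P` and `v` (as in `Ty.all`); `letPair e₁ e₂` is `let (x₁, x₂) = e₁ in e₂` and `dup e₁ e₂` is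
`dup e₁ as x₁, x₂ in e₂`, where `x₁` is index `1` and `x₂` is index `0` in `e₂`;
`caseOf e e₁ e₂` is `case e of inl x₁ → e₁; inr x₂ → e₂`, with index `0` bound in each branch;
`drop e₁ e₂` is `drop e₁ in e₂`. The body of `tabs` has to be a value; this is required wherever
type abstractions are typed, evaluated, or counted as values. -/
inductive Term : Type
  | var (i : ℕ)
  | lam (aq : ArrowQual) (τ : Ty) (e : Term)
  | tabs (n : ℕ) (P : Constraint) (v : Term)
  | loc (l : Loc)
  | unit
  | app (e₁ e₂ : Term)
  | tapp (e : Term) (τs : List Ty)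
  | pair (e₁ e₂ : Term)
  | letPair (e₁ e₂ : Term)
  | inl (e : Term)
  | inr (e : Term)
  | caseOf (e e₁ e₂ : Term)
  | new (rq : RefQual) (e : Term)
  | release (rq : RefQual) (e : Term)
  | swap (rq : RefQual) (e₁ e₂ : Term)
  | dup (e₁ e₂ : Term)
  | drop (e₁ e₂ : Term)

/-- Values. -/
inductive Term.IsValue : Term → Prop
  | lam (aq : ArrowQual) (τ : Ty) (e : Term) : IsValue (.lam aq τ e)
  | tabs (n : ℕ) (P : Constraint) {v : Term} : IsValue v → IsValue (.tabs n P v)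
  | pair {v₁ v₂ : Term} : IsValue v₁ → IsValue v₂ → IsValue (.pair v₁ v₂)
  | inl {v : Term} : IsValue v → IsValue (.inl v)
  | inr {v : Term} : IsValue v → IsValue (.inr v)
  | loc (l : Loc) : IsValue (.loc l)
  | unit : IsValue .unit

/-! ## Substitution of types -/

/-- A renaming, moved under `n` binders. -/
def liftRen (n : ℕ) (r : ℕ → ℕ) : ℕ → ℕ :=
  fun i => if i < n then i else r (i - n) + n

mutual
/-- Renaming of the free type variables of a type. -/
def Ty.rename (r : ℕ → ℕ) : Ty → Ty
  | .var i => .var (r i)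
  | .arrow aq τ₁ τ₂ => .arrow aq (τ₁.rename r) (τ₂.rename r)
  | .prod τ₁ τ₂ => .prod (τ₁.rename r) (τ₂.rename r)
  | .sum τ₁ τ₂ => .sum (τ₁.rename r) (τ₂.rename r)
  | .unit => .unit
  | .ref rq τ => .ref rq (τ.rename r)
  | .all n P τ => .all n (Constraint.rename (liftRen n r) P) (τ.rename (liftRen n r))

def Constraint.rename (r : ℕ → ℕ) : List (PredCon × Ty) → List (PredCon × Ty)
  | [] => []
  | c :: P => Pred.rename r c :: Constraint.rename r P

def Pred.rename (r : ℕ → ℕ) : PredCon × Ty → PredCon × Ty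
  | (K, τ) => (K, τ.rename r)
end

/-- Moving a type under `n` binders of type variables. -/
def Ty.shift (n : ℕ) (τ : Ty) : Ty := τ.rename (fun i => i + n)

def Constraint.shift (n : ℕ) (P : Constraint) : Constraint := P.map fun c => (c.1, c.2.shift n)

/-- A substitution of types, moved under `n` binders of type variables. -/
def liftTySub (n : ℕ) (s : ℕ → Ty) : ℕ → Ty :=
  fun i => if i < n then .var i else (s (i - n)).shift n

mutual
/-- Simultaneous capture-avoiding substitution for the type variables of a type. -/
def Ty.subst (s : ℕ → Ty) : Ty → Ty
  | .var i => s i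
  | .arrow aq τ₁ τ₂ => .arrow aq (τ₁.subst s) (τ₂.subst s)
  | .prod τ₁ τ₂ => .prod (τ₁.subst s) (τ₂.subst s)
  | .sum τ₁ τ₂ => .sum (τ₁.subst s) (τ₂.subst s)
  | .unit => .unit
  | .ref rq τ => .ref rq (τ.subst s)
  | .all n P τ => .all n (Constraint.subst (liftTySub n s) P) (τ.subst (liftTySub n s))

def Constraint.subst (s : ℕ → Ty) : List (PredCon × Ty) → List (PredCon × Ty)
  | [] => []
  | c :: P => Pred.subst s c :: Constraint.subst s P

def Pred.subst (s : ℕ → Ty) : PredCon × Ty → PredCon × Ty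
  | (K, τ) => (K, τ.subst s)
end

/-- The substitution of `τs` for the `τs.length` innermost type variables. -/
def instTys (τs : List Ty) : ℕ → Ty :=
  fun i => (τs[i]?).getD (.var (i - τs.length))

/-- Simultaneous substitution for the type variables of a term. -/
def Term.tsubst (s : ℕ → Ty) : Term → Term
  | .var i => .var i
  | .lam aq τ e => .lam aq (τ.subst s) (e.tsubst s)
  | .tabs n P v => .tabs n (Constraint.subst (liftTySub n s) P) (v.tsubst (liftTySub n s))
  | .loc l => .loc l
  | .unit => .unit
  | .app e₁ e₂ => .app (e₁.tsubst s) (e₂.tsubst s)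
  | .tapp e τs => .tapp (e.tsubst s) (τs.map (Ty.subst s))
  | .pair e₁ e₂ => .pair (e₁.tsubst s) (e₂.tsubst s)
  | .letPair e₁ e₂ => .letPair (e₁.tsubst s) (e₂.tsubst s)
  | .inl e => .inl (e.tsubst s)
  | .inr e => .inr (e.tsubst s)
  | .caseOf e e₁ e₂ => .caseOf (e.tsubst s) (e₁.tsubst s) (e₂.tsubst s)
  | .new rq e => .new rq (e.tsubst s)
  | .release rq e => .release rq (e.tsubst s)
  | .swap rq e₁ e₂ => .swap rq (e₁.tsubst s) (e₂.tsubst s)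
  | .dup e₁ e₂ => .dup (e₁.tsubst s) (e₂.tsubst s)
  | .drop e₁ e₂ => .drop (e₁.tsubst s) (e₂.tsubst s)

/-- Moving a term under `n` binders of type variables. -/
def Term.tshift (n : ℕ) (e : Term) : Term := e.tsubst fun i => .var (i + n)

/-! ## Substitution of terms -/

/-- Renaming of the free term variables of a term. -/
def Term.rename (r : ℕ → ℕ) : Term → Term
  | .var i => .var (r i)
  | .lam aq τ e => .lam aq τ (e.rename (liftRen 1 r))
  | .tabs n P v => .tabs n P (v.rename r)
  | .loc l => .loc l
  | .unit => .unit
  | .app e₁ e₂ => .app (e₁.rename r) (e₂.rename r)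
  | .tapp e τs => .tapp (e.rename r) τs
  | .pair e₁ e₂ => .pair (e₁.rename r) (e₂.rename r)
  | .letPair e₁ e₂ => .letPair (e₁.rename r) (e₂.rename (liftRen 2 r))
  | .inl e => .inl (e.rename r)
  | .inr e => .inr (e.rename r)
  | .caseOf e e₁ e₂ =>
      .caseOf (e.rename r) (e₁.rename (liftRen 1 r)) (e₂.rename (liftRen 1 r))
  | .new rq e => .new rq (e.rename r)
  | .release rq e => .release rq (e.rename r)
  | .swap rq e₁ e₂ => .swap rq (e₁.rename r) (e₂.rename r)
  | .dup e₁ e₂ => .dup (e₁.rename r) (e₂.rename (liftRen 2 r))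
  | .drop e₁ e₂ => .drop (e₁.rename r) (e₂.rename r)

/-- A substitution of terms, moved under `n` binders of term variables. -/
def liftSub (n : ℕ) (σ : ℕ → Term) : ℕ → Term :=
  fun i => if i < n then .var i else (σ (i - n)).rename (fun j => j + n)

/-- Simultaneous capture-avoiding substitution for the term variables of a term. -/
def Term.subst (σ : ℕ → Term) : Term → Term
  | .var i => σ i
  | .lam aq τ e => .lam aq τ (e.subst (liftSub 1 σ))
  | .tabs n P v => .tabs n P (v.subst fun i => (σ i).tshift n)
  | .loc l => .loc l
  | .unit => .unit
  | .app e₁ e₂ => .app (e₁.subst σ) (e₂.subst σ)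
  | .tapp e τs => .tapp (e.subst σ) τs
  | .pair e₁ e₂ => .pair (e₁.subst σ) (e₂.subst σ)
  | .letPair e₁ e₂ => .letPair (e₁.subst σ) (e₂.subst (liftSub 2 σ))
  | .inl e => .inl (e.subst σ)
  | .inr e => .inr (e.subst σ)
  | .caseOf e e₁ e₂ =>
      .caseOf (e.subst σ) (e₁.subst (liftSub 1 σ)) (e₂.subst (liftSub 1 σ))
  | .new rq e => .new rq (e.subst σ)
  | .release rq e => .release rq (e.subst σ)
  | .swap rq e₁ e₂ => .swap rq (e₁.subst σ) (e₂.subst σ)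
  | .dup e₁ e₂ => .dup (e₁.subst σ) (e₂.subst (liftSub 2 σ))
  | .drop e₁ e₂ => .drop (e₁.subst σ) (e₂.subst σ)

/-- `e[v/x]` for the innermost variable `x` of `e`. -/
def Term.subst1 (v e : Term) : Term :=
  e.subst fun
    | 0 => v
    | i + 1 => .var i

/-- `e[v₁/x₁][v₂/x₂]`, where `x₁` is index `1` and `x₂` is index `0` in `e`. -/
def Term.subst2 (v₁ v₂ e : Term) : Term :=
  e.subst fun
    | 0 => v₂
    | 1 => v₁
    | i + 2 => .var i

/-! ## Reference-counted stores and the small-step relation -/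

/-- Stores: finite maps from locations to a reference count and a value. -/
abbrev Store : Type := Finmap fun _ : Loc => ℕ × Term

/-- Configurations: a store and a term. -/
abbrev Config : Type := Store × Term

/-- The multiset of the location occurrences in a term. Of the branches of a `case` only the first
is counted: in a well-typed term both branches have the same location context. -/
def Term.locs : Term → Multiset Loc
  | .var _ => 0
  | .lam _ _ e => e.locs
  | .tabs _ _ v => v.locs
  | .loc l => {l}
  | .unit => 0
  | .app e₁ e₂ => e₁.locs + e₂.locs
  | .tapp e _ => e.locs
  | .pair e₁ e₂ => e₁.locs + e₂.locs
  | .letPair e₁ e₂ => e₁.locs + e₂.locs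
  | .inl e => e.locs
  | .inr e => e.locs
  | .caseOf e e₁ _ => e.locs + e₁.locs
  | .new _ e => e.locs
  | .release _ e => e.locs
  | .swap _ e₁ e₂ => e₁.locs + e₂.locs
  | .dup e₁ e₂ => e₁.locs + e₂.locs
  | .drop e₁ e₂ => e₁.locs + e₂.locs

/-- `Incr [l₁, …, lₖ] μ μ'`: the partial operation `incr l₁ (⋯ (incr lₖ μ))` is defined and has the
value `μ'`. -/
inductive Incr : List Loc → Store → Store → Prop
  | nil (μ : Store) : Incr [] μ μ
  | cons {l : Loc} {ls : List Loc} {μ μ' : Store} {j : ℕ} {v : Term} :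
      Incr ls μ μ' → μ'.lookup l = some (j, v) →
      Incr (l :: ls) μ (μ'.insert l (j + 1, v))

/-- `Decr [l₁, …, lₖ] μ μ'`: the partial operation `decr l₁ (⋯ (decr lₖ μ))` is defined and has the
value `μ'`. Removing the last pointer to a cell deallocates the cell, and then decrements the
reference counts of all location occurrences in its contents. -/
inductive Decr : List Loc → Store → Store → Prop
  | nil (μ : Store) : Decr [] μ μ
  | last {l : Loc} {ls ls' : List Loc} {μ μ' μ'' : Store} {v : Term} :
      Decr ls μ μ' → μ'.lookup l = some (1, v) →
      (ls' : Multiset Loc) = v.locs → Decr ls' (μ'.erase l) μ'' →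
      Decr (l :: ls) μ μ''
  | more {l : Loc} {ls : List Loc} {μ μ' : Store} {j : ℕ} {v : Term} :
      Decr ls μ μ' → μ'.lookup l = some (j, v) → 1 < j →
      Decr (l :: ls) μ (μ'.insert l (j - 1, v))

/-- Evaluation contexts. -/
inductive ECtx : Type
  | hole
  | appL (E : ECtx) (e : Term)
  | appR (v : Term) (hv : v.IsValue) (E : ECtx)
  | tapp (E : ECtx) (τs : List Ty)
  | pairL (E : ECtx) (e : Term)
  | pairR (v : Term) (hv : v.IsValue) (E : ECtx)
  | inl (E : ECtx)
  | inr (E : ECtx)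
  | caseOf (E : ECtx) (e₁ e₂ : Term)
  | letPair (E : ECtx) (e : Term)
  | new (rq : RefQual) (E : ECtx)
  | release (rq : RefQual) (E : ECtx)
  | swapL (rq : RefQual) (E : ECtx) (e : Term)
  | swapR (rq : RefQual) (v : Term) (hv : v.IsValue) (E : ECtx)
  | dup (E : ECtx) (e : Term)
  | drop (E : ECtx) (e : Term)

/-- `E[e]`. -/
def ECtx.plug : ECtx → Term → Term
  | .hole, t => t
  | .appL E e, t => .app (E.plug t) e
  | .appR v _ E, t => .app v (E.plug t)
  | .tapp E τs, t => .tapp (E.plug t) τs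
  | .pairL E e, t => .pair (E.plug t) e
  | .pairR v _ E, t => .pair v (E.plug t)
  | .inl E, t => .inl (E.plug t)
  | .inr E, t => .inr (E.plug t)
  | .caseOf E e₁ e₂, t => .caseOf (E.plug t) e₁ e₂
  | .letPair E e, t => .letPair (E.plug t) e
  | .new rq E, t => .new rq (E.plug t)
  | .release rq E, t => .release rq (E.plug t)
  | .swapL rq E e, t => .swap rq (E.plug t) e
  | .swapR rq v _ E, t => .swap rq v (E.plug t)
  | .dup E e, t => .dup (E.plug t) e
  | .drop E e, t => .drop (E.plug t) e

/-- The call-by-value small-step relation on configurations. -/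
inductive Step : Config → Config → Prop
  | beta {μ : Store} {aq : ArrowQual} {τ : Ty} {e v : Term} : v.IsValue →
      Step (μ, .app (.lam aq τ e) v) (μ, Term.subst1 v e)
  | tbeta {μ : Store} {n : ℕ} {P : Constraint} {v : Term} {τs : List Ty} :
      v.IsValue → τs.length = n →
      Step (μ, .tapp (.tabs n P v) τs) (μ, v.tsubst (instTys τs))
  | letPair {μ : Store} {v₁ v₂ e : Term} : v₁.IsValue → v₂.IsValue →
      Step (μ, .letPair (.pair v₁ v₂) e) (μ, Term.subst2 v₁ v₂ e)
  | caseInl {μ : Store} {v e₁ e₂ : Term} : v.IsValue →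
      Step (μ, .caseOf (.inl v) e₁ e₂) (μ, Term.subst1 v e₁)
  | caseInr {μ : Store} {v e₁ e₂ : Term} : v.IsValue →
      Step (μ, .caseOf (.inr v) e₁ e₂) (μ, Term.subst1 v e₂)
  | new {μ : Store} {rq : RefQual} {v : Term} {l : Loc} : v.IsValue → l ∉ μ →
      Step (μ, .new rq v) (μ.insert l (1, v), .loc l)
  | swap {μ : Store} {rq : RefQual} {l : Loc} {i : ℕ} {v₁ v₂ : Term} : v₂.IsValue →
      μ.lookup l = some (i, v₁) →
      Step (μ, .swap rq (.loc l) v₂) (μ.insert l (i, v₂), .pair (.loc l) v₁)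
  | releaseWLast {μ : Store} {l : Loc} {v : Term} : μ.lookup l = some (1, v) →
      Step (μ, .release .w (.loc l)) (μ.erase l, .inl v)
  | releaseWMore {μ : Store} {l : Loc} {i : ℕ} {v : Term} : μ.lookup l = some (i, v) → 1 < i →
      Step (μ, .release .w (.loc l)) (μ.insert l (i - 1, v), .inr .unit)
  | releaseS {μ : Store} {l : Loc} {v : Term} : μ.lookup l = some (1, v) →
      Step (μ, .release .s (.loc l)) (μ.erase l, v)
  | dup {μ μ' : Store} {v e : Term} {ls : List Loc} : v.IsValue →
      (ls : Multiset Loc) = v.locs → Incr ls μ μ' →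
      Step (μ, .dup v e) (μ', Term.subst2 v v e)
  | drop {μ μ' : Store} {v e : Term} {ls : List Loc} : v.IsValue →
      (ls : Multiset Loc) = v.locs → Decr ls μ μ' →
      Step (μ, .drop v e) (μ', e)
  | ctx {μ₁ μ₂ : Store} {e₁ e₂ : Term} (E : ECtx) : Step (μ₁, e₁) (μ₂, e₂) →
      Step (μ₁, E.plug e₁) (μ₂, E.plug e₂)

/-- Finitely many (possibly zero) steps. -/
def Steps : Config → Config → Prop := Relation.ReflTransGen Step

/-- There is an infinite sequence of steps from `c`. -/
def Diverges (c : Config) : Prop :=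
  ∃ f : ℕ → Config, f 0 = c ∧ ∀ n, Step (f n) (f (n + 1))

/-! ## Identification of types, and entailment -/

/-- Types are identified when they differ only in how the constraints in them are listed, since a
constraint denotes a set of atomic constraints: this is the least congruence on types that
identifies `∀ ᾱ. P ⇒ τ` with `∀ ᾱ. Q ⇒ τ` whenever `P` and `Q` have the same members. -/
inductive TyEq : Ty → Ty → Prop
  | refl (τ : Ty) : TyEq τ τ
  | symm {τ τ' : Ty} : TyEq τ τ' → TyEq τ' τ
  | trans {τ τ' τ'' : Ty} : TyEq τ τ' → TyEq τ' τ'' → TyEq τ τ''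
  | arrow (aq : ArrowQual) {τ₁ τ₁' τ₂ τ₂' : Ty} : TyEq τ₁ τ₁' → TyEq τ₂ τ₂' →
      TyEq (.arrow aq τ₁ τ₂) (.arrow aq τ₁' τ₂')
  | prod {τ₁ τ₁' τ₂ τ₂' : Ty} : TyEq τ₁ τ₁' → TyEq τ₂ τ₂' → TyEq (.prod τ₁ τ₂) (.prod τ₁' τ₂')
  | sum {τ₁ τ₁' τ₂ τ₂' : Ty} : TyEq τ₁ τ₁' → TyEq τ₂ τ₂' → TyEq (.sum τ₁ τ₂) (.sum τ₁' τ₂')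
  | ref (rq : RefQual) {τ τ' : Ty} : TyEq τ τ' → TyEq (.ref rq τ) (.ref rq τ')
  | allBody (n : ℕ) (P : Constraint) {τ τ' : Ty} : TyEq τ τ' → TyEq (.all n P τ) (.all n P τ')
  | allHead (n : ℕ) (K : PredCon) (P : Constraint) (τ : Ty) {τ₁ τ₁' : Ty} : TyEq τ₁ τ₁' →
      TyEq (.all n ((K, τ₁) :: P) τ) (.all n ((K, τ₁') :: P) τ)
  | allSet (n : ℕ) {P Q : Constraint} (τ : Ty) : (∀ c, c ∈ P ↔ c ∈ Q) →
      TyEq (.all n P τ) (.all n Q τ)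

/-- `Entails P K τ`: the atomic constraint `K τ` follows from `P` and the `Dup` and `Drop`
instances. -/
inductive Entails (P : Constraint) : PredCon → Ty → Prop
  | hyp {K : PredCon} {τ τ' : Ty} : (K, τ) ∈ P → TyEq τ τ' → Entails P K τ'
  | prod {K : PredCon} {τ₁ τ₂ : Ty} : Entails P K τ₁ → Entails P K τ₂ → Entails P K (.prod τ₁ τ₂)
  | sum {K : PredCon} {τ₁ τ₂ : Ty} : Entails P K τ₁ → Entails P K τ₂ → Entails P K (.sum τ₁ τ₂)
  | unit {K : PredCon} : Entails P K .unit
  | arrowU {K : PredCon} {τ₁ τ₂ : Ty} : Entails P K (.arrow .U τ₁ τ₂)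
  | dupArrowR {τ₁ τ₂ : Ty} : Entails P .Dup (.arrow .R τ₁ τ₂)
  | dropArrowA {τ₁ τ₂ : Ty} : Entails P .Drop (.arrow .A τ₁ τ₂)
  | dupRefW {τ : Ty} : Entails P .Dup (.ref .w τ)
  | dropRef {rq : RefQual} {τ : Ty} : Entails P .Drop τ → Entails P .Drop (.ref rq τ)

/-- Entailment of a constraint. -/
def EntailsAll (P Q : Constraint) : Prop := ∀ c ∈ Q, Entails P c.1 c.2

/-! ## Contexts

Contexts are partial maps, which identifies them up to permutation; the ones that occur in
derivations have finite domains. -/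

/-- Variable contexts. -/
abbrev VarCtx : Type := ℕ → Option Ty

namespace VarCtx

def empty : VarCtx := fun _ => none

/-- The context `x : τ`. -/
def single (x : ℕ) (τ : Ty) : VarCtx := fun i => if i = x then some τ else none

/-- `Γ, x : τ`, where the new variable `x` is index `0`. -/
def cons (τ : Ty) (Γ : VarCtx) : VarCtx
  | 0 => some τ
  | i + 1 => Γ i

/-- The context `Γ`, moved under `n` binders of type variables. -/
def tshift (n : ℕ) (Γ : VarCtx) : VarCtx := fun i => (Γ i).map (Ty.shift n)

/-- Compatibility: disjoint domains. -/
def Compat (Γ₁ Γ₂ : VarCtx) : Prop := ∀ i, Γ₁ i = none ∨ Γ₂ i = none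

/-- The join of compatible contexts. -/
def join (Γ₁ Γ₂ : VarCtx) : VarCtx := fun i => (Γ₁ i).or (Γ₂ i)

/-- `Γ₁` and `Γ₂` are compatible and `Γ = Γ₁ + Γ₂`. -/
def Splits (Γ Γ₁ Γ₂ : VarCtx) : Prop := Compat Γ₁ Γ₂ ∧ Γ = join Γ₁ Γ₂

end VarCtx

/-- Entries of location contexts: a strong location with contents of type `τ`, or a weak location
with reference count `k` and contents of type `τ`. -/
inductive LocEntry : Type
  | strong (τ : Ty)
  | weak (k : ℕ) (τ : Ty)

namespace LocEntry

/-- The reference type of a location. -/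
def refTy : LocEntry → Ty
  | .strong τ => .ref .s τ
  | .weak _ τ => .ref .w τ

def tshift (n : ℕ) : LocEntry → LocEntry
  | .strong τ => .strong (τ.shift n)
  | .weak k τ => .weak k (τ.shift n)

end LocEntry

/-- Location contexts. -/
abbrev LocCtx : Type := Loc → Option LocEntry

namespace LocCtx

def empty : LocCtx := fun _ => none

/-- `S, l ↦ a`, for a location `l` outside the domain of `S`. -/
def extend (S : LocCtx) (l : Loc) (a : LocEntry) : LocCtx := Function.update S l (some a)

def single (l : Loc) (a : LocEntry) : LocCtx := empty.extend l a

/-- The context `S`, moved under `n` binders of type variables. -/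
def tshift (n : ℕ) (S : LocCtx) : LocCtx := fun l => (S l).map (LocEntry.tshift n)

/-- Compatibility: a location in both domains is weak in both contexts, with the same type. -/
def Compat (S₁ S₂ : LocCtx) : Prop :=
  ∀ l a₁ a₂, S₁ l = some a₁ → S₂ l = some a₂ →
    ∃ k₁ k₂ τ, a₁ = .weak k₁ τ ∧ a₂ = .weak k₂ τ

/-- The join of the entries of one location; the counts of a shared weak location are summed. The
last case does not arise for compatible contexts. -/
def joinEntry : Option LocEntry → Option LocEntry → Option LocEntry
  | none, a => a
  | a, none => a
  | some (.weak k₁ τ), some (.weak k₂ _) => some (.weak (k₁ + k₂) τ)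
  | some a, some _ => some a

/-- The join of compatible contexts. -/
def join (S₁ S₂ : LocCtx) : LocCtx := fun l => joinEntry (S₁ l) (S₂ l)

/-- `S₁` and `S₂` are compatible and `S = S₁ + S₂`. -/
def Splits (S S₁ S₂ : LocCtx) : Prop := Compat S₁ S₂ ∧ S = join S₁ S₂

end LocCtx

/-- The predicates that a closure with a given arrow qualifier imposes on what it captures. -/
def ArrowQual.Requires : ArrowQual → PredCon → Prop
  | .U, _ => True
  | .R, K => K = .Dup
  | .A, K => K = .Drop
  | .L, _ => False

/-- `P` entails the set of the constraints, imposed by the arrow qualifier `aq`, on all types in `Γ`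
and on all reference types in `S`. -/
def EntailsConstrain (P : Constraint) (aq : ArrowQual) (Γ : VarCtx) (S : LocCtx) : Prop :=
  ∀ K, aq.Requires K →
    (∀ x τ, Γ x = some τ → Entails P K τ) ∧ (∀ l a, S l = some a → Entails P K a.refTy)

/-! ## Typing -/

/-- Term typing `P; Γ; S ⊢ e : τ`. The rule `conv` expresses the identification of types. -/
inductive HasTy : Constraint → VarCtx → LocCtx → Term → Ty → Prop
  | conv {P : Constraint} {Γ : VarCtx} {S : LocCtx} {e : Term} {τ τ' : Ty} :
      HasTy P Γ S e τ → TyEq τ τ' → HasTy P Γ S e τ'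
  | var {P : Constraint} {x : ℕ} {τ : Ty} :
      HasTy P (VarCtx.single x τ) LocCtx.empty (.var x) τ
  | tabs {P₁ P₂ : Constraint} {Γ : VarCtx} {S : LocCtx} {n : ℕ} {v : Term} {τ : Ty} :
      v.IsValue →
      HasTy (P₁.shift n ++ P₂) (Γ.tshift n) (S.tshift n) v τ →
      (∀ c ∈ P₂, ∃ i < n, c.2 = .var i) →
      HasTy P₁ Γ S (.tabs n P₂ v) (.all n P₂ τ)
  | tapp {P₁ P₂ : Constraint} {Γ : VarCtx} {S : LocCtx} {n : ℕ} {e : Term} {τ : Ty}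
      {τs : List Ty} :
      HasTy P₁ Γ S e (.all n P₂ τ) → τs.length = n →
      EntailsAll P₁ (Constraint.subst (instTys τs) P₂) →
      HasTy P₁ Γ S (.tapp e τs) (τ.subst (instTys τs))
  | lam {P : Constraint} {Γ : VarCtx} {S : LocCtx} {aq : ArrowQual} {e : Term} {τ₁ τ₂ : Ty} :
      HasTy P (Γ.cons τ₁) S e τ₂ → EntailsConstrain P aq Γ S →
      HasTy P Γ S (.lam aq τ₁ e) (.arrow aq τ₁ τ₂)
  | app {P : Constraint} {Γ Γ₁ Γ₂ : VarCtx} {S S₁ S₂ : LocCtx} {aq : ArrowQual} {e₁ e₂ : Term}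
      {τ₂ τ : Ty} :
      HasTy P Γ₁ S₁ e₁ (.arrow aq τ₂ τ) → HasTy P Γ₂ S₂ e₂ τ₂ →
      Γ.Splits Γ₁ Γ₂ → S.Splits S₁ S₂ →
      HasTy P Γ S (.app e₁ e₂) τ
  | unit {P : Constraint} : HasTy P VarCtx.empty LocCtx.empty .unit .unit
  | pair {P : Constraint} {Γ Γ₁ Γ₂ : VarCtx} {S S₁ S₂ : LocCtx} {e₁ e₂ : Term} {τ₁ τ₂ : Ty} :
      HasTy P Γ₁ S₁ e₁ τ₁ → HasTy P Γ₂ S₂ e₂ τ₂ →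
      Γ.Splits Γ₁ Γ₂ → S.Splits S₁ S₂ →
      HasTy P Γ S (.pair e₁ e₂) (.prod τ₁ τ₂)
  | letPair {P : Constraint} {Γ Γ₁ Γ₂ : VarCtx} {S S₁ S₂ : LocCtx} {e₁ e₂ : Term}
      {τ₁ τ₂ τ : Ty} :
      HasTy P Γ₁ S₁ e₁ (.prod τ₁ τ₂) → HasTy P ((Γ₂.cons τ₁).cons τ₂) S₂ e₂ τ →
      Γ.Splits Γ₁ Γ₂ → S.Splits S₁ S₂ →
      HasTy P Γ S (.letPair e₁ e₂) τ
  | inl {P : Constraint} {Γ : VarCtx} {S : LocCtx} {e : Term} {τ₁ τ₂ : Ty} :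
      HasTy P Γ S e τ₁ → HasTy P Γ S (.inl e) (.sum τ₁ τ₂)
  | inr {P : Constraint} {Γ : VarCtx} {S : LocCtx} {e : Term} {τ₁ τ₂ : Ty} :
      HasTy P Γ S e τ₂ → HasTy P Γ S (.inr e) (.sum τ₁ τ₂)
  | caseOf {P : Constraint} {Γ Γ₁ Γ₂ : VarCtx} {S S₁ S₂ : LocCtx} {e₁ e₂₁ e₂₂ : Term}
      {τ₁₁ τ₁₂ τ₂ : Ty} :
      HasTy P Γ₁ S₁ e₁ (.sum τ₁₁ τ₁₂) →
      HasTy P (Γ₂.cons τ₁₁) S₂ e₂₁ τ₂ → HasTy P (Γ₂.cons τ₁₂) S₂ e₂₂ τ₂ →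
      Γ.Splits Γ₁ Γ₂ → S.Splits S₁ S₂ →
      HasTy P Γ S (.caseOf e₁ e₂₁ e₂₂) τ₂
  | dup {P : Constraint} {Γ Γ₁ Γ₂ : VarCtx} {S S₁ S₂ : LocCtx} {e₁ e₂ : Term} {τ₁ τ₂ : Ty} :
      HasTy P Γ₁ S₁ e₁ τ₁ → HasTy P ((Γ₂.cons τ₁).cons τ₁) S₂ e₂ τ₂ → Entails P .Dup τ₁ →
      Γ.Splits Γ₁ Γ₂ → S.Splits S₁ S₂ →
      HasTy P Γ S (.dup e₁ e₂) τ₂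
  | drop {P : Constraint} {Γ Γ₁ Γ₂ : VarCtx} {S S₁ S₂ : LocCtx} {e₁ e₂ : Term} {τ₁ τ₂ : Ty} :
      HasTy P Γ₁ S₁ e₁ τ₁ → HasTy P Γ₂ S₂ e₂ τ₂ → Entails P .Drop τ₁ →
      Γ.Splits Γ₁ Γ₂ → S.Splits S₁ S₂ →
      HasTy P Γ S (.drop e₁ e₂) τ₂
  | new {P : Constraint} {Γ : VarCtx} {S : LocCtx} {rq : RefQual} {e : Term} {τ : Ty} :
      HasTy P Γ S e τ → HasTy P Γ S (.new rq e) (.ref rq τ)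
  | locW {P : Constraint} {l : Loc} {τ : Ty} :
      HasTy P VarCtx.empty (LocCtx.single l (.weak 1 τ)) (.loc l) (.ref .w τ)
  | locS {P : Constraint} {l : Loc} {τ : Ty} :
      HasTy P VarCtx.empty (LocCtx.single l (.strong τ)) (.loc l) (.ref .s τ)
  | releaseW {P : Constraint} {Γ : VarCtx} {S : LocCtx} {rq : RefQual} {e : Term} {τ : Ty} :
      HasTy P Γ S e (.ref rq τ) → HasTy P Γ S (.release .w e) (.sum τ .unit)
  | releaseS {P : Constraint} {Γ : VarCtx} {S : LocCtx} {e : Term} {τ : Ty} :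
      HasTy P Γ S e (.ref .s τ) → HasTy P Γ S (.release .s e) τ
  | swapW {P : Constraint} {Γ Γ₁ Γ₂ : VarCtx} {S S₁ S₂ : LocCtx} {rq : RefQual} {e₁ e₂ : Term}
      {τ : Ty} :
      HasTy P Γ₁ S₁ e₁ (.ref rq τ) → HasTy P Γ₂ S₂ e₂ τ →
      Γ.Splits Γ₁ Γ₂ → S.Splits S₁ S₂ →
      HasTy P Γ S (.swap .w e₁ e₂) (.prod (.ref rq τ) τ)
  | swapS {P : Constraint} {Γ Γ₁ Γ₂ : VarCtx} {S S₁ S₂ : LocCtx} {e₁ e₂ : Term} {τ₁ τ₂ : Ty} :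
      HasTy P Γ₁ S₁ e₁ (.ref .s τ₁) → HasTy P Γ₂ S₂ e₂ τ₂ →
      Γ.Splits Γ₁ Γ₂ → S.Splits S₁ S₂ →
      HasTy P Γ S (.swap .s e₁ e₂) (.prod (.ref .s τ₂) τ₁)

/-- Store typing `S₁ ⊢ μ : S₂`: the contents of `μ` use the locations as described by `S₁`, and
the cells of `μ` have the types and reference counts described by `S₂`. -/
inductive StoreTy : LocCtx → Store → LocCtx → Prop
  | nil : StoreTy LocCtx.empty ∅ LocCtx.empty
  | consW {S S₁ Sv S₂ : LocCtx} {μ : Store} {l : Loc} {i : ℕ} {v : Term} {τ : Ty} :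
      StoreTy S₁ μ S₂ → v.IsValue → HasTy [] VarCtx.empty Sv v τ → S.Splits S₁ Sv →
      l ∉ μ → S₂ l = none →
      StoreTy S (μ.insert l (i, v)) (S₂.extend l (.weak i τ))
  | consS {S S₁ Sv S₂ : LocCtx} {μ : Store} {l : Loc} {v : Term} {τ : Ty} :
      StoreTy S₁ μ S₂ → v.IsValue → HasTy [] VarCtx.empty Sv v τ → S.Splits S₁ Sv →
      l ∉ μ → S₂ l = none →
      StoreTy S (μ.insert l (1, v)) (S₂.extend l (.strong τ))

/-- Configuration typing `⊢ (μ, e) : τ`. -/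
inductive ConfTy : Config → Ty → Prop
  | mk {S S₁ S₂ : LocCtx} {μ : Store} {e : Term} {τ : Ty} :
      StoreTy S₁ μ S → S.Splits S₁ S₂ → HasTy [] VarCtx.empty S₂ e τ → ConfTy (μ, e) τ

end LambdaCl

namespace LambdaCl

/-! ## The algebra of type substitutions -/

-- Soundness is progress plus preservation for one invariant: the reference count of every cell
-- equals the number of occurrences of its location, in the contents of the store and in the running
-- term together, and every occurrence carries the type and the qualifier of the cell. A strong cell
-- has exactly one occurrence, which is why its type may change and why it can be released outright.
--
-- To make the counting algebraic, location contexts are traded for multisets of typed occurrences.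
-- In `HasOccTy` a split of a location context is just a sum in a commutative monoid, and
-- compatibility is no longer checked rule by rule: it is checked once, where a context describes
-- all occurrences (`Describes`, used in `StoreFits`). `HasTy.exists_hasOccTy` and `HasOccTy.hasTy`
-- pass between the two forms; the return trip works because a description of a sum always splits
-- (`Describes.split`).
--
-- Preservation rests on substitution (`HasOccTy.substAt`). A variable is used exactly once along
-- each branch, so the occurrences of the substituted value are added once. The delicate point is a
-- closure that captured the variable: its qualifier demands predicates of the type of the variable,
-- and now has to get them for the locations inside the value. This is `HasOccTy.entails_occ`, which
-- holds because all hypotheses in scope concern type variables, so an entailment at a compound type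
-- must come from an instance and can be inverted. The same lemma shows that a duplicable value
-- contains only weak locations, so that `dup` may raise their counts.
--
-- Each store operation moves occurrences between the store and the term (`StoreFits.new`,
-- `StoreFits.swap`, `StoreFits.erase`, and so on). The cascade started by `drop` is defined because
-- every decrement consumes one occurrence, while freeing a cell merely moves the occurrences of its
-- contents to the list of pending ones (`StoreFits.exists_decr`).
--
-- Finally, if no value is reachable, progress gives a successor to every reachable configuration,
-- and choice yields an infinite reduction.

theorem Ty.induct {p : Ty → Prop} (var : ∀ i, p (.var i))
    (arrow : ∀ aq τ₁ τ₂, p τ₁ → p τ₂ → p (.arrow aq τ₁ τ₂))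
    (prod : ∀ τ₁ τ₂, p τ₁ → p τ₂ → p (.prod τ₁ τ₂))
    (sum : ∀ τ₁ τ₂, p τ₁ → p τ₂ → p (.sum τ₁ τ₂)) (unit : p .unit)
    (ref : ∀ rq τ, p τ → p (.ref rq τ))
    (all : ∀ n P τ, (∀ c ∈ P, p c.2) → p τ → p (.all n P τ)) (τ : Ty) : p τ :=
  -- The recursor of the nested type has extra motives for lists and pairs; these choices make the
  -- hypothesis for a constraint speak about its members.
  Ty.rec (motive_1 := p) (motive_2 := fun P => ∀ c ∈ P, p c.2) (motive_3 := fun c => p c.2)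
    var arrow prod sum unit ref all (by simp)
    (fun _ _ hc hP => by simpa using ⟨hc, fun a b h => hP (a, b) h⟩) (fun _ _ h => h) τ

/-- Replaces the mutual recursion by `List.map`, so that equalities on constraints reduce to
equalities on members. -/
theorem Constraint.rename_eq_map (r : ℕ → ℕ) (P : Constraint) :
    Constraint.rename r P = P.map fun c => (c.1, c.2.rename r) := by
  induction P with
  | nil => simp [Constraint.rename]
  | cons c P ih => cases c; simp [Constraint.rename, Pred.rename, ih]

theorem Constraint.subst_eq_map (s : ℕ → Ty) (P : Constraint) :
    Constraint.subst s P = P.map fun c => (c.1, c.2.subst s) := by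
  induction P with
  | nil => simp [Constraint.subst]
  | cons c P ih => cases c; simp [Constraint.subst, Pred.subst, ih]

theorem liftRen_comp (n : ℕ) (r r' : ℕ → ℕ) (i : ℕ) :
    liftRen n r' (liftRen n r i) = liftRen n (fun j => r' (r j)) i := by
  unfold liftRen
  by_cases h : i < n <;> simp [h]

/-- The first of four composition laws. Lifting a substitution involves a shift, which is a
renaming; so `Ty.subst_rename` needs this law under binders, and `Ty.subst_subst` needs both mixed
laws. -/
theorem Ty.rename_rename (τ : Ty) : ∀ r r' : ℕ → ℕ,
    (τ.rename r).rename r' = τ.rename fun i => r' (r i) := by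
  induction τ using Ty.induct with
  | all n P τ hP hτ =>
    intro r r'
    simp only [Ty.rename, Constraint.rename_eq_map, List.map_map, hτ, liftRen_comp]
    congr 1
    refine List.map_congr_left fun c hc => ?_
    simp [hP c hc, liftRen_comp]
  | _ => simp_all [Ty.rename]

theorem Ty.shift_rename_liftRen (τ : Ty) (n : ℕ) (r : ℕ → ℕ) :
    (τ.shift n).rename (liftRen n r) = (τ.rename r).shift n := by
  simp [Ty.shift, Ty.rename_rename, liftRen]

theorem liftTySub_liftRen (n : ℕ) (r : ℕ → ℕ) (s : ℕ → Ty) :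
    (fun i => liftTySub n s (liftRen n r i)) = liftTySub n fun j => s (r j) := by
  funext i
  unfold liftRen liftTySub
  by_cases h : i < n <;> simp [h]

theorem Ty.rename_subst (τ : Ty) : ∀ (r : ℕ → ℕ) (s : ℕ → Ty),
    (τ.rename r).subst s = τ.subst fun i => s (r i) := by
  induction τ using Ty.induct with
  | all n P τ hP hτ =>
    intro r s
    simp only [Ty.rename, Ty.subst, Constraint.rename_eq_map, Constraint.subst_eq_map,
      List.map_map, hτ, liftTySub_liftRen]
    congr 1
    refine List.map_congr_left fun c hc => ?_
    simp [hP c hc, liftTySub_liftRen]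
  | _ => simp_all [Ty.rename, Ty.subst]

theorem liftTySub_rename (n : ℕ) (s : ℕ → Ty) (r : ℕ → ℕ) :
    (fun i => (liftTySub n s i).rename (liftRen n r)) = liftTySub n fun i => (s i).rename r := by
  funext i
  unfold liftTySub
  by_cases h : i < n
  · simp [h, Ty.rename, liftRen]
  · simp [h, Ty.shift_rename_liftRen]

theorem Ty.subst_rename (τ : Ty) : ∀ (s : ℕ → Ty) (r : ℕ → ℕ),
    (τ.subst s).rename r = τ.subst fun i => (s i).rename r := by
  induction τ using Ty.induct with
  | all n P τ hP hτ =>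
    intro s r
    simp only [Ty.rename, Ty.subst, Constraint.rename_eq_map, Constraint.subst_eq_map,
      List.map_map, hτ, liftTySub_rename]
    congr 1
    refine List.map_congr_left fun c hc => ?_
    simp [hP c hc, liftTySub_rename]
  | _ => simp_all [Ty.rename, Ty.subst]

theorem Ty.shift_subst_liftTySub (τ : Ty) (n : ℕ) (s : ℕ → Ty) :
    (τ.shift n).subst (liftTySub n s) = (τ.subst s).shift n := by
  simp [Ty.shift, Ty.rename_subst, Ty.subst_rename, liftTySub]

theorem liftTySub_subst (n : ℕ) (s t : ℕ → Ty) :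
    (fun i => (liftTySub n s i).subst (liftTySub n t)) =
      liftTySub n fun i => (s i).subst t := by
  funext i
  by_cases h : i < n
  · simp [liftTySub, h, Ty.subst]
  · have : liftTySub n s i = (s (i - n)).shift n := by simp [liftTySub, h]
    rw [this, Ty.shift_subst_liftTySub]
    simp [liftTySub, h]

theorem Ty.subst_subst (τ : Ty) : ∀ s t : ℕ → Ty,
    (τ.subst s).subst t = τ.subst fun i => (s i).subst t := by
  induction τ using Ty.induct with
  | all n P τ hP hτ =>
    intro s t
    simp only [Ty.subst, Constraint.subst_eq_map, List.map_map, hτ, liftTySub_subst]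
    congr 1
    refine List.map_congr_left fun c hc => ?_
    simp [hP c hc, liftTySub_subst]
  | _ => simp_all [Ty.subst]

theorem liftTySub_var (n : ℕ) (r : ℕ → ℕ) :
    liftTySub n (fun i => .var (r i)) = fun i => .var (liftRen n r i) := by
  funext i
  unfold liftTySub liftRen
  by_cases h : i < n <;> simp [h, Ty.shift, Ty.rename]

/-- Makes a shift a special substitution, so that weakening to a larger type scope needs no separate
induction. -/
theorem Ty.subst_var_comp (τ : Ty) : ∀ r : ℕ → ℕ, (τ.subst fun i => .var (r i)) = τ.rename r := by
  induction τ using Ty.induct with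
  | all n P τ hP hτ =>
    intro r
    simp only [Ty.subst, Ty.rename, Constraint.subst_eq_map, Constraint.rename_eq_map,
      liftTySub_var, hτ]
    congr 1
    refine List.map_congr_left fun c hc => ?_
    simp [hP c hc]
  | _ => simp_all [Ty.subst, Ty.rename]

theorem Ty.rename_id (τ : Ty) : ∀ r : ℕ → ℕ, (∀ i, r i = i) → τ.rename r = τ := by
  induction τ using Ty.induct with
  | all n P τ hP hτ =>
    intro r hr
    have h : ∀ i, liftRen n r i = i := fun i => by
      unfold liftRen
      split_ifs with h
      · rfl
      · rw [hr]; omega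
    simp only [Ty.rename, Constraint.rename_eq_map, hτ _ h]
    congr 1
    conv_rhs => rw [← List.map_id P]
    refine List.map_congr_left fun c hc => ?_
    simp [hP c hc _ h]
  | _ => simp_all [Ty.rename]

theorem Ty.subst_var (τ : Ty) : τ.subst .var = τ :=
  (Ty.subst_var_comp τ fun i => i).trans (Ty.rename_id τ _ fun _ => rfl)

theorem Ty.shift_subst_instTys (τ : Ty) (τs : List Ty) :
    (τ.shift τs.length).subst (instTys τs) = τ := by
  rw [Ty.shift, Ty.rename_subst]
  conv_rhs => rw [← Ty.subst_var τ]
  congr 1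
  funext i
  simp [instTys]

/-- Instantiation commutes with substitution; this is what the type application rule needs in
`HasOccTy.tsubst`. -/
theorem Ty.subst_instTys_subst (τ : Ty) (τs : List Ty) (s : ℕ → Ty) :
    (τ.subst (instTys τs)).subst s =
      (τ.subst (liftTySub τs.length s)).subst (instTys (τs.map (Ty.subst s))) := by
  rw [Ty.subst_subst, Ty.subst_subst]
  congr 1
  funext i
  by_cases h : i < τs.length
  · simp [instTys, liftTySub, h, Ty.subst]
  -- The shift is written with the length of the mapped list, so that instantiating with that list
  -- cancels it.
  · have : liftTySub τs.length s i = (s (i - τs.length)).shift (τs.map (Ty.subst s)).length := by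
      simp [liftTySub, h]
    rw [this, Ty.shift_subst_instTys]
    have h' : τs[i]? = none := by simpa using h
    simp [instTys, h', Ty.subst]

/-! ## Type equality -/

/-- Constraints with the same members up to type equality. -/
def ConstraintEq (P Q : Constraint) : Prop :=
  (∀ c ∈ P, ∃ c' ∈ Q, c'.1 = c.1 ∧ TyEq c.2 c'.2) ∧ ∀ c ∈ Q, ∃ c' ∈ P, c'.1 = c.1 ∧ TyEq c.2 c'.2

theorem ConstraintEq.symm {P Q : Constraint} (h : ConstraintEq P Q) : ConstraintEq Q P :=
  ⟨h.2, h.1⟩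

theorem ConstraintEq.trans {P Q R : Constraint} (h : ConstraintEq P Q) (h' : ConstraintEq Q R) :
    ConstraintEq P R := by
  constructor
  · intro c hc
    obtain ⟨d, hd, hdc, hcd⟩ := h.1 c hc
    obtain ⟨e, he, hed, hde⟩ := h'.1 d hd
    exact ⟨e, he, hed.trans hdc, hcd.trans hde⟩
  · intro c hc
    obtain ⟨d, hd, hdc, hcd⟩ := h'.2 c hc
    obtain ⟨e, he, hed, hde⟩ := h.2 d hd
    exact ⟨e, he, hed.trans hdc, hcd.trans hde⟩

theorem ConstraintEq.refl (P : Constraint) : ConstraintEq P P :=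
  ⟨fun c hc => ⟨c, hc, rfl, .refl _⟩, fun c hc => ⟨c, hc, rfl, .refl _⟩⟩

/-- The same head constructor, with equal immediate components. -/
def HeadEq : Ty → Ty → Prop
  | .var i, .var j => i = j
  | .arrow aq τ₁ τ₂, .arrow aq' τ₁' τ₂' => aq = aq' ∧ TyEq τ₁ τ₁' ∧ TyEq τ₂ τ₂'
  | .prod τ₁ τ₂, .prod τ₁' τ₂' => TyEq τ₁ τ₁' ∧ TyEq τ₂ τ₂'
  | .sum τ₁ τ₂, .sum τ₁' τ₂' => TyEq τ₁ τ₁' ∧ TyEq τ₂ τ₂'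
  | .unit, .unit => True
  | .ref rq τ, .ref rq' τ' => rq = rq' ∧ TyEq τ τ'
  | .all n P τ, .all n' P' τ' => n = n' ∧ ConstraintEq P P' ∧ TyEq τ τ'
  | _, _ => False

/-- With symmetry and transitivity as rules, `TyEq` cannot be inverted by cases. `HeadEq` is closed
under all the rules, so it yields injectivity and disjointness of the type constructors up to
identification. -/
theorem TyEq.headEq {τ τ' : Ty} (h : TyEq τ τ') : HeadEq τ τ' := by
  induction h with
  | refl τ => cases τ <;> simp [HeadEq, TyEq.refl, ConstraintEq.refl]
  | @symm τ τ' _ ih =>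
    cases τ <;> cases τ' <;> simp only [HeadEq] at ih ⊢ <;>
      first | exact ih.symm | exact ⟨ih.1.symm, ih.2.symm⟩
            | exact ⟨ih.1.symm, ih.2.1.symm, ih.2.2.symm⟩
  | @trans τ τ' τ'' _ _ ih ih' =>
    cases τ <;> cases τ' <;> simp only [HeadEq] at ih <;> cases τ'' <;>
      simp only [HeadEq] at ih' ⊢ <;>
      first | exact ih.trans ih' | exact ⟨ih.1.trans ih'.1, ih.2.trans ih'.2⟩
            | exact ⟨ih.1.trans ih'.1, ih.2.1.trans ih'.2.1, ih.2.2.trans ih'.2.2⟩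
  | arrow aq h₁ h₂ => exact ⟨rfl, h₁, h₂⟩
  | prod h₁ h₂ => exact ⟨h₁, h₂⟩
  | sum h₁ h₂ => exact ⟨h₁, h₂⟩
  | ref rq h => exact ⟨rfl, h⟩
  | allBody n P h => exact ⟨rfl, .refl P, h⟩
  | @allHead n K P τ τ₁ τ₁' h _ =>
    refine ⟨rfl, ⟨?_, ?_⟩, .refl τ⟩
    · rintro c (_ | ⟨_, hc⟩)
      · exact ⟨_, List.mem_cons_self, rfl, h⟩
      · exact ⟨c, List.mem_cons_of_mem _ hc, rfl, .refl _⟩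
    · rintro c (_ | ⟨_, hc⟩)
      · exact ⟨_, List.mem_cons_self, rfl, h.symm⟩
      · exact ⟨c, List.mem_cons_of_mem _ hc, rfl, .refl _⟩
  | allSet n τ h =>
    exact ⟨rfl, ⟨fun c hc => ⟨c, (h c).1 hc, rfl, .refl _⟩,
      fun c hc => ⟨c, (h c).2 hc, rfl, .refl _⟩⟩, .refl τ⟩

theorem TyEq.subst {τ τ' : Ty} (h : TyEq τ τ') : ∀ s : ℕ → Ty, TyEq (τ.subst s) (τ'.subst s) := by
  induction h with
  | refl τ => exact fun s => .refl _
  | symm _ ih => exact fun s => (ih s).symm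
  | trans _ _ ih ih' => exact fun s => (ih s).trans (ih' s)
  | arrow aq _ _ ih₁ ih₂ => exact fun s => by simpa [Ty.subst] using .arrow aq (ih₁ s) (ih₂ s)
  | prod _ _ ih₁ ih₂ => exact fun s => by simpa [Ty.subst] using .prod (ih₁ s) (ih₂ s)
  | sum _ _ ih₁ ih₂ => exact fun s => by simpa [Ty.subst] using .sum (ih₁ s) (ih₂ s)
  | ref rq _ ih => exact fun s => by simpa [Ty.subst] using .ref rq (ih s)
  | allBody n P _ ih => exact fun s => by simpa [Ty.subst] using .allBody n _ (ih _)
  | allHead n K P τ _ ih =>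
    exact fun s => by
      simpa [Ty.subst, Constraint.subst, Pred.subst] using .allHead n K _ _ (ih _)
  | @allSet n P Q τ h =>
    intro s
    simp only [Ty.subst, Constraint.subst_eq_map]
    exact .allSet n _ fun c => by simp [List.mem_map, h]

/-! ## Entailment -/

/-- Each instance looks only at the head constructor and immediate components, which `TyEq.headEq`
transports; hypotheses are already closed under identification. -/
theorem Entails.congr {P : Constraint} {K : PredCon} {τ τ' : Ty} (h : Entails P K τ) :
    TyEq τ τ' → Entails P K τ' := by
  induction h generalizing τ' with
  | hyp hm he => exact fun h' => .hyp hm (he.trans h')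
  | prod _ _ ih₁ ih₂ =>
    intro h'
    have := h'.headEq
    cases τ' <;> simp only [HeadEq] at this
    exact .prod (ih₁ this.1) (ih₂ this.2)
  | sum _ _ ih₁ ih₂ =>
    intro h'
    have := h'.headEq
    cases τ' <;> simp only [HeadEq] at this
    exact .sum (ih₁ this.1) (ih₂ this.2)
  | unit =>
    intro h'
    have := h'.headEq
    cases τ' <;> simp only [HeadEq] at this
    exact .unit
  | arrowU =>
    intro h'
    have := h'.headEq
    cases τ' <;> simp only [HeadEq] at this
    obtain ⟨rfl, _⟩ := this
    exact .arrowU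
  | dupArrowR =>
    intro h'
    have := h'.headEq
    cases τ' <;> simp only [HeadEq] at this
    obtain ⟨rfl, _⟩ := this
    exact .dupArrowR
  | dropArrowA =>
    intro h'
    have := h'.headEq
    cases τ' <;> simp only [HeadEq] at this
    obtain ⟨rfl, _⟩ := this
    exact .dropArrowA
  | dupRefW =>
    intro h'
    have := h'.headEq
    cases τ' <;> simp only [HeadEq] at this
    obtain ⟨rfl, _⟩ := this
    exact .dupRefW
  | dropRef _ ih =>
    intro h'
    have := h'.headEq
    cases τ' <;> simp only [HeadEq] at this
    exact .dropRef (ih this.2)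

/-- The instances are schematic, so only uses of hypotheses change: each is replaced by its
derivation from `Q`. -/
theorem Entails.subst {P Q : Constraint} {K : PredCon} {τ : Ty} {s : ℕ → Ty}
    (h : Entails P K τ) (hQ : EntailsAll Q (Constraint.subst s P)) : Entails Q K (τ.subst s) := by
  induction h with
  | @hyp K τ τ' hm he =>
    refine Entails.congr ?_ (he.subst s)
    refine hQ (K, τ.subst s) ?_
    rw [Constraint.subst_eq_map]
    exact List.mem_map.2 ⟨_, hm, rfl⟩
  | prod _ _ ih₁ ih₂ => exact .prod ih₁ ih₂
  | sum _ _ ih₁ ih₂ => exact .sum ih₁ ih₂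
  | unit => exact .unit
  | arrowU => exact .arrowU
  | dupArrowR => exact .dupArrowR
  | dropArrowA => exact .dropArrowA
  | dupRefW => exact .dupRefW
  | dropRef _ ih => exact .dropRef ih

theorem Entails.of_mem {P : Constraint} {c : PredCon × Ty} (h : c ∈ P) : Entails P c.1 c.2 :=
  .hyp h (.refl _)

theorem Ty.shift_eq_subst (τ : Ty) (n : ℕ) : τ.shift n = τ.subst fun i => .var (i + n) :=
  (Ty.subst_var_comp τ _).symm

/-- Carries the assumption of the type substitution lemma under a type abstraction. The outer
constraints are weakened by a shift, itself a substitution, so `Entails.subst` applies again; those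
of the binder are hypotheses on both sides. -/
theorem EntailsAll.append_subst {P Q : Constraint} {n : ℕ} {s : ℕ → Ty} (R : Constraint)
    (h : EntailsAll Q (Constraint.subst s P)) :
    EntailsAll (Constraint.shift n Q ++ Constraint.subst (liftTySub n s) R)
      (Constraint.subst (liftTySub n s) (Constraint.shift n P ++ R)) := by
  intro c hc
  rw [Constraint.subst_eq_map, List.map_append, List.mem_append] at hc
  rcases hc with hc | hc
  · simp only [Constraint.shift, List.map_map, List.mem_map, Function.comp_apply] at hc
    obtain ⟨d, hd, rfl⟩ := hc
    simp only [Ty.shift_subst_liftTySub]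
    have := h (d.1, d.2.subst s) (by rw [Constraint.subst_eq_map]; exact List.mem_map.2 ⟨d, hd, rfl⟩)
    rw [Ty.shift_eq_subst]
    refine this.subst fun c hc => Entails.of_mem (List.mem_append_left _ ?_)
    rw [Constraint.subst_eq_map] at hc
    simpa only [Constraint.shift, Ty.shift_eq_subst] using hc
  · rw [← Constraint.subst_eq_map] at hc
    exact Entails.of_mem (List.mem_append_right _ hc)

/-- All constraints are on type variables. -/
def Constraint.OnVars (P : Constraint) : Prop := ∀ c ∈ P, ∃ i, c.2 = .var i

theorem Constraint.OnVars.shift_append {P Q : Constraint} {n : ℕ} (hP : P.OnVars)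
    (hQ : ∀ c ∈ Q, ∃ i < n, c.2 = Ty.var i) : (Constraint.shift n P ++ Q).OnVars := by
  intro c hc
  rcases List.mem_append.1 hc with hc | hc
  · obtain ⟨d, hd, rfl⟩ := List.mem_map.1 hc
    obtain ⟨i, hi⟩ := hP d hd
    exact ⟨i + n, by simp [hi, Ty.shift, Ty.rename]⟩
  · obtain ⟨i, _, hi⟩ := hQ c hc
    exact ⟨i, hi⟩

/-- A hypothesis on a type variable cannot be identified with a compound type, so the entailment
must end in an instance. The next lemmas invert entailment at the other type formers in the same
way. -/
theorem Entails.requires_of_arrow {P : Constraint} {K : PredCon} {aq : ArrowQual} {τ₁ τ₂ : Ty}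
    (hP : P.OnVars) (h : Entails P K (.arrow aq τ₁ τ₂)) : aq.Requires K := by
  cases h with
  | hyp hm he =>
    obtain ⟨i, hi⟩ := hP _ hm
    simp only at hi
    subst hi
    exact he.headEq.elim
  | arrowU => trivial
  | dupArrowR => rfl
  | dropArrowA => rfl

theorem Entails.of_prod {P : Constraint} {K : PredCon} {τ₁ τ₂ : Ty}
    (hP : P.OnVars) (h : Entails P K (.prod τ₁ τ₂)) : Entails P K τ₁ ∧ Entails P K τ₂ := by
  cases h with
  | hyp hm he =>
    obtain ⟨i, hi⟩ := hP _ hm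
    simp only at hi
    subst hi
    exact he.headEq.elim
  | prod h₁ h₂ => exact ⟨h₁, h₂⟩

theorem Entails.of_sum {P : Constraint} {K : PredCon} {τ₁ τ₂ : Ty}
    (hP : P.OnVars) (h : Entails P K (.sum τ₁ τ₂)) : Entails P K τ₁ ∧ Entails P K τ₂ := by
  cases h with
  | hyp hm he =>
    obtain ⟨i, hi⟩ := hP _ hm
    simp only at hi
    subst hi
    exact he.headEq.elim
  | sum h₁ h₂ => exact ⟨h₁, h₂⟩

theorem Entails.not_all {P : Constraint} {K : PredCon} {n : ℕ} {Q : Constraint} {τ : Ty}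
    (hP : P.OnVars) : ¬ Entails P K (.all n Q τ) := by
  intro h
  cases h with
  | hyp hm he =>
    obtain ⟨i, hi⟩ := hP _ hm
    simp only at hi
    subst hi
    exact he.headEq.elim

theorem Entails.not_dup_ref_s {P : Constraint} {τ : Ty}
    (hP : P.OnVars) : ¬ Entails P .Dup (.ref .s τ) := by
  intro h
  cases h with
  | hyp hm he =>
    obtain ⟨i, hi⟩ := hP _ hm
    simp only at hi
    subst hi
    exact he.headEq.elim

/-! ## Typing with multisets of location occurrences -/

/-- An occurrence of a location, with its qualifier and the type of its contents. -/
abbrev Occ : Type := Loc × RefQual × Ty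

namespace Occ

/-- Substitution in the type of an occurrence. -/
def subst (s : ℕ → Ty) (a : Occ) : Occ := (a.1, a.2.1, a.2.2.subst s)

def shift (n : ℕ) (a : Occ) : Occ := (a.1, a.2.1, a.2.2.shift n)

/-- The type of an occurrence. -/
def refTy (a : Occ) : Ty := .ref a.2.1 a.2.2

end Occ

/-- `EntailsConstrain` for multisets of occurrences. -/
def EntailsOcc (P : Constraint) (aq : ArrowQual) (Γ : VarCtx) (M : Multiset Occ) : Prop :=
  ∀ K, aq.Requires K →
    (∀ x τ, Γ x = some τ → Entails P K τ) ∧ ∀ a ∈ M, Entails P K a.refTy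

/-- Term typing, where the location context is the multiset of the occurrences in the term.
The compatibility of the occurrences is not part of the rules. -/
inductive HasOccTy : Constraint → VarCtx → Multiset Occ → Term → Ty → Prop
  | conv {P : Constraint} {Γ : VarCtx} {M : Multiset Occ} {e : Term} {τ τ' : Ty} :
      HasOccTy P Γ M e τ → TyEq τ τ' → HasOccTy P Γ M e τ'
  | var {P : Constraint} {x : ℕ} {τ : Ty} :
      HasOccTy P (VarCtx.single x τ) 0 (.var x) τ
  | tabs {P₁ P₂ : Constraint} {Γ : VarCtx} {M : Multiset Occ} {n : ℕ} {v : Term} {τ : Ty} :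
      v.IsValue →
      HasOccTy (P₁.shift n ++ P₂) (Γ.tshift n) (M.map (Occ.shift n)) v τ →
      (∀ c ∈ P₂, ∃ i < n, c.2 = .var i) →
      HasOccTy P₁ Γ M (.tabs n P₂ v) (.all n P₂ τ)
  | tapp {P₁ P₂ : Constraint} {Γ : VarCtx} {M : Multiset Occ} {n : ℕ} {e : Term} {τ : Ty}
      {τs : List Ty} :
      HasOccTy P₁ Γ M e (.all n P₂ τ) → τs.length = n →
      EntailsAll P₁ (Constraint.subst (instTys τs) P₂) →
      HasOccTy P₁ Γ M (.tapp e τs) (τ.subst (instTys τs))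
  | lam {P : Constraint} {Γ : VarCtx} {M : Multiset Occ} {aq : ArrowQual} {e : Term}
      {τ₁ τ₂ : Ty} :
      HasOccTy P (Γ.cons τ₁) M e τ₂ → EntailsOcc P aq Γ M →
      HasOccTy P Γ M (.lam aq τ₁ e) (.arrow aq τ₁ τ₂)
  | app {P : Constraint} {Γ Γ₁ Γ₂ : VarCtx} {M₁ M₂ : Multiset Occ} {aq : ArrowQual}
      {e₁ e₂ : Term} {τ₂ τ : Ty} :
      HasOccTy P Γ₁ M₁ e₁ (.arrow aq τ₂ τ) → HasOccTy P Γ₂ M₂ e₂ τ₂ → Γ.Splits Γ₁ Γ₂ →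
      HasOccTy P Γ (M₁ + M₂) (.app e₁ e₂) τ
  | unit {P : Constraint} : HasOccTy P VarCtx.empty 0 .unit .unit
  | pair {P : Constraint} {Γ Γ₁ Γ₂ : VarCtx} {M₁ M₂ : Multiset Occ} {e₁ e₂ : Term} {τ₁ τ₂ : Ty} :
      HasOccTy P Γ₁ M₁ e₁ τ₁ → HasOccTy P Γ₂ M₂ e₂ τ₂ → Γ.Splits Γ₁ Γ₂ →
      HasOccTy P Γ (M₁ + M₂) (.pair e₁ e₂) (.prod τ₁ τ₂)
  | letPair {P : Constraint} {Γ Γ₁ Γ₂ : VarCtx} {M₁ M₂ : Multiset Occ} {e₁ e₂ : Term}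
      {τ₁ τ₂ τ : Ty} :
      HasOccTy P Γ₁ M₁ e₁ (.prod τ₁ τ₂) → HasOccTy P ((Γ₂.cons τ₁).cons τ₂) M₂ e₂ τ →
      Γ.Splits Γ₁ Γ₂ →
      HasOccTy P Γ (M₁ + M₂) (.letPair e₁ e₂) τ
  | inl {P : Constraint} {Γ : VarCtx} {M : Multiset Occ} {e : Term} {τ₁ τ₂ : Ty} :
      HasOccTy P Γ M e τ₁ → HasOccTy P Γ M (.inl e) (.sum τ₁ τ₂)
  | inr {P : Constraint} {Γ : VarCtx} {M : Multiset Occ} {e : Term} {τ₁ τ₂ : Ty} :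
      HasOccTy P Γ M e τ₂ → HasOccTy P Γ M (.inr e) (.sum τ₁ τ₂)
  | caseOf {P : Constraint} {Γ Γ₁ Γ₂ : VarCtx} {M₁ M₂ : Multiset Occ} {e₁ e₂₁ e₂₂ : Term}
      {τ₁₁ τ₁₂ τ₂ : Ty} :
      HasOccTy P Γ₁ M₁ e₁ (.sum τ₁₁ τ₁₂) →
      HasOccTy P (Γ₂.cons τ₁₁) M₂ e₂₁ τ₂ → HasOccTy P (Γ₂.cons τ₁₂) M₂ e₂₂ τ₂ →
      Γ.Splits Γ₁ Γ₂ →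
      HasOccTy P Γ (M₁ + M₂) (.caseOf e₁ e₂₁ e₂₂) τ₂
  | dup {P : Constraint} {Γ Γ₁ Γ₂ : VarCtx} {M₁ M₂ : Multiset Occ} {e₁ e₂ : Term} {τ₁ τ₂ : Ty} :
      HasOccTy P Γ₁ M₁ e₁ τ₁ → HasOccTy P ((Γ₂.cons τ₁).cons τ₁) M₂ e₂ τ₂ → Entails P .Dup τ₁ →
      Γ.Splits Γ₁ Γ₂ →
      HasOccTy P Γ (M₁ + M₂) (.dup e₁ e₂) τ₂
  | drop {P : Constraint} {Γ Γ₁ Γ₂ : VarCtx} {M₁ M₂ : Multiset Occ} {e₁ e₂ : Term} {τ₁ τ₂ : Ty} :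
      HasOccTy P Γ₁ M₁ e₁ τ₁ → HasOccTy P Γ₂ M₂ e₂ τ₂ → Entails P .Drop τ₁ →
      Γ.Splits Γ₁ Γ₂ →
      HasOccTy P Γ (M₁ + M₂) (.drop e₁ e₂) τ₂
  | new {P : Constraint} {Γ : VarCtx} {M : Multiset Occ} {rq : RefQual} {e : Term} {τ : Ty} :
      HasOccTy P Γ M e τ → HasOccTy P Γ M (.new rq e) (.ref rq τ)
  | loc {P : Constraint} {l : Loc} {rq : RefQual} {τ : Ty} :
      HasOccTy P VarCtx.empty {(l, rq, τ)} (.loc l) (.ref rq τ)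
  | releaseW {P : Constraint} {Γ : VarCtx} {M : Multiset Occ} {rq : RefQual} {e : Term}
      {τ : Ty} :
      HasOccTy P Γ M e (.ref rq τ) → HasOccTy P Γ M (.release .w e) (.sum τ .unit)
  | releaseS {P : Constraint} {Γ : VarCtx} {M : Multiset Occ} {e : Term} {τ : Ty} :
      HasOccTy P Γ M e (.ref .s τ) → HasOccTy P Γ M (.release .s e) τ
  | swapW {P : Constraint} {Γ Γ₁ Γ₂ : VarCtx} {M₁ M₂ : Multiset Occ} {rq : RefQual}
      {e₁ e₂ : Term} {τ : Ty} :
      HasOccTy P Γ₁ M₁ e₁ (.ref rq τ) → HasOccTy P Γ₂ M₂ e₂ τ → Γ.Splits Γ₁ Γ₂ →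
      HasOccTy P Γ (M₁ + M₂) (.swap .w e₁ e₂) (.prod (.ref rq τ) τ)
  | swapS {P : Constraint} {Γ Γ₁ Γ₂ : VarCtx} {M₁ M₂ : Multiset Occ} {e₁ e₂ : Term}
      {τ₁ τ₂ : Ty} :
      HasOccTy P Γ₁ M₁ e₁ (.ref .s τ₁) → HasOccTy P Γ₂ M₂ e₂ τ₂ → Γ.Splits Γ₁ Γ₂ →
      HasOccTy P Γ (M₁ + M₂) (.swap .s e₁ e₂) (.prod (.ref .s τ₂) τ₁)

/-! ## Location contexts as multisets of occurrences -/

/-- The occurrences of `l` described by an entry. -/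
def LocEntry.occs (l : Loc) : LocEntry → Multiset Occ
  | .strong τ => {(l, .s, τ)}
  | .weak k τ => Multiset.replicate k (l, .w, τ)

/-- The occurrences of `l` described by an optional entry. -/
def LocEntry.optOccs (l : Loc) : Option LocEntry → Multiset Occ
  | none => 0
  | some a => a.occs l

/-- The occurrences of one location in a multiset. -/
def occsAt (l : Loc) (M : Multiset Occ) : Multiset Occ := M.filter fun a => a.1 = l

theorem occsAt_add (l : Loc) (M N : Multiset Occ) :
    occsAt l (M + N) = occsAt l M + occsAt l N := Multiset.filter_add _ _ _

theorem mem_of_mem_occsAt {l : Loc} {M : Multiset Occ} {a : Occ} (h : a ∈ occsAt l M) : a ∈ M :=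
  Multiset.mem_of_mem_filter h

theorem mem_occsAt {l : Loc} {M : Multiset Occ} {a : Occ} : a ∈ occsAt l M ↔ a ∈ M ∧ a.1 = l :=
  Multiset.mem_filter

theorem LocEntry.fst_of_mem_occs {l : Loc} {b : LocEntry} {a : Occ} (h : a ∈ b.occs l) :
    a.1 = l := by
  cases b with
  | strong τ => simp [occs] at h; simp [h]
  | weak k τ => simp [occs, Multiset.mem_replicate] at h; simp [h]

theorem LocEntry.occsAt_occs_self (l : Loc) (b : LocEntry) : occsAt l (b.occs l) = b.occs l :=
  Multiset.filter_eq_self.2 fun _ h => fst_of_mem_occs h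

theorem LocEntry.occsAt_occs_of_ne {l l' : Loc} (b : LocEntry) (h : l ≠ l') :
    occsAt l (b.occs l') = 0 :=
  Multiset.filter_eq_nil.2 fun _ ha hl => h (hl.symm.trans (fst_of_mem_occs ha))

theorem eq_of_occsAt_eq {M N : Multiset Occ} (h : ∀ l, occsAt l M = occsAt l N) : M = N := by
  classical
  ext a
  have : ∀ M : Multiset Occ, M.count a = (occsAt a.1 M).count a := fun M => by
    simp [occsAt]
  rw [this, this N, h]

/-- `S` describes the occurrences in `M`; all counts in `S` are positive. -/
def Describes (S : LocCtx) (M : Multiset Occ) : Prop :=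
  ∀ l, occsAt l M = LocEntry.optOccs l (S l) ∧ ∀ τ, S l ≠ some (.weak 0 τ)

theorem Describes.unique {S : LocCtx} {M N : Multiset Occ} (h : Describes S M)
    (h' : Describes S N) : M = N :=
  eq_of_occsAt_eq fun l => (h l).1.trans (h' l).1.symm

/-- Zero counts have to be excluded: a weak entry with count zero has the same occurrences as no
entry at all, namely none. -/
theorem LocEntry.optOccs_injective {l : Loc} {a b : Option LocEntry}
    (ha : ∀ τ, a ≠ some (.weak 0 τ)) (hb : ∀ τ, b ≠ some (.weak 0 τ))
    (h : optOccs l a = optOccs l b) : a = b := by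
  rcases a with _ | (τ | ⟨_ | k, τ⟩) <;> rcases b with _ | (τ' | ⟨_ | k', τ'⟩) <;>
    simp_all [optOccs, occs, Multiset.replicate_succ]
  · have := h ▸ Multiset.mem_cons_self ((l, .w, τ) : Occ) (Multiset.replicate k (l, .w, τ))
    simp at this
  -- Two weak entries: cardinality identifies the counts, and membership of one element then
  -- identifies the types.
  · have hc := congrArg Multiset.card h
    simp at hc
    subst hc
    have := h ▸ Multiset.mem_cons_self ((l, .w, τ) : Occ) (Multiset.replicate k (l, .w, τ))
    rw [← Multiset.replicate_succ] at this
    have := Multiset.eq_of_mem_replicate this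
    simp_all

theorem Describes.unique_left {S S' : LocCtx} {M : Multiset Occ} (h : Describes S M)
    (h' : Describes S' M) : S = S' :=
  funext fun l => LocEntry.optOccs_injective (h l).2 (h' l).2 ((h l).1.symm.trans (h' l).1)

theorem Describes.empty : Describes LocCtx.empty 0 := fun l => by
  simp [LocCtx.empty, LocEntry.optOccs, occsAt]

theorem Describes.extend {S : LocCtx} {M : Multiset Occ} {l : Loc} {a : LocEntry}
    (h : Describes S M) (hl : S l = none) (ha : ∀ τ, a ≠ .weak 0 τ) :
    Describes (S.extend l a) (a.occs l + M) := by
  intro l'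
  by_cases hl' : l' = l
  · subst hl'
    have := (h l').1
    rw [hl] at this
    simp [LocCtx.extend, occsAt_add, this, LocEntry.optOccs, LocEntry.occsAt_occs_self, ha]
  · simpa [LocCtx.extend, hl', occsAt_add, LocEntry.occsAt_occs_of_ne a hl'] using h l'

theorem Describes.single {l : Loc} {a : LocEntry} (ha : ∀ τ, a ≠ .weak 0 τ) :
    Describes (LocCtx.single l a) (a.occs l) := by
  simpa [LocCtx.single] using Describes.empty.extend (l := l) rfl ha

/-- Removing one location from a context. -/
theorem Describes.exists_eq_add {S : LocCtx} {M : Multiset Occ} {l : Loc} {a : LocEntry}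
    (h : Describes (S.extend l a) M) (hl : S l = none) :
    ∃ N, M = a.occs l + N ∧ Describes S N := by
  have hM : M = a.occs l + M.filter fun b => ¬ b.1 = l := by
    have := (h l).1
    simp only [LocCtx.extend, Function.update_self, LocEntry.optOccs] at this
    rw [← this, occsAt, Multiset.filter_add_not]
  refine ⟨_, hM, fun l' => ?_⟩
  by_cases hl' : l' = l
  · subst hl'
    simp [hl, LocEntry.optOccs, occsAt, Multiset.filter_filter]
  · have := h l'
    rw [hM] at this
    simpa [LocCtx.extend, hl', occsAt_add, LocEntry.occsAt_occs_of_ne _ hl'] using this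

theorem Describes.join {S S₁ S₂ : LocCtx} {M₁ M₂ : Multiset Occ} (h₁ : Describes S₁ M₁)
    (h₂ : Describes S₂ M₂) (hS : S.Splits S₁ S₂) : Describes S (M₁ + M₂) := by
  obtain ⟨hc, rfl⟩ := hS
  intro l
  rw [occsAt_add, (h₁ l).1, (h₂ l).1]
  have p₁ := (h₁ l).2
  have p₂ := (h₂ l).2
  simp only [LocCtx.join]
  cases hs₁ : S₁ l with
  | none => cases hs₂ : S₂ l <;> simp_all [LocCtx.joinEntry, LocEntry.optOccs]
  | some a₁ =>
    cases hs₂ : S₂ l with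
    | none => cases a₁ <;> simp_all [LocCtx.joinEntry, LocEntry.optOccs]
    | some a₂ =>
      obtain ⟨k₁, k₂, τ, rfl, rfl⟩ := hc l a₁ a₂ hs₁ hs₂
      simp_all [LocCtx.joinEntry, LocEntry.optOccs, LocEntry.occs, Multiset.replicate_add]

/-- A location occurring in both parts has at least two occurrences, so its entry is weak, and its
count is the sum of the two numbers of occurrences. Compatibility of the parts is thus a consequence
of the description of the whole. -/
theorem Describes.split {S : LocCtx} {M₁ M₂ : Multiset Occ} (h : Describes S (M₁ + M₂)) :
    ∃ S₁ S₂, Describes S₁ M₁ ∧ Describes S₂ M₂ ∧ S.Splits S₁ S₂ := by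
  have key : ∀ l, ∃ a₁ a₂ : Option LocEntry,
      (occsAt l M₁ = LocEntry.optOccs l a₁ ∧ ∀ τ, a₁ ≠ some (.weak 0 τ)) ∧
      (occsAt l M₂ = LocEntry.optOccs l a₂ ∧ ∀ τ, a₂ ≠ some (.weak 0 τ)) ∧
      (∀ b₁ b₂, a₁ = some b₁ → a₂ = some b₂ →
        ∃ k₁ k₂ τ, b₁ = .weak k₁ τ ∧ b₂ = .weak k₂ τ) ∧
      S l = LocCtx.joinEntry a₁ a₂ := by
    intro l
    obtain ⟨h, hp⟩ := h l
    rw [occsAt_add] at h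
    -- If one part has no occurrence of `l`, the whole entry goes to the other part.
    by_cases h₁ : occsAt l M₁ = 0
    · refine ⟨none, S l, ⟨h₁, by simp⟩, ⟨by rw [← h, h₁, zero_add], hp⟩, by simp, ?_⟩
      cases S l <;> rfl
    by_cases h₂ : occsAt l M₂ = 0
    · refine ⟨S l, none, ⟨by rw [← h, h₂, add_zero], hp⟩, ⟨h₂, by simp⟩, by simp, ?_⟩
      cases S l <;> rfl
    have c₁ := Multiset.card_pos.2 h₁
    have c₂ := Multiset.card_pos.2 h₂
    cases hS : S l with
    | none =>
      have := congrArg Multiset.card h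
      simp only [hS, LocEntry.optOccs, Multiset.card_add, Multiset.card_zero] at this
      omega
    | some a =>
      cases a with
      | strong τ =>
        have := congrArg Multiset.card h
        simp only [hS, LocEntry.optOccs, LocEntry.occs, Multiset.card_add,
          Multiset.card_singleton] at this
        omega
      | weak k τ =>
        simp only [hS, LocEntry.optOccs, LocEntry.occs] at h
        have e₁ : occsAt l M₁ = Multiset.replicate (Multiset.card (occsAt l M₁)) (l, .w, τ) :=
          Multiset.eq_replicate_card.2 fun b hb => Multiset.eq_of_mem_replicate
            (h ▸ Multiset.mem_add.2 (Or.inl hb))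
        have e₂ : occsAt l M₂ = Multiset.replicate (Multiset.card (occsAt l M₂)) (l, .w, τ) :=
          Multiset.eq_replicate_card.2 fun b hb => Multiset.eq_of_mem_replicate
            (h ▸ Multiset.mem_add.2 (Or.inr hb))
        have hk := congrArg Multiset.card h
        simp only [Multiset.card_add, Multiset.card_replicate] at hk
        refine ⟨some (.weak _ τ), some (.weak _ τ), ⟨e₁, ?_⟩, ⟨e₂, ?_⟩, ?_, ?_⟩
        · intro τ' hτ
          simp only [Option.some.injEq, LocEntry.weak.injEq] at hτ
          omega
        · intro τ' hτ
          simp only [Option.some.injEq, LocEntry.weak.injEq] at hτ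
          omega
        · rintro b₁ b₂ ⟨⟩ ⟨⟩
          exact ⟨_, _, τ, rfl, rfl⟩
        · simp [LocCtx.joinEntry, hk]
  choose S₁ S₂ h₁ h₂ hc hj using key
  exact ⟨S₁, S₂, h₁, h₂, fun l a₁ a₂ e₁ e₂ => hc l a₁ a₂ e₁ e₂, funext hj⟩

theorem occsAt_map_shift (n : ℕ) (l : Loc) (M : Multiset Occ) :
    occsAt l (M.map (Occ.shift n)) = (occsAt l M).map (Occ.shift n) := by
  rw [occsAt, Multiset.filter_map]
  rfl

theorem LocEntry.optOccs_tshift (n : ℕ) (l : Loc) (a : Option LocEntry) :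
    optOccs l (a.map (LocEntry.tshift n)) = (optOccs l a).map (Occ.shift n) := by
  rcases a with _ | (τ | ⟨k, τ⟩) <;> simp [optOccs, occs, LocEntry.tshift, Occ.shift]

theorem LocEntry.tshift_ne_weak_zero_iff (n : ℕ) (a : Option LocEntry) :
    (∀ τ, a.map (LocEntry.tshift n) ≠ some (.weak 0 τ)) ↔ ∀ τ, a ≠ some (.weak 0 τ) := by
  rcases a with _ | (τ | ⟨k, τ⟩) <;> simp [LocEntry.tshift]

theorem Describes.tshift {S : LocCtx} {M : Multiset Occ} (h : Describes S M) (n : ℕ) :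
    Describes (S.tshift n) (M.map (Occ.shift n)) := fun l =>
  ⟨by rw [occsAt_map_shift, (h l).1, LocCtx.tshift, LocEntry.optOccs_tshift],
    (LocEntry.tshift_ne_weak_zero_iff n _).2 (h l).2⟩

/-- A shift of the context keeps its domain and counts. The domain is finite because `N` is, so the
unshifted context also describes some multiset, built one location at a time; uniqueness identifies
its shift with `N`. -/
theorem Describes.of_tshift {S : LocCtx} {N : Multiset Occ} {n : ℕ}
    (h : Describes (S.tshift n) N) : ∃ M, Describes S M ∧ N = M.map (Occ.shift n) := by
  suffices ∃ M, Describes S M by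
    obtain ⟨M, hM⟩ := this
    exact ⟨M, hM, h.unique (hM.tshift n)⟩
  have hp : ∀ l τ, S l ≠ some (.weak 0 τ) := fun l =>
    (LocEntry.tshift_ne_weak_zero_iff n _).1 (h l).2
  have hs : ∀ l, l ∉ (N.map Prod.fst).toFinset → S l = none := by
    intro l hl
    have h0 : occsAt l N = 0 := Multiset.filter_eq_nil.2 fun a ha hal =>
      hl (by simp only [Multiset.mem_toFinset, Multiset.mem_map]; exact ⟨a, ha, hal⟩)
    have := LocEntry.optOccs_injective (b := none) (h l).2 (by simp)
      ((h l).1.symm.trans (h0.trans rfl))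
    simpa [LocCtx.tshift] using this
  -- Only a finite bound on the domain is needed from here on; the induction removes a location from
  -- both `S` and the bound.
  generalize (N.map Prod.fst).toFinset = F at hs
  clear h
  induction F using Finset.induction_on generalizing S with
  | empty =>
    have : S = LocCtx.empty := funext fun l => hs l (by simp)
    exact ⟨0, this ▸ Describes.empty⟩
  | insert l F hl ih =>
    obtain ⟨M, hM⟩ := ih (S := Function.update S l none)
      (fun l' τ => by by_cases e : l' = l <;> simp [e, hp])
      (fun l' hl' => by
        by_cases e : l' = l
        · simp [e]
        · simpa [e] using hs l' (by simp [e, hl']))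
    cases hSl : S l with
    | none => exact ⟨M, by rwa [← hSl, Function.update_eq_self] at hM⟩
    | some a =>
      have := hM.extend (l := l) (a := a) (by simp) (fun τ hτ => hp l τ (by rw [hSl, hτ]))
      rw [LocCtx.extend, Function.update_idem, ← hSl, Function.update_eq_self] at this
      exact ⟨_, this⟩

theorem Describes.exists_of_mem {S : LocCtx} {M : Multiset Occ} (h : Describes S M) {a : Occ}
    (ha : a ∈ M) : ∃ b, S a.1 = some b ∧ b.refTy = a.refTy := by
  have hm : a ∈ occsAt a.1 M := mem_occsAt.2 ⟨ha, rfl⟩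
  rw [(h a.1).1] at hm
  obtain ⟨l, rq, τ⟩ := a
  rcases hb : S l with _ | (τ' | ⟨k, τ'⟩)
  · simp [hb, LocEntry.optOccs] at hm
  · simp [hb, LocEntry.optOccs, LocEntry.occs] at hm
    exact ⟨_, rfl, by simp [LocEntry.refTy, Occ.refTy, hm]⟩
  · simp [hb, LocEntry.optOccs, LocEntry.occs, Multiset.mem_replicate] at hm
    exact ⟨_, rfl, by simp [LocEntry.refTy, Occ.refTy, hm]⟩

theorem Describes.exists_mem {S : LocCtx} {M : Multiset Occ} (h : Describes S M) {l : Loc}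
    {b : LocEntry} (hb : S l = some b) : ∃ a ∈ M, b.refTy = a.refTy := by
  obtain ⟨hl, hp⟩ := h l
  rw [hb] at hl hp
  rcases b with τ | ⟨_ | k, τ⟩
  · exact ⟨(l, .s, τ), mem_of_mem_occsAt (l := l) (by simp [hl, LocEntry.optOccs, LocEntry.occs]),
      rfl⟩
  · exact (hp τ rfl).elim
  · exact ⟨(l, .w, τ), mem_of_mem_occsAt (l := l) (by simp [hl, LocEntry.optOccs, LocEntry.occs]),
      rfl⟩

/-- Closure constraints see reference types but not counts, and positivity of the counts ensures
that every entry has an occurrence. -/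
theorem Describes.entailsConstrain_iff {P : Constraint} {aq : ArrowQual} {Γ : VarCtx}
    {S : LocCtx} {M : Multiset Occ} (h : Describes S M) :
    EntailsConstrain P aq Γ S ↔ EntailsOcc P aq Γ M := by
  refine forall₂_congr fun K _ => and_congr_right fun _ => ⟨fun H a ha => ?_, fun H l b hb => ?_⟩
  · obtain ⟨b, hb, e⟩ := h.exists_of_mem ha
    exact e ▸ H _ b hb
  · obtain ⟨a, ha, e⟩ := h.exists_mem hb
    exact e ▸ H a ha

theorem HasTy.exists_hasOccTy {P : Constraint} {Γ : VarCtx} {S : LocCtx} {e : Term} {τ : Ty}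
    (h : HasTy P Γ S e τ) : ∃ M, Describes S M ∧ HasOccTy P Γ M e τ := by
  induction h with
  | conv _ he ih => exact ih.imp fun M hM => ⟨hM.1, hM.2.conv he⟩
  | var => exact ⟨0, .empty, .var⟩
  | tabs hv _ hP ih =>
    obtain ⟨N, hN, h⟩ := ih
    obtain ⟨M, hM, rfl⟩ := hN.of_tshift
    exact ⟨M, hM, .tabs hv h hP⟩
  | tapp _ hn hE ih => exact ih.imp fun M hM => ⟨hM.1, hM.2.tapp hn hE⟩
  | lam _ hE ih => exact ih.imp fun M hM => ⟨hM.1, hM.2.lam (hM.1.entailsConstrain_iff.1 hE)⟩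
  | app _ _ hΓ hS ih₁ ih₂ =>
    obtain ⟨M₁, d₁, h₁⟩ := ih₁
    obtain ⟨M₂, d₂, h₂⟩ := ih₂
    exact ⟨_, d₁.join d₂ hS, h₁.app h₂ hΓ⟩
  | unit => exact ⟨0, .empty, .unit⟩
  | pair _ _ hΓ hS ih₁ ih₂ =>
    obtain ⟨M₁, d₁, h₁⟩ := ih₁
    obtain ⟨M₂, d₂, h₂⟩ := ih₂
    exact ⟨_, d₁.join d₂ hS, h₁.pair h₂ hΓ⟩
  | letPair _ _ hΓ hS ih₁ ih₂ =>
    obtain ⟨M₁, d₁, h₁⟩ := ih₁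
    obtain ⟨M₂, d₂, h₂⟩ := ih₂
    exact ⟨_, d₁.join d₂ hS, h₁.letPair h₂ hΓ⟩
  | inl _ ih => exact ih.imp fun M hM => ⟨hM.1, hM.2.inl⟩
  | inr _ ih => exact ih.imp fun M hM => ⟨hM.1, hM.2.inr⟩
  | caseOf _ _ _ hΓ hS ih₁ ih₂ ih₃ =>
    obtain ⟨M₁, d₁, h₁⟩ := ih₁
    obtain ⟨M₂, d₂, h₂⟩ := ih₂
    obtain ⟨M₃, d₃, h₃⟩ := ih₃
    -- Both branches are typed in the same location context, which determines the multiset.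
    obtain rfl := d₂.unique d₃
    exact ⟨_, d₁.join d₂ hS, h₁.caseOf h₂ h₃ hΓ⟩
  | dup _ _ hE hΓ hS ih₁ ih₂ =>
    obtain ⟨M₁, d₁, h₁⟩ := ih₁
    obtain ⟨M₂, d₂, h₂⟩ := ih₂
    exact ⟨_, d₁.join d₂ hS, h₁.dup h₂ hE hΓ⟩
  | drop _ _ hE hΓ hS ih₁ ih₂ =>
    obtain ⟨M₁, d₁, h₁⟩ := ih₁
    obtain ⟨M₂, d₂, h₂⟩ := ih₂
    exact ⟨_, d₁.join d₂ hS, h₁.drop h₂ hE hΓ⟩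
  | new _ ih => exact ih.imp fun M hM => ⟨hM.1, hM.2.new⟩
  | locW => exact ⟨_, .single (by simp), .loc⟩
  | locS => exact ⟨_, .single (by simp), .loc⟩
  | releaseW _ ih => exact ih.imp fun M hM => ⟨hM.1, hM.2.releaseW⟩
  | releaseS _ ih => exact ih.imp fun M hM => ⟨hM.1, hM.2.releaseS⟩
  | swapW _ _ hΓ hS ih₁ ih₂ =>
    obtain ⟨M₁, d₁, h₁⟩ := ih₁
    obtain ⟨M₂, d₂, h₂⟩ := ih₂
    exact ⟨_, d₁.join d₂ hS, h₁.swapW h₂ hΓ⟩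
  | swapS _ _ hΓ hS ih₁ ih₂ =>
    obtain ⟨M₁, d₁, h₁⟩ := ih₁
    obtain ⟨M₂, d₂, h₂⟩ := ih₂
    exact ⟨_, d₁.join d₂ hS, h₁.swapS h₂ hΓ⟩

/-- The compatibility conditions missing from `HasOccTy` are recovered from the description of the
total multiset, by splitting it at each rule with several subterms. -/
theorem HasOccTy.hasTy {P : Constraint} {Γ : VarCtx} {M : Multiset Occ} {e : Term} {τ : Ty}
    (h : HasOccTy P Γ M e τ) : ∀ {S : LocCtx}, Describes S M → HasTy P Γ S e τ := by
  induction h with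
  | conv _ he ih => exact fun hS => (ih hS).conv he
  | var => exact fun hS => hS.unique_left .empty ▸ .var
  | tabs hv _ hP ih => exact fun hS => .tabs hv (ih (hS.tshift _)) hP
  | tapp _ hn hE ih => exact fun hS => (ih hS).tapp hn hE
  | lam _ hE ih => exact fun hS => (ih hS).lam (hS.entailsConstrain_iff.2 hE)
  | app _ _ hΓ ih₁ ih₂ =>
    intro S hS
    obtain ⟨S₁, S₂, d₁, d₂, hS⟩ := hS.split
    exact (ih₁ d₁).app (ih₂ d₂) hΓ hS
  | unit => exact fun hS => hS.unique_left .empty ▸ .unit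
  | pair _ _ hΓ ih₁ ih₂ =>
    intro S hS
    obtain ⟨S₁, S₂, d₁, d₂, hS⟩ := hS.split
    exact (ih₁ d₁).pair (ih₂ d₂) hΓ hS
  | letPair _ _ hΓ ih₁ ih₂ =>
    intro S hS
    obtain ⟨S₁, S₂, d₁, d₂, hS⟩ := hS.split
    exact (ih₁ d₁).letPair (ih₂ d₂) hΓ hS
  | inl _ ih => exact fun hS => (ih hS).inl
  | inr _ ih => exact fun hS => (ih hS).inr
  | caseOf _ _ _ hΓ ih₁ ih₂ ih₃ =>
    intro S hS
    obtain ⟨S₁, S₂, d₁, d₂, hS⟩ := hS.split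
    exact (ih₁ d₁).caseOf (ih₂ d₂) (ih₃ d₂) hΓ hS
  | dup _ _ hE hΓ ih₁ ih₂ =>
    intro S hS
    obtain ⟨S₁, S₂, d₁, d₂, hS⟩ := hS.split
    exact (ih₁ d₁).dup (ih₂ d₂) hE hΓ hS
  | drop _ _ hE hΓ ih₁ ih₂ =>
    intro S hS
    obtain ⟨S₁, S₂, d₁, d₂, hS⟩ := hS.split
    exact (ih₁ d₁).drop (ih₂ d₂) hE hΓ hS
  | new _ ih => exact fun hS => (ih hS).new
  | @loc P l rq τ =>
    intro S hS
    cases rq with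
    | s => exact hS.unique_left (.single (a := .strong τ) (by simp)) ▸ .locS
    | w => exact hS.unique_left (.single (a := .weak 1 τ) (by simp)) ▸ .locW
  | releaseW _ ih => exact fun hS => (ih hS).releaseW
  | releaseS _ ih => exact fun hS => (ih hS).releaseS
  | swapW _ _ hΓ ih₁ ih₂ =>
    intro S hS
    obtain ⟨S₁, S₂, d₁, d₂, hS⟩ := hS.split
    exact (ih₁ d₁).swapW (ih₂ d₂) hΓ hS
  | swapS _ _ hΓ ih₁ ih₂ =>
    intro S hS
    obtain ⟨S₁, S₂, d₁, d₂, hS⟩ := hS.split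
    exact (ih₁ d₁).swapS (ih₂ d₂) hΓ hS

/-! ## Inversion of typing -/

section Inversion

variable {P : Constraint} {Γ : VarCtx} {M : Multiset Occ} {τ : Ty}

/-- Because of `conv`, typing is not syntax-directed. The inversion lemmas of this section strip
conversions by induction, collecting them in a `TyEq` or pushing them into the premises when the
type of the term is that of a subterm or a component of it. -/
theorem HasOccTy.inv_var {x : ℕ} (h : HasOccTy P Γ M (.var x) τ) :
    ∃ τ', Γ = VarCtx.single x τ' := by
  generalize ht : Term.var x = t at h
  induction h with
  | conv _ _ ih => exact ih ht
  | var => cases ht; exact ⟨_, rfl⟩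
  | _ => cases ht

theorem HasOccTy.inv_tabs {n : ℕ} {P₂ : Constraint} {v : Term}
    (h : HasOccTy P Γ M (.tabs n P₂ v) τ) :
    ∃ τ₀, v.IsValue ∧ HasOccTy (P.shift n ++ P₂) (Γ.tshift n) (M.map (Occ.shift n)) v τ₀ ∧
      (∀ c ∈ P₂, ∃ i < n, c.2 = .var i) ∧ TyEq (.all n P₂ τ₀) τ := by
  generalize ht : Term.tabs n P₂ v = t at h
  induction h with
  | conv _ he ih =>
    obtain ⟨τ₀, hv, h, hP, hτ⟩ := ih ht
    exact ⟨τ₀, hv, h, hP, hτ.trans he⟩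
  | tabs hv h hP => cases ht; exact ⟨_, hv, h, hP, .refl _⟩
  | _ => cases ht

theorem HasOccTy.inv_tapp {e : Term} {τs : List Ty} (h : HasOccTy P Γ M (.tapp e τs) τ) :
    ∃ P₂ τ₀, HasOccTy P Γ M e (.all τs.length P₂ τ₀) ∧
      EntailsAll P (Constraint.subst (instTys τs) P₂) ∧ TyEq (τ₀.subst (instTys τs)) τ := by
  generalize ht : Term.tapp e τs = t at h
  induction h with
  | conv _ he ih =>
    obtain ⟨P₂, τ₀, h, hP, hτ⟩ := ih ht
    exact ⟨P₂, τ₀, h, hP, hτ.trans he⟩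
  | tapp h hn hE => cases ht; subst hn; exact ⟨_, _, h, hE, .refl _⟩
  | _ => cases ht

theorem HasOccTy.inv_lam {aq : ArrowQual} {τ₁ : Ty} {e : Term}
    (h : HasOccTy P Γ M (.lam aq τ₁ e) τ) :
    ∃ τ₂, HasOccTy P (Γ.cons τ₁) M e τ₂ ∧ EntailsOcc P aq Γ M ∧ TyEq (.arrow aq τ₁ τ₂) τ := by
  generalize ht : Term.lam aq τ₁ e = t at h
  induction h with
  | conv _ he ih =>
    obtain ⟨τ₂, h, hE, hτ⟩ := ih ht
    exact ⟨τ₂, h, hE, hτ.trans he⟩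
  | lam h hE => cases ht; exact ⟨_, h, hE, .refl _⟩
  | _ => cases ht

theorem HasOccTy.inv_app {e₁ e₂ : Term} (h : HasOccTy P Γ M (.app e₁ e₂) τ) :
    ∃ Γ₁ Γ₂ M₁ M₂ aq τ₂, Γ.Splits Γ₁ Γ₂ ∧ M = M₁ + M₂ ∧
      HasOccTy P Γ₁ M₁ e₁ (.arrow aq τ₂ τ) ∧ HasOccTy P Γ₂ M₂ e₂ τ₂ := by
  generalize ht : Term.app e₁ e₂ = t at h
  induction h with
  | conv _ he ih =>
    obtain ⟨Γ₁, Γ₂, M₁, M₂, aq, τ₂, hΓ, hM, h₁, h₂⟩ := ih ht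
    exact ⟨Γ₁, Γ₂, M₁, M₂, aq, τ₂, hΓ, hM, h₁.conv (.arrow _ (.refl _) he), h₂⟩
  | app h₁ h₂ hΓ => cases ht; exact ⟨_, _, _, _, _, _, hΓ, rfl, h₁, h₂⟩
  | _ => cases ht

theorem HasOccTy.inv_unit (h : HasOccTy P Γ M .unit τ) : M = 0 ∧ TyEq .unit τ := by
  generalize ht : Term.unit = t at h
  induction h with
  | conv _ he ih => exact ⟨(ih ht).1, (ih ht).2.trans he⟩
  | unit => exact ⟨rfl, .refl _⟩
  | _ => cases ht

theorem HasOccTy.inv_pair {e₁ e₂ : Term} (h : HasOccTy P Γ M (.pair e₁ e₂) τ) :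
    ∃ Γ₁ Γ₂ M₁ M₂ τ₁ τ₂, Γ.Splits Γ₁ Γ₂ ∧ M = M₁ + M₂ ∧
      HasOccTy P Γ₁ M₁ e₁ τ₁ ∧ HasOccTy P Γ₂ M₂ e₂ τ₂ ∧ TyEq (.prod τ₁ τ₂) τ := by
  generalize ht : Term.pair e₁ e₂ = t at h
  induction h with
  | conv _ he ih =>
    obtain ⟨Γ₁, Γ₂, M₁, M₂, τ₁, τ₂, hΓ, hM, h₁, h₂, hτ⟩ := ih ht
    exact ⟨Γ₁, Γ₂, M₁, M₂, τ₁, τ₂, hΓ, hM, h₁, h₂, hτ.trans he⟩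
  | pair h₁ h₂ hΓ => cases ht; exact ⟨_, _, _, _, _, _, hΓ, rfl, h₁, h₂, .refl _⟩
  | _ => cases ht

theorem HasOccTy.inv_letPair {e₁ e₂ : Term} (h : HasOccTy P Γ M (.letPair e₁ e₂) τ) :
    ∃ Γ₁ Γ₂ M₁ M₂ τ₁ τ₂, Γ.Splits Γ₁ Γ₂ ∧ M = M₁ + M₂ ∧
      HasOccTy P Γ₁ M₁ e₁ (.prod τ₁ τ₂) ∧ HasOccTy P ((Γ₂.cons τ₁).cons τ₂) M₂ e₂ τ := by
  generalize ht : Term.letPair e₁ e₂ = t at h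
  induction h with
  | conv _ he ih =>
    obtain ⟨Γ₁, Γ₂, M₁, M₂, τ₁, τ₂, hΓ, hM, h₁, h₂⟩ := ih ht
    exact ⟨Γ₁, Γ₂, M₁, M₂, τ₁, τ₂, hΓ, hM, h₁, h₂.conv he⟩
  | letPair h₁ h₂ hΓ => cases ht; exact ⟨_, _, _, _, _, _, hΓ, rfl, h₁, h₂⟩
  | _ => cases ht

theorem HasOccTy.inv_inl {e : Term} (h : HasOccTy P Γ M (.inl e) τ) :
    ∃ τ₁ τ₂, HasOccTy P Γ M e τ₁ ∧ TyEq (.sum τ₁ τ₂) τ := by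
  generalize ht : Term.inl e = t at h
  induction h with
  | conv _ he ih =>
    obtain ⟨τ₁, τ₂, h, hτ⟩ := ih ht
    exact ⟨τ₁, τ₂, h, hτ.trans he⟩
  | inl h => cases ht; exact ⟨_, _, h, .refl _⟩
  | _ => cases ht

theorem HasOccTy.inv_inr {e : Term} (h : HasOccTy P Γ M (.inr e) τ) :
    ∃ τ₁ τ₂, HasOccTy P Γ M e τ₂ ∧ TyEq (.sum τ₁ τ₂) τ := by
  generalize ht : Term.inr e = t at h
  induction h with
  | conv _ he ih =>
    obtain ⟨τ₁, τ₂, h, hτ⟩ := ih ht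
    exact ⟨τ₁, τ₂, h, hτ.trans he⟩
  | inr h => cases ht; exact ⟨_, _, h, .refl _⟩
  | _ => cases ht

theorem HasOccTy.inv_caseOf {e₁ e₂₁ e₂₂ : Term} (h : HasOccTy P Γ M (.caseOf e₁ e₂₁ e₂₂) τ) :
    ∃ Γ₁ Γ₂ M₁ M₂ τ₁₁ τ₁₂, Γ.Splits Γ₁ Γ₂ ∧ M = M₁ + M₂ ∧
      HasOccTy P Γ₁ M₁ e₁ (.sum τ₁₁ τ₁₂) ∧ HasOccTy P (Γ₂.cons τ₁₁) M₂ e₂₁ τ ∧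
      HasOccTy P (Γ₂.cons τ₁₂) M₂ e₂₂ τ := by
  generalize ht : Term.caseOf e₁ e₂₁ e₂₂ = t at h
  induction h with
  | conv _ he ih =>
    obtain ⟨Γ₁, Γ₂, M₁, M₂, τ₁₁, τ₁₂, hΓ, hM, h₁, h₂, h₃⟩ := ih ht
    exact ⟨Γ₁, Γ₂, M₁, M₂, τ₁₁, τ₁₂, hΓ, hM, h₁, h₂.conv he, h₃.conv he⟩
  | caseOf h₁ h₂ h₃ hΓ => cases ht; exact ⟨_, _, _, _, _, _, hΓ, rfl, h₁, h₂, h₃⟩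
  | _ => cases ht

theorem HasOccTy.inv_dup {e₁ e₂ : Term} (h : HasOccTy P Γ M (.dup e₁ e₂) τ) :
    ∃ Γ₁ Γ₂ M₁ M₂ τ₁, Γ.Splits Γ₁ Γ₂ ∧ M = M₁ + M₂ ∧ HasOccTy P Γ₁ M₁ e₁ τ₁ ∧
      HasOccTy P ((Γ₂.cons τ₁).cons τ₁) M₂ e₂ τ ∧ Entails P .Dup τ₁ := by
  generalize ht : Term.dup e₁ e₂ = t at h
  induction h with
  | conv _ he ih =>
    obtain ⟨Γ₁, Γ₂, M₁, M₂, τ₁, hΓ, hM, h₁, h₂, hE⟩ := ih ht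
    exact ⟨Γ₁, Γ₂, M₁, M₂, τ₁, hΓ, hM, h₁, h₂.conv he, hE⟩
  | dup h₁ h₂ hE hΓ => cases ht; exact ⟨_, _, _, _, _, hΓ, rfl, h₁, h₂, hE⟩
  | _ => cases ht

theorem HasOccTy.inv_drop {e₁ e₂ : Term} (h : HasOccTy P Γ M (.drop e₁ e₂) τ) :
    ∃ Γ₁ Γ₂ M₁ M₂ τ₁, Γ.Splits Γ₁ Γ₂ ∧ M = M₁ + M₂ ∧ HasOccTy P Γ₁ M₁ e₁ τ₁ ∧
      HasOccTy P Γ₂ M₂ e₂ τ ∧ Entails P .Drop τ₁ := by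
  generalize ht : Term.drop e₁ e₂ = t at h
  induction h with
  | conv _ he ih =>
    obtain ⟨Γ₁, Γ₂, M₁, M₂, τ₁, hΓ, hM, h₁, h₂, hE⟩ := ih ht
    exact ⟨Γ₁, Γ₂, M₁, M₂, τ₁, hΓ, hM, h₁, h₂.conv he, hE⟩
  | drop h₁ h₂ hE hΓ => cases ht; exact ⟨_, _, _, _, _, hΓ, rfl, h₁, h₂, hE⟩
  | _ => cases ht

theorem HasOccTy.inv_new {rq : RefQual} {e : Term} (h : HasOccTy P Γ M (.new rq e) τ) :
    ∃ τ₀, HasOccTy P Γ M e τ₀ ∧ TyEq (.ref rq τ₀) τ := by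
  generalize ht : Term.new rq e = t at h
  induction h with
  | conv _ he ih =>
    obtain ⟨τ₀, h, hτ⟩ := ih ht
    exact ⟨τ₀, h, hτ.trans he⟩
  | new h => cases ht; exact ⟨_, h, .refl _⟩
  | _ => cases ht

theorem HasOccTy.inv_loc {l : Loc} (h : HasOccTy P Γ M (.loc l) τ) :
    ∃ rq τ₀, M = {(l, rq, τ₀)} ∧ TyEq (.ref rq τ₀) τ := by
  generalize ht : Term.loc l = t at h
  induction h with
  | conv _ he ih =>
    obtain ⟨rq, τ₀, h, hτ⟩ := ih ht
    exact ⟨rq, τ₀, h, hτ.trans he⟩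
  | loc => cases ht; exact ⟨_, _, rfl, .refl _⟩
  | _ => cases ht

theorem HasOccTy.inv_releaseW {e : Term} (h : HasOccTy P Γ M (.release .w e) τ) :
    ∃ rq τ₀, HasOccTy P Γ M e (.ref rq τ₀) ∧ TyEq (.sum τ₀ .unit) τ := by
  generalize ht : Term.release .w e = t at h
  induction h with
  | conv _ he ih =>
    obtain ⟨rq, τ₀, h, hτ⟩ := ih ht
    exact ⟨rq, τ₀, h, hτ.trans he⟩
  | releaseW h => cases ht; exact ⟨_, _, h, .refl _⟩
  | _ => cases ht

theorem HasOccTy.inv_releaseS {e : Term} (h : HasOccTy P Γ M (.release .s e) τ) :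
    HasOccTy P Γ M e (.ref .s τ) := by
  generalize ht : Term.release .s e = t at h
  induction h with
  | conv _ he ih => exact (ih ht).conv (.ref _ he)
  | releaseS h => cases ht; exact h
  | _ => cases ht

theorem HasOccTy.inv_swapW {e₁ e₂ : Term} (h : HasOccTy P Γ M (.swap .w e₁ e₂) τ) :
    ∃ Γ₁ Γ₂ M₁ M₂ rq τ₀, Γ.Splits Γ₁ Γ₂ ∧ M = M₁ + M₂ ∧ HasOccTy P Γ₁ M₁ e₁ (.ref rq τ₀) ∧
      HasOccTy P Γ₂ M₂ e₂ τ₀ ∧ TyEq (.prod (.ref rq τ₀) τ₀) τ := by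
  generalize ht : Term.swap .w e₁ e₂ = t at h
  induction h with
  | conv _ he ih =>
    obtain ⟨Γ₁, Γ₂, M₁, M₂, rq, τ₀, hΓ, hM, h₁, h₂, hτ⟩ := ih ht
    exact ⟨Γ₁, Γ₂, M₁, M₂, rq, τ₀, hΓ, hM, h₁, h₂, hτ.trans he⟩
  | swapW h₁ h₂ hΓ => cases ht; exact ⟨_, _, _, _, _, _, hΓ, rfl, h₁, h₂, .refl _⟩
  | _ => cases ht

theorem HasOccTy.inv_swapS {e₁ e₂ : Term} (h : HasOccTy P Γ M (.swap .s e₁ e₂) τ) :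
    ∃ Γ₁ Γ₂ M₁ M₂ τ₁ τ₂, Γ.Splits Γ₁ Γ₂ ∧ M = M₁ + M₂ ∧ HasOccTy P Γ₁ M₁ e₁ (.ref .s τ₁) ∧
      HasOccTy P Γ₂ M₂ e₂ τ₂ ∧ TyEq (.prod (.ref .s τ₂) τ₁) τ := by
  generalize ht : Term.swap .s e₁ e₂ = t at h
  induction h with
  | conv _ he ih =>
    obtain ⟨Γ₁, Γ₂, M₁, M₂, τ₁, τ₂, hΓ, hM, h₁, h₂, hτ⟩ := ih ht
    exact ⟨Γ₁, Γ₂, M₁, M₂, τ₁, τ₂, hΓ, hM, h₁, h₂, hτ.trans he⟩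
  | swapS h₁ h₂ hΓ => cases ht; exact ⟨_, _, _, _, _, _, hΓ, rfl, h₁, h₂, .refl _⟩
  | _ => cases ht

end Inversion

/-! ## Variable contexts -/

/-- Substitution in the types of a context. -/
def VarCtx.tsubst (s : ℕ → Ty) (Γ : VarCtx) : VarCtx := fun i => (Γ i).map (Ty.subst s)

/-- Removal of the variable `k` from a context. -/
def VarCtx.removeAt (k : ℕ) (Γ : VarCtx) : VarCtx := fun i => if i < k then Γ i else Γ (i + 1)

theorem VarCtx.tsubst_cons (s : ℕ → Ty) (τ : Ty) (Γ : VarCtx) :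
    (Γ.cons τ).tsubst s = (Γ.tsubst s).cons (τ.subst s) := by
  funext i
  cases i <;> rfl

theorem VarCtx.tsubst_single (s : ℕ → Ty) (x : ℕ) (τ : Ty) :
    (single x τ).tsubst s = single x (τ.subst s) := by
  funext i
  unfold tsubst single
  split_ifs <;> rfl

theorem VarCtx.tshift_tsubst (n : ℕ) (s : ℕ → Ty) (Γ : VarCtx) :
    (Γ.tshift n).tsubst (liftTySub n s) = (Γ.tsubst s).tshift n := by
  funext i
  simp [tsubst, tshift, Function.comp_def, Ty.shift_subst_liftTySub]

theorem VarCtx.Splits.tsubst {Γ Γ₁ Γ₂ : VarCtx} (h : Γ.Splits Γ₁ Γ₂) (s : ℕ → Ty) :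
    (Γ.tsubst s).Splits (Γ₁.tsubst s) (Γ₂.tsubst s) := by
  obtain ⟨hc, rfl⟩ := h
  refine ⟨fun i => (hc i).imp (fun h => by simp [VarCtx.tsubst, h])
    fun h => by simp [VarCtx.tsubst, h], funext fun i => ?_⟩
  simp only [VarCtx.tsubst, VarCtx.join]
  cases Γ₁ i <;> rfl

theorem VarCtx.Splits.eq_none {Γ Γ₁ Γ₂ : VarCtx} (h : Γ.Splits Γ₁ Γ₂) {i : ℕ}
    (hi : Γ i = none) : Γ₁ i = none ∧ Γ₂ i = none := by
  obtain ⟨_, rfl⟩ := h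
  simpa [VarCtx.join, Option.or_eq_none_iff] using hi

/-- Evaluation concerns closed terms; this removes variable contexts from the arguments for
preservation and progress. -/
theorem VarCtx.Splits.of_empty {Γ₁ Γ₂ : VarCtx} (h : empty.Splits Γ₁ Γ₂) :
    Γ₁ = empty ∧ Γ₂ = empty :=
  ⟨funext fun i => (h.eq_none (i := i) rfl).1, funext fun i => (h.eq_none (i := i) rfl).2⟩

theorem VarCtx.Splits.removeAt {Γ Γ₁ Γ₂ : VarCtx} (h : Γ.Splits Γ₁ Γ₂) (k : ℕ) :
    (Γ.removeAt k).Splits (Γ₁.removeAt k) (Γ₂.removeAt k) := by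
  obtain ⟨hc, rfl⟩ := h
  constructor
  · intro i
    unfold VarCtx.removeAt
    split_ifs
    · exact hc i
    · exact hc (i + 1)
  · funext i
    simp only [VarCtx.removeAt, VarCtx.join]
    split_ifs <;> rfl

theorem VarCtx.removeAt_cons (k : ℕ) (τ : Ty) (Γ : VarCtx) :
    (Γ.cons τ).removeAt (k + 1) = (Γ.removeAt k).cons τ := by
  funext i
  cases i with
  | zero => simp [removeAt, cons]
  | succ i => simp [removeAt, cons]

theorem VarCtx.removeAt_tshift (k n : ℕ) (Γ : VarCtx) :
    (Γ.tshift n).removeAt k = (Γ.removeAt k).tshift n := by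
  funext i
  simp only [removeAt, tshift]
  split_ifs <;> rfl

theorem VarCtx.removeAt_zero_cons (τ : Ty) (Γ : VarCtx) : (Γ.cons τ).removeAt 0 = Γ := by
  funext i
  simp [removeAt, cons]

/-! ## Substitution of types in typing derivations -/

theorem Occ.map_subst_shift (n : ℕ) (s : ℕ → Ty) (M : Multiset Occ) :
    (M.map (Occ.shift n)).map (Occ.subst (liftTySub n s)) =
      (M.map (Occ.subst s)).map (Occ.shift n) := by
  simp [Occ.shift, Occ.subst, Function.comp_def, Ty.shift_subst_liftTySub]

theorem Occ.shift_eq_subst (n : ℕ) : Occ.shift n = Occ.subst fun i => .var (i + n) := by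
  funext a
  simp [Occ.shift, Occ.subst, Ty.shift_eq_subst]

theorem Term.IsValue.tsubst {v : Term} (h : v.IsValue) : ∀ s : ℕ → Ty, (v.tsubst s).IsValue := by
  induction h with
  | lam => exact fun _ => .lam _ _ _
  | tabs _ _ _ ih => exact fun _ => .tabs _ _ (ih _)
  | pair _ _ ih₁ ih₂ => exact fun _ => .pair (ih₁ _) (ih₂ _)
  | inl _ ih => exact fun _ => .inl (ih _)
  | inr _ ih => exact fun _ => .inr (ih _)
  | loc => exact fun _ => .loc _
  | unit => exact fun _ => .unit

theorem Term.IsValue.subst {v : Term} (h : v.IsValue) : ∀ σ : ℕ → Term, (v.subst σ).IsValue := by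
  induction h with
  | lam => exact fun _ => .lam _ _ _
  | tabs _ _ _ ih => exact fun _ => .tabs _ _ (ih _)
  | pair _ _ ih₁ ih₂ => exact fun _ => .pair (ih₁ _) (ih₂ _)
  | inl _ ih => exact fun _ => .inl (ih _)
  | inr _ ih => exact fun _ => .inr (ih _)
  | loc => exact fun _ => .loc _
  | unit => exact fun _ => .unit

theorem EntailsAll.instTys_subst {P Q P₂ : Constraint} {τs : List Ty} {s : ℕ → Ty}
    (h : EntailsAll P (Constraint.subst (instTys τs) P₂))
    (hQ : EntailsAll Q (Constraint.subst s P)) :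
    EntailsAll Q (Constraint.subst (instTys (τs.map (Ty.subst s)))
      (Constraint.subst (liftTySub τs.length s) P₂)) := by
  intro c hc
  simp only [Constraint.subst_eq_map, List.map_map, List.mem_map, Function.comp_apply] at hc
  obtain ⟨d, hd, rfl⟩ := hc
  simp only [← Ty.subst_instTys_subst]
  refine Entails.subst (h (d.1, d.2.subst (instTys τs)) ?_) hQ
  rw [Constraint.subst_eq_map]
  exact List.mem_map.2 ⟨d, hd, rfl⟩

theorem EntailsOcc.tsubst {P Q : Constraint} {aq : ArrowQual} {Γ : VarCtx} {M : Multiset Occ}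
    {s : ℕ → Ty} (h : EntailsOcc P aq Γ M) (hQ : EntailsAll Q (Constraint.subst s P)) :
    EntailsOcc Q aq (Γ.tsubst s) (M.map (Occ.subst s)) := by
  intro K hK
  constructor
  · intro x τ hx
    obtain ⟨τ', hτ', rfl⟩ := Option.map_eq_some_iff.1 hx
    exact ((h K hK).1 x τ' hτ').subst hQ
  · intro a ha
    obtain ⟨b, hb, rfl⟩ := Multiset.mem_map.1 ha
    exact ((h K hK).2 b hb).subst hQ

/-- The new hypotheses need only entail the substituted ones. This freedom covers both instantiation
of a type abstraction, where they are discharged completely, and weakening under a type binder. -/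
theorem HasOccTy.tsubst {P : Constraint} {Γ : VarCtx} {M : Multiset Occ} {e : Term} {τ : Ty}
    (h : HasOccTy P Γ M e τ) : ∀ {s : ℕ → Ty} {Q : Constraint},
      EntailsAll Q (Constraint.subst s P) →
      HasOccTy Q (Γ.tsubst s) (M.map (Occ.subst s)) (e.tsubst s) (τ.subst s) := by
  induction h with
  | conv _ he ih => exact fun hQ => (ih hQ).conv (he.subst _)
  | var => exact fun hQ => by rw [VarCtx.tsubst_single]; exact .var
  | @tabs P₁ P₂ Γ M n v τ hv _ hP ih =>
    intro s Q hQ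
    have := ih (hQ.append_subst (n := n) P₂)
    rw [VarCtx.tshift_tsubst, Occ.map_subst_shift] at this
    refine .tabs (hv.tsubst _) this fun c hc => ?_
    rw [Constraint.subst_eq_map] at hc
    obtain ⟨d, hd, rfl⟩ := List.mem_map.1 hc
    obtain ⟨i, hi, hd⟩ := hP d hd
    -- Constraints on the bound variables are untouched by the lifted substitution, so they keep
    -- their required form.
    exact ⟨i, hi, by simp [hd, Ty.subst, liftTySub, hi]⟩
  | tapp _ hn hE ih =>
    intro s Q hQ
    subst hn
    rw [Ty.subst_instTys_subst]
    exact .tapp (ih hQ) (by simp) (hE.instTys_subst hQ)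
  | lam _ hE ih => exact fun hQ => .lam (by simpa [VarCtx.tsubst_cons] using ih hQ) (hE.tsubst hQ)
  | app _ _ hΓ ih₁ ih₂ =>
    exact fun hQ => by
      rw [Multiset.map_add]
      exact .app (ih₁ hQ) (ih₂ hQ) (hΓ.tsubst _)
  | unit => exact fun hQ => .unit
  | pair _ _ hΓ ih₁ ih₂ =>
    exact fun hQ => by
      rw [Multiset.map_add]
      exact .pair (ih₁ hQ) (ih₂ hQ) (hΓ.tsubst _)
  | letPair _ _ hΓ ih₁ ih₂ =>
    exact fun hQ => by
      rw [Multiset.map_add]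
      exact .letPair (ih₁ hQ) (by simpa [VarCtx.tsubst_cons] using ih₂ hQ) (hΓ.tsubst _)
  | inl _ ih => exact fun hQ => .inl (ih hQ)
  | inr _ ih => exact fun hQ => .inr (ih hQ)
  | caseOf _ _ _ hΓ ih₁ ih₂ ih₃ =>
    exact fun hQ => by
      rw [Multiset.map_add]
      exact .caseOf (ih₁ hQ) (by simpa [VarCtx.tsubst_cons] using ih₂ hQ)
        (by simpa [VarCtx.tsubst_cons] using ih₃ hQ) (hΓ.tsubst _)
  | dup _ _ hE hΓ ih₁ ih₂ =>
    exact fun hQ => by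
      rw [Multiset.map_add]
      exact .dup (ih₁ hQ) (by simpa [VarCtx.tsubst_cons] using ih₂ hQ) (hE.subst hQ)
        (hΓ.tsubst _)
  | drop _ _ hE hΓ ih₁ ih₂ =>
    exact fun hQ => by
      rw [Multiset.map_add]
      exact .drop (ih₁ hQ) (ih₂ hQ) (hE.subst hQ) (hΓ.tsubst _)
  | new _ ih => exact fun hQ => .new (ih hQ)
  | loc => exact fun hQ => .loc
  | releaseW _ ih => exact fun hQ => .releaseW (ih hQ)
  | releaseS _ ih => exact fun hQ => .releaseS (ih hQ)
  | swapW _ _ hΓ ih₁ ih₂ =>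
    exact fun hQ => by
      rw [Multiset.map_add]
      exact .swapW (ih₁ hQ) (ih₂ hQ) (hΓ.tsubst _)
  | swapS _ _ hΓ ih₁ ih₂ =>
    exact fun hQ => by
      rw [Multiset.map_add]
      exact .swapS (ih₁ hQ) (ih₂ hQ) (hΓ.tsubst _)

/-- Weakening of a derivation to a larger scope of type variables. -/
theorem HasOccTy.tshift {P Q : Constraint} {M : Multiset Occ} {e : Term} {τ : Ty}
    (h : HasOccTy P VarCtx.empty M e τ) (n : ℕ) :
    HasOccTy (P.shift n ++ Q) VarCtx.empty (M.map (Occ.shift n)) (e.tshift n) (τ.shift n) := by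
  rw [Occ.shift_eq_subst, Ty.shift_eq_subst]
  refine h.tsubst fun c hc => .of_mem (List.mem_append_left _ ?_)
  rw [Constraint.subst_eq_map] at hc
  simpa only [Constraint.shift, Ty.shift_eq_subst] using hc

/-! ## Closed terms -/

/-- All free term variables are below `k`. -/
def Term.ClosedAt : Term → ℕ → Prop
  | .var i, k => i < k
  | .lam _ _ e, k => e.ClosedAt (k + 1)
  | .tabs _ _ v, k => v.ClosedAt k
  | .loc _, _ => True
  | .unit, _ => True
  | .app e₁ e₂, k => e₁.ClosedAt k ∧ e₂.ClosedAt k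
  | .tapp e _, k => e.ClosedAt k
  | .pair e₁ e₂, k => e₁.ClosedAt k ∧ e₂.ClosedAt k
  | .letPair e₁ e₂, k => e₁.ClosedAt k ∧ e₂.ClosedAt (k + 2)
  | .inl e, k => e.ClosedAt k
  | .inr e, k => e.ClosedAt k
  | .caseOf e e₁ e₂, k => e.ClosedAt k ∧ e₁.ClosedAt (k + 1) ∧ e₂.ClosedAt (k + 1)
  | .new _ e, k => e.ClosedAt k
  | .release _ e, k => e.ClosedAt k
  | .swap _ e₁ e₂, k => e₁.ClosedAt k ∧ e₂.ClosedAt k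
  | .dup e₁ e₂, k => e₁.ClosedAt k ∧ e₂.ClosedAt (k + 2)
  | .drop e₁ e₂, k => e₁.ClosedAt k ∧ e₂.ClosedAt k

theorem liftRen_fixes {n k : ℕ} {r : ℕ → ℕ} (h : ∀ i < k, r i = i) :
    ∀ i < k + n, liftRen n r i = i := by
  intro i hi
  unfold liftRen
  split_ifs with hn
  · rfl
  · rw [h _ (by omega)]; omega

theorem liftSub_fixes {n k : ℕ} {σ : ℕ → Term} (h : ∀ i < k, σ i = .var i) :
    ∀ i < k + n, liftSub n σ i = .var i := by
  intro i hi
  unfold liftSub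
  split_ifs with hn
  · rfl
  · rw [h _ (by omega), Term.rename]
    congr 1
    omega

theorem Term.ClosedAt.rename_eq {e : Term} : ∀ {k : ℕ} {r : ℕ → ℕ}, e.ClosedAt k →
    (∀ i < k, r i = i) → e.rename r = e := by
  induction e with
  | var i => exact fun h hr => by simp [Term.rename, hr i h]
  | lam aq τ e ih => exact fun h hr => by simp [Term.rename, ih h (liftRen_fixes hr)]
  | letPair e₁ e₂ ih₁ ih₂ =>
    exact fun h hr => by simp [Term.rename, ih₁ h.1 hr, ih₂ h.2 (liftRen_fixes hr)]
  | caseOf e₁ e₂ e₃ ih₁ ih₂ ih₃ =>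
    exact fun h hr => by
      simp [Term.rename, ih₁ h.1 hr, ih₂ h.2.1 (liftRen_fixes hr), ih₃ h.2.2 (liftRen_fixes hr)]
  | dup e₁ e₂ ih₁ ih₂ =>
    exact fun h hr => by simp [Term.rename, ih₁ h.1 hr, ih₂ h.2 (liftRen_fixes hr)]
  | app e₁ e₂ ih₁ ih₂ => exact fun h hr => by simp [Term.rename, ih₁ h.1 hr, ih₂ h.2 hr]
  | pair e₁ e₂ ih₁ ih₂ => exact fun h hr => by simp [Term.rename, ih₁ h.1 hr, ih₂ h.2 hr]
  | swap rq e₁ e₂ ih₁ ih₂ => exact fun h hr => by simp [Term.rename, ih₁ h.1 hr, ih₂ h.2 hr]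
  | drop e₁ e₂ ih₁ ih₂ => exact fun h hr => by simp [Term.rename, ih₁ h.1 hr, ih₂ h.2 hr]
  | loc | unit => exact fun _ _ => rfl
  | tabs _ _ _ ih | tapp _ _ ih | inl _ ih | inr _ ih | new _ _ ih | release _ _ ih =>
    exact fun h hr => by simp [Term.rename, ih h hr]

theorem Term.ClosedAt.subst_eq {e : Term} : ∀ {k : ℕ} {σ : ℕ → Term}, e.ClosedAt k →
    (∀ i < k, σ i = .var i) → e.subst σ = e := by
  induction e with
  | var i => exact fun h hr => by simp [Term.subst, hr i h]
  | lam aq τ e ih => exact fun h hr => by simp [Term.subst, ih h (liftSub_fixes hr)]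
  | letPair e₁ e₂ ih₁ ih₂ =>
    exact fun h hr => by simp [Term.subst, ih₁ h.1 hr, ih₂ h.2 (liftSub_fixes hr)]
  | caseOf e₁ e₂ e₃ ih₁ ih₂ ih₃ =>
    exact fun h hr => by
      simp [Term.subst, ih₁ h.1 hr, ih₂ h.2.1 (liftSub_fixes hr), ih₃ h.2.2 (liftSub_fixes hr)]
  | dup e₁ e₂ ih₁ ih₂ =>
    exact fun h hr => by simp [Term.subst, ih₁ h.1 hr, ih₂ h.2 (liftSub_fixes hr)]
  | app e₁ e₂ ih₁ ih₂ => exact fun h hr => by simp [Term.subst, ih₁ h.1 hr, ih₂ h.2 hr]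
  | pair e₁ e₂ ih₁ ih₂ => exact fun h hr => by simp [Term.subst, ih₁ h.1 hr, ih₂ h.2 hr]
  | swap rq e₁ e₂ ih₁ ih₂ => exact fun h hr => by simp [Term.subst, ih₁ h.1 hr, ih₂ h.2 hr]
  | drop e₁ e₂ ih₁ ih₂ => exact fun h hr => by simp [Term.subst, ih₁ h.1 hr, ih₂ h.2 hr]
  | loc | unit => exact fun _ _ => rfl
  | tabs n P v ih =>
    exact fun h hr => by
      rw [Term.subst, ih h fun i hi => by rw [hr i hi]; rfl]
  | tapp _ _ ih | inl _ ih | inr _ ih | new _ _ ih | release _ _ ih =>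
    exact fun h hr => by simp [Term.subst, ih h hr]

theorem Term.ClosedAt.tsubst {e : Term} : ∀ {k : ℕ} (s : ℕ → Ty), e.ClosedAt k →
    (e.tsubst s).ClosedAt k := by
  induction e with
  | caseOf _ _ _ ih₁ ih₂ ih₃ => exact fun s h => ⟨ih₁ s h.1, ih₂ s h.2.1, ih₃ s h.2.2⟩
  | var | loc | unit => exact fun _ h => h
  | lam _ _ _ ih | tapp _ _ ih | inl _ ih | inr _ ih | new _ _ ih | release _ _ ih =>
    exact fun s h => ih s h
  | tabs n _ _ ih => exact fun s h => ih (liftTySub n s) h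
  | app _ _ ih₁ ih₂ | pair _ _ ih₁ ih₂ | letPair _ _ ih₁ ih₂ | swap _ _ _ ih₁ ih₂
  | dup _ _ ih₁ ih₂ | drop _ _ ih₁ ih₂ => exact fun s h => ⟨ih₁ s h.1, ih₂ s h.2⟩

theorem VarCtx.cons_eq_none {Γ : VarCtx} {k : ℕ} (h : ∀ i, k ≤ i → Γ i = none) (τ : Ty) :
    ∀ i, k + 1 ≤ i → Γ.cons τ i = none := by
  rintro (_ | i) hi
  · omega
  · exact h i (by omega)

theorem HasOccTy.closedAt {P : Constraint} {Γ : VarCtx} {M : Multiset Occ} {e : Term} {τ : Ty}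
    (h : HasOccTy P Γ M e τ) : ∀ {k : ℕ}, (∀ i, k ≤ i → Γ i = none) → e.ClosedAt k := by
  induction h with
  | conv _ _ ih => exact ih
  | @var P x τ =>
    intro k hk
    by_contra hx
    simpa [VarCtx.single] using hk x (not_lt.1 hx)
  | tabs _ _ _ ih => exact fun hk => ih fun i hi => by simp [VarCtx.tshift, hk i hi]
  | tapp _ _ _ ih => exact ih
  | lam _ _ ih => exact fun hk => ih (VarCtx.cons_eq_none hk _)
  | app _ _ hΓ ih₁ ih₂ | pair _ _ hΓ ih₁ ih₂ | drop _ _ _ hΓ ih₁ ih₂ | swapW _ _ hΓ ih₁ ih₂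
  | swapS _ _ hΓ ih₁ ih₂ =>
    exact fun hk => ⟨ih₁ fun i hi => (hΓ.eq_none (hk i hi)).1,
      ih₂ fun i hi => (hΓ.eq_none (hk i hi)).2⟩
  | letPair _ _ hΓ ih₁ ih₂ | dup _ _ _ hΓ ih₁ ih₂ =>
    exact fun hk => ⟨ih₁ fun i hi => (hΓ.eq_none (hk i hi)).1,
      ih₂ (VarCtx.cons_eq_none
        (VarCtx.cons_eq_none (fun i hi => (hΓ.eq_none (hk i hi)).2) _) _)⟩
  | caseOf _ _ _ hΓ ih₁ ih₂ ih₃ =>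
    exact fun hk => ⟨ih₁ fun i hi => (hΓ.eq_none (hk i hi)).1,
      ih₂ (VarCtx.cons_eq_none (fun i hi => (hΓ.eq_none (hk i hi)).2) _),
      ih₃ (VarCtx.cons_eq_none (fun i hi => (hΓ.eq_none (hk i hi)).2) _)⟩
  | unit | loc => exact fun _ => trivial
  | inl _ ih | inr _ ih | new _ ih | releaseW _ ih | releaseS _ ih => exact ih

/-! ## Substitution of values -/

/-- The substitution of `v` for the variable `k`. -/
def substAt (k : ℕ) (v : Term) : ℕ → Term :=
  fun i => if i < k then .var i else if i = k then v else .var (i - 1)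

/-- The substitution of `v₂` for the variable `k` and of `v₁` for the variable `k + 1`. -/
def substAt₂ (k : ℕ) (v₁ v₂ : Term) : ℕ → Term :=
  fun i => if i < k then .var i else if i = k then v₂ else if i = k + 1 then v₁ else .var (i - 2)

/-- A closed value is unaffected by the renaming under binders, so lifting only moves the position
of the replaced variable. -/
theorem liftSub_substAt {v : Term} (hv : v.ClosedAt 0) (n k : ℕ) :
    liftSub n (substAt k v) = substAt (k + n) v := by
  funext i
  unfold liftSub substAt
  split_ifs <;> first
    | omega
    | rfl
    | exact hv.rename_eq (by simp)
    | (simp only [Term.rename, Term.var.injEq]; omega)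

theorem liftSub_substAt₂ {v₁ v₂ : Term} (hv₁ : v₁.ClosedAt 0) (hv₂ : v₂.ClosedAt 0) (n k : ℕ) :
    liftSub n (substAt₂ k v₁ v₂) = substAt₂ (k + n) v₁ v₂ := by
  funext i
  unfold liftSub substAt₂
  split_ifs <;> first
    | omega
    | rfl
    | exact hv₁.rename_eq (by simp)
    | exact hv₂.rename_eq (by simp)
    | (simp only [Term.rename, Term.var.injEq]; omega)

theorem substAt_tshift (n k : ℕ) (v : Term) :
    (fun i => (substAt k v i).tshift n) = substAt k (v.tshift n) := by
  funext i
  unfold substAt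
  split_ifs <;> rfl

theorem substAt₂_tshift (n k : ℕ) (v₁ v₂ : Term) :
    (fun i => (substAt₂ k v₁ v₂ i).tshift n) = substAt₂ k (v₁.tshift n) (v₂.tshift n) := by
  funext i
  unfold substAt₂
  split_ifs <;> rfl

/-- Reduces the two-variable substitution to single ones. The higher index goes first; the second
substitution then leaves the inserted copies of `v₁` alone because they are closed. -/
theorem Term.subst_substAt₂ (e : Term) : ∀ (k : ℕ) {v₁ v₂ : Term}, v₁.ClosedAt 0 →
    v₂.ClosedAt 0 →
    e.subst (substAt₂ k v₁ v₂) = (e.subst (substAt (k + 1) v₁)).subst (substAt k v₂) := by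
  induction e with
  | var i =>
    intro k v₁ v₂ h₁ h₂
    have e₁ : v₁.subst (substAt k v₂) = v₁ := h₁.subst_eq (by simp)
    rcases lt_trichotomy i k with h | h | h
    · simp [Term.subst, substAt, substAt₂, h, h.trans (Nat.lt_succ_self k)]
    · simp [Term.subst, substAt, substAt₂, h]
    · rcases eq_or_ne i (k + 1) with rfl | h'
      · simp [Term.subst, substAt, substAt₂]
        simpa [substAt] using e₁.symm
      · have a₁ : ¬ i < k := by omega
        have a₂ : ¬ i = k := by omega
        have a₃ : ¬ i < k + 1 := by omega
        have a₄ : ¬ i - 1 < k := by omega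
        have a₅ : ¬ i - 1 = k := by omega
        simp [Term.subst, substAt, substAt₂, h', a₁, a₂, a₃, a₄, a₅, Nat.sub_sub]
  | tabs n P v ih =>
    intro k v₁ v₂ h₁ h₂
    simp only [Term.subst, substAt_tshift, substAt₂_tshift]
    -- Under a type binder the inserted values are shifted in their type annotations, which is why
    -- the induction is general in them.
    rw [ih k (v₁ := v₁.tshift n) (v₂ := v₂.tshift n) (h₁.tsubst _) (h₂.tsubst _)]
  | loc | unit => exact fun _ _ _ _ _ => rfl
  | _ =>
    intro k v₁ v₂ h₁ h₂
    simp_all [Term.subst, liftSub_substAt, liftSub_substAt₂, Nat.add_right_comm]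

theorem Term.subst1_eq (v e : Term) : Term.subst1 v e = e.subst (substAt 0 v) := by
  unfold Term.subst1
  congr 1
  funext i
  rcases i with _ | i <;> simp [substAt]

theorem Term.subst2_eq {v₁ v₂ : Term} (e : Term) (h₁ : v₁.ClosedAt 0) (h₂ : v₂.ClosedAt 0) :
    Term.subst2 v₁ v₂ e = (e.subst (substAt 1 v₁)).subst (substAt 0 v₂) := by
  rw [← Term.subst_substAt₂ e 0 h₁ h₂]
  unfold Term.subst2
  congr 1
  funext i
  rcases i with _ | _ | i <;> simp [substAt₂]

/-- The predicates entailed for the type of a value are entailed for all locations in it. -/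
theorem HasOccTy.entails_occ {v : Term} (hv : v.IsValue) : ∀ {P : Constraint} {Γ : VarCtx}
    {M : Multiset Occ} {τ : Ty} {K : PredCon}, P.OnVars → HasOccTy P Γ M v τ → Entails P K τ →
    ∀ a ∈ M, Entails P K a.refTy := by
  induction hv with
  | lam aq τ e =>
    intro P Γ M τ K hP h hE
    obtain ⟨τ₂, _, hC, hτ⟩ := h.inv_lam
    -- An arrow satisfies `K` only if its qualifier imposes `K`, and then the closure rule has
    -- checked `K` on every captured location.
    exact (hC K ((hE.congr hτ.symm).requires_of_arrow hP)).2
  | tabs n P v _ =>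
    intro P Γ M τ K hP h hE
    obtain ⟨τ₀, _, _, _, hτ⟩ := h.inv_tabs
    -- No instance concerns quantified types, so nothing can be entailed for a type abstraction.
    exact ((hE.congr hτ.symm).not_all hP).elim
  | pair _ _ ih₁ ih₂ =>
    intro P Γ M τ K hP h hE a ha
    obtain ⟨_, _, _, _, _, _, _, rfl, h₁, h₂, hτ⟩ := h.inv_pair
    have := (hE.congr hτ.symm).of_prod hP
    exact (Multiset.mem_add.1 ha).elim (ih₁ hP h₁ this.1 a) (ih₂ hP h₂ this.2 a)
  | inl _ ih =>
    intro P Γ M τ K hP h hE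
    obtain ⟨_, _, h, hτ⟩ := h.inv_inl
    exact ih hP h ((hE.congr hτ.symm).of_sum hP).1
  | inr _ ih =>
    intro P Γ M τ K hP h hE
    obtain ⟨_, _, h, hτ⟩ := h.inv_inr
    exact ih hP h ((hE.congr hτ.symm).of_sum hP).2
  | loc l =>
    intro P Γ M τ K hP h hE a ha
    obtain ⟨rq, τ₀, rfl, hτ⟩ := h.inv_loc
    rw [Multiset.mem_singleton.1 ha]
    exact hE.congr hτ.symm
  | unit =>
    intro P Γ M τ K hP h hE a ha
    simp [h.inv_unit.1] at ha

/-- `v` supplies the occurrences `R` to a variable with an optional type. -/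
def Supplies (P : Constraint) (v : Term) (R : Multiset Occ) : Option Ty → Prop
  | none => R = 0
  | some τ => HasOccTy P VarCtx.empty R v τ

/-- The domains are disjoint, so the variable belongs to at most one part, and that part receives
all of `R`: substitution never copies the value across a split. -/
theorem Supplies.split {P : Constraint} {v : Term} {R : Multiset Occ} {Γ Γ₁ Γ₂ : VarCtx} {k : ℕ}
    (h : Supplies P v R (Γ k)) (hΓ : Γ.Splits Γ₁ Γ₂) :
    ∃ R₁ R₂, R = R₁ + R₂ ∧ Supplies P v R₁ (Γ₁ k) ∧ Supplies P v R₂ (Γ₂ k) := by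
  obtain ⟨hc, rfl⟩ := hΓ
  rcases hc k with hk | hk
  · exact ⟨0, R, (zero_add R).symm, by rw [hk]; rfl, by simpa [VarCtx.join, hk] using h⟩
  · exact ⟨R, 0, (add_zero R).symm, by simpa [VarCtx.join, hk] using h, by rw [hk]; rfl⟩

theorem Supplies.tshift {P Q : Constraint} {v : Term} {R : Multiset Occ} {Γ : VarCtx} {k : ℕ}
    (h : Supplies P v R (Γ k)) (n : ℕ) :
    Supplies (P.shift n ++ Q) (v.tshift n) (R.map (Occ.shift n)) (Γ.tshift n k) := by
  unfold VarCtx.tshift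
  cases hk : Γ k with
  | none => rw [hk] at h; cases h; rfl
  | some τ => rw [hk] at h; exact HasOccTy.tshift h n

/-- A closure that captured the variable now captures the locations of the value. The predicates it
demanded of the type of the variable pass to these locations by `HasOccTy.entails_occ`. -/
theorem EntailsOcc.removeAt {P : Constraint} {aq : ArrowQual} {Γ : VarCtx} {M R : Multiset Occ}
    {v : Term} {k : ℕ} (hP : P.OnVars) (hv : v.IsValue) (h : EntailsOcc P aq Γ M)
    (hR : Supplies P v R (Γ k)) : EntailsOcc P aq (Γ.removeAt k) (M + R) := by
  intro K hK
  obtain ⟨h₁, h₂⟩ := h K hK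
  constructor
  · intro x τ hx
    unfold VarCtx.removeAt at hx
    split_ifs at hx
    · exact h₁ _ _ hx
    · exact h₁ _ _ hx
  · intro a ha
    rcases Multiset.mem_add.1 ha with ha | ha
    · exact h₂ a ha
    · cases hk : Γ k with
      | none => rw [hk] at hR; cases hR; simp at ha
      | some τ => rw [hk] at hR; exact HasOccTy.entails_occ hv hP hR (h₁ k τ hk) a ha

/-- The position `k` is arbitrary so that the induction passes binders, and `Supplies` allows the
variable to be absent, since at a split it goes to one side only. -/
theorem HasOccTy.substAt {P : Constraint} {Γ : VarCtx} {M : Multiset Occ} {e : Term} {τ : Ty}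
    (h : HasOccTy P Γ M e τ) : P.OnVars → ∀ {k : ℕ} {v : Term} {R : Multiset Occ}, v.IsValue →
      v.ClosedAt 0 → Supplies P v R (Γ k) →
      HasOccTy P (Γ.removeAt k) (M + R) (e.subst (substAt k v)) τ := by
  induction h with
  | conv _ he ih => exact fun hP _ _ _ hv hc hR => (ih hP hv hc hR).conv he
  | @var P x τ =>
    intro hP k v R hv hc hR
    -- Only for `x = k` is the value used; otherwise `R` is empty, and an index above `k` drops by
    -- one.
    rcases lt_trichotomy x k with h | rfl | h
    · have hx : VarCtx.single x τ k = none := by simp [VarCtx.single, h.ne']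
      rw [hx] at hR
      cases hR
      have : (VarCtx.single x τ).removeAt k = VarCtx.single x τ := by
        funext i
        simp only [VarCtx.removeAt, VarCtx.single]
        split_ifs <;> first | rfl | omega
      rw [this]
      simpa [Term.subst, LambdaCl.substAt, h] using HasOccTy.var
    · have hx : VarCtx.single x τ x = some τ := by simp [VarCtx.single]
      rw [hx] at hR
      have : (VarCtx.single x τ).removeAt x = VarCtx.empty := by
        funext i
        simp only [VarCtx.removeAt, VarCtx.single, VarCtx.empty]
        split_ifs <;> first | rfl | omega
      rw [this]
      simpa [Term.subst, LambdaCl.substAt, Supplies] using hR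
    · have hx : VarCtx.single x τ k = none := by simp [VarCtx.single, h.ne]
      rw [hx] at hR
      cases hR
      have : (VarCtx.single x τ).removeAt k = VarCtx.single (x - 1) τ := by
        funext i
        simp only [VarCtx.removeAt, VarCtx.single]
        split_ifs <;> first | rfl | omega
      rw [this]
      simpa [Term.subst, LambdaCl.substAt, h.not_gt, h.ne'] using HasOccTy.var
  | tabs hv' _ hP₂ ih =>
    intro hP k v R hv hc hR
    simp only [Term.subst, substAt_tshift]
    refine .tabs (hv'.subst _) ?_ hP₂
    rw [Multiset.map_add, ← VarCtx.removeAt_tshift]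
    -- The form imposed on the constraints of a type abstraction keeps all hypotheses on type
    -- variables, as `HasOccTy.entails_occ` needs.
    exact ih (hP.shift_append hP₂) (hv.tsubst _) (hc.tsubst _) (hR.tshift _)
  | tapp _ hn hE ih => exact fun hP _ _ _ hv hc hR => .tapp (ih hP hv hc hR) hn hE
  | lam _ hE ih =>
    intro hP k v R hv hc hR
    refine .lam ?_ (hE.removeAt hP hv hR)
    rw [liftSub_substAt hc, ← VarCtx.removeAt_cons]
    exact ih hP hv hc hR
  | app _ _ hΓ ih₁ ih₂ =>
    intro hP k v R hv hc hR
    obtain ⟨R₁, R₂, rfl, hR₁, hR₂⟩ := hR.split hΓ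
    rw [add_add_add_comm]
    exact .app (ih₁ hP hv hc hR₁) (ih₂ hP hv hc hR₂) (hΓ.removeAt k)
  | unit =>
    intro hP k v R hv hc hR
    cases hR
    have : VarCtx.empty.removeAt k = VarCtx.empty := by
      funext i
      simp [VarCtx.removeAt, VarCtx.empty]
    rw [this]
    exact .unit
  | pair _ _ hΓ ih₁ ih₂ =>
    intro hP k v R hv hc hR
    obtain ⟨R₁, R₂, rfl, hR₁, hR₂⟩ := hR.split hΓ
    rw [add_add_add_comm]
    exact .pair (ih₁ hP hv hc hR₁) (ih₂ hP hv hc hR₂) (hΓ.removeAt k)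
  | letPair _ _ hΓ ih₁ ih₂ =>
    intro hP k v R hv hc hR
    obtain ⟨R₁, R₂, rfl, hR₁, hR₂⟩ := hR.split hΓ
    rw [add_add_add_comm]
    refine .letPair (ih₁ hP hv hc hR₁) ?_ (hΓ.removeAt k)
    rw [liftSub_substAt hc, ← VarCtx.removeAt_cons, ← VarCtx.removeAt_cons]
    exact ih₂ hP hv hc hR₂
  | inl _ ih => exact fun hP _ _ _ hv hc hR => .inl (ih hP hv hc hR)
  | inr _ ih => exact fun hP _ _ _ hv hc hR => .inr (ih hP hv hc hR)
  | caseOf _ _ _ hΓ ih₁ ih₂ ih₃ =>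
    intro hP k v R hv hc hR
    obtain ⟨R₁, R₂, rfl, hR₁, hR₂⟩ := hR.split hΓ
    rw [add_add_add_comm]
    -- Both branches receive the same `R₂`: only one of them will run.
    refine .caseOf (ih₁ hP hv hc hR₁) ?_ ?_ (hΓ.removeAt k)
    · rw [liftSub_substAt hc, ← VarCtx.removeAt_cons]
      exact ih₂ hP hv hc hR₂
    · rw [liftSub_substAt hc, ← VarCtx.removeAt_cons]
      exact ih₃ hP hv hc hR₂
  | dup _ _ hE hΓ ih₁ ih₂ =>
    intro hP k v R hv hc hR
    obtain ⟨R₁, R₂, rfl, hR₁, hR₂⟩ := hR.split hΓ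
    rw [add_add_add_comm]
    refine .dup (ih₁ hP hv hc hR₁) ?_ hE (hΓ.removeAt k)
    rw [liftSub_substAt hc, ← VarCtx.removeAt_cons, ← VarCtx.removeAt_cons]
    exact ih₂ hP hv hc hR₂
  | drop _ _ hE hΓ ih₁ ih₂ =>
    intro hP k v R hv hc hR
    obtain ⟨R₁, R₂, rfl, hR₁, hR₂⟩ := hR.split hΓ
    rw [add_add_add_comm]
    exact .drop (ih₁ hP hv hc hR₁) (ih₂ hP hv hc hR₂) hE (hΓ.removeAt k)
  | new _ ih => exact fun hP _ _ _ hv hc hR => .new (ih hP hv hc hR)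
  | loc =>
    intro hP k v R hv hc hR
    cases hR
    have : VarCtx.empty.removeAt k = VarCtx.empty := by
      funext i
      simp [VarCtx.removeAt, VarCtx.empty]
    rw [this]
    exact .loc
  | releaseW _ ih => exact fun hP _ _ _ hv hc hR => .releaseW (ih hP hv hc hR)
  | releaseS _ ih => exact fun hP _ _ _ hv hc hR => .releaseS (ih hP hv hc hR)
  | swapW _ _ hΓ ih₁ ih₂ =>
    intro hP k v R hv hc hR
    obtain ⟨R₁, R₂, rfl, hR₁, hR₂⟩ := hR.split hΓ
    rw [add_add_add_comm]
    exact .swapW (ih₁ hP hv hc hR₁) (ih₂ hP hv hc hR₂) (hΓ.removeAt k)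
  | swapS _ _ hΓ ih₁ ih₂ =>
    intro hP k v R hv hc hR
    obtain ⟨R₁, R₂, rfl, hR₁, hR₂⟩ := hR.split hΓ
    rw [add_add_add_comm]
    exact .swapS (ih₁ hP hv hc hR₁) (ih₂ hP hv hc hR₂) (hΓ.removeAt k)

theorem HasOccTy.subst1 {P : Constraint} {Γ : VarCtx} {M R : Multiset Occ} {e v : Term}
    {τ τ₁ : Ty} (hP : P.OnVars) (h : HasOccTy P (Γ.cons τ₁) M e τ) (hv : v.IsValue)
    (hR : HasOccTy P VarCtx.empty R v τ₁) : HasOccTy P Γ (M + R) (Term.subst1 v e) τ := by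
  rw [Term.subst1_eq, ← VarCtx.removeAt_zero_cons τ₁ Γ]
  exact h.substAt hP hv (hR.closedAt fun _ _ => rfl) hR

theorem HasOccTy.subst2 {P : Constraint} {Γ : VarCtx} {M R₁ R₂ : Multiset Occ} {e v₁ v₂ : Term}
    {τ τ₁ τ₂ : Ty} (hP : P.OnVars) (h : HasOccTy P ((Γ.cons τ₁).cons τ₂) M e τ)
    (hv₁ : v₁.IsValue) (hv₂ : v₂.IsValue) (hR₁ : HasOccTy P VarCtx.empty R₁ v₁ τ₁)
    (hR₂ : HasOccTy P VarCtx.empty R₂ v₂ τ₂) :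
    HasOccTy P Γ (M + R₁ + R₂) (Term.subst2 v₁ v₂ e) τ := by
  have hc₁ : v₁.ClosedAt 0 := hR₁.closedAt fun _ _ => rfl
  have hc₂ : v₂.ClosedAt 0 := hR₂.closedAt fun _ _ => rfl
  rw [Term.subst2_eq e hc₁ hc₂]
  -- Index `1` goes first, so that index `0` is still in place for the second substitution.
  have := h.substAt hP (k := 1) hv₁ hc₁ hR₁
  rw [VarCtx.removeAt_cons, VarCtx.removeAt_zero_cons] at this
  rw [← VarCtx.removeAt_zero_cons τ₂ Γ]
  exact this.substAt hP hv₂ hc₂ hR₂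

/-- Links the untyped count that evaluation uses with the typed one. Counting only the first branch
of a `case` is harmless, as both branches have the same multiset. -/
theorem HasOccTy.locs_eq {P : Constraint} {Γ : VarCtx} {M : Multiset Occ} {e : Term} {τ : Ty}
    (h : HasOccTy P Γ M e τ) : e.locs = M.map Prod.fst := by
  induction h with
  | conv _ _ ih => exact ih
  | var | unit => rfl
  | tabs _ _ _ ih => simpa [Term.locs, Occ.shift, Function.comp_def] using ih
  | loc => rfl
  | tapp _ _ _ ih => exact ih
  | lam _ _ ih => exact ih
  | inl _ ih | inr _ ih | new _ ih | releaseW _ ih | releaseS _ ih => exact ih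
  | _ => simp_all [Term.locs]

/-! ## Store typing with multisets of occurrences -/

/-- The entry of a cell with a given qualifier, reference count, and type of contents. -/
def LocEntry.ofCell : RefQual → ℕ → Ty → LocEntry
  | .s, _, τ => .strong τ
  | .w, i, τ => .weak i τ

theorem LocEntry.occs_ofCell {rq : RefQual} {i : ℕ} {τ : Ty} (l : Loc) (h : rq = .s → i = 1) :
    (ofCell rq i τ).occs l = Multiset.replicate i (l, rq, τ) := by
  cases rq with
  | s => rw [h rfl]; rfl
  | w => rfl

/-- Store typing, where `M` is the multiset of the occurrences in the contents of the store. -/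
inductive StoreOccTy : Multiset Occ → Store → LocCtx → Prop
  | nil : StoreOccTy 0 ∅ LocCtx.empty
  | cons {M N : Multiset Occ} {S : LocCtx} {μ : Store} {l : Loc} {rq : RefQual} {i : ℕ}
      {v : Term} {τ : Ty} :
      StoreOccTy M μ S → v.IsValue → HasOccTy [] VarCtx.empty N v τ → l ∉ μ → S l = none →
      (rq = .s → i = 1) →
      StoreOccTy (M + N) (μ.insert l (i, v)) (S.extend l (.ofCell rq i τ))

theorem StoreTy.exists_storeOccTy {S S' : LocCtx} {μ : Store} (h : StoreTy S μ S') :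
    ∃ M, Describes S M ∧ StoreOccTy M μ S' := by
  induction h with
  | nil => exact ⟨0, .empty, .nil⟩
  | consW _ hv hN hS hl hl' ih =>
    obtain ⟨M, hM, h⟩ := ih
    obtain ⟨N, hN, hv'⟩ := hN.exists_hasOccTy
    exact ⟨M + N, hM.join hN hS, h.cons (rq := .w) hv hv' hl hl' (by simp)⟩
  | consS _ hv hN hS hl hl' ih =>
    obtain ⟨M, hM, h⟩ := ih
    obtain ⟨N, hN, hv'⟩ := hN.exists_hasOccTy
    exact ⟨M + N, hM.join hN hS, h.cons (rq := .s) hv hv' hl hl' (by simp)⟩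

theorem StoreOccTy.storeTy {M : Multiset Occ} {μ : Store} {S' : LocCtx}
    (h : StoreOccTy M μ S') : ∀ {S : LocCtx}, Describes S M → StoreTy S μ S' := by
  induction h with
  | nil => exact fun hS => hS.unique_left .empty ▸ .nil
  | @cons M N S₂ μ l rq i v τ _ hv hN hl hl' hi ih =>
    intro S hS
    obtain ⟨S₁, Sv, h₁, h₂, hS⟩ := hS.split
    cases rq with
    | w => exact .consW (ih h₁) hv (hN.hasTy h₂) hS hl hl'
    | s =>
      obtain rfl := hi rfl
      exact .consS (ih h₁) hv (hN.hasTy h₂) hS hl hl'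

theorem StoreOccTy.eq_none_iff {M : Multiset Occ} {μ : Store} {S : LocCtx}
    (h : StoreOccTy M μ S) (l : Loc) : S l = none ↔ l ∉ μ := by
  induction h with
  | nil => simp [LocCtx.empty, Finmap.notMem_empty]
  | @cons M N S μ l' rq i v τ _ _ _ _ _ _ ih =>
    by_cases e : l = l' <;> simp [LocCtx.extend, e, Finmap.mem_insert, ih]

theorem LocCtx.extend_comm (S : LocCtx) {l l' : Loc} (h : l ≠ l') (a b : LocEntry) :
    (S.extend l a).extend l' b = (S.extend l' b).extend l a :=
  Function.update_comm h.symm _ _ S |>.symm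

theorem Store.erase_insert_of_ne (μ : Store) {l l' : Loc} (h : l ≠ l') (x : ℕ × Term) :
    (μ.insert l' x).erase l = (μ.erase l).insert l' x := by
  refine Finmap.ext_lookup fun k => ?_
  by_cases e : k = l
  · subst e
    rw [Finmap.lookup_erase, Finmap.lookup_insert_of_ne _ h, Finmap.lookup_erase]
  · rw [Finmap.lookup_erase_ne e]
    by_cases e' : k = l'
    · subst e'
      rw [Finmap.lookup_insert, Finmap.lookup_insert]
    · rw [Finmap.lookup_insert_of_ne _ e', Finmap.lookup_insert_of_ne _ e',
        Finmap.lookup_erase_ne e]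

theorem Store.erase_insert_self (μ : Store) {l : Loc} (h : l ∉ μ) (x : ℕ × Term) :
    (μ.insert l x).erase l = μ := by
  refine Finmap.ext_lookup fun k => ?_
  by_cases e : k = l
  · subst e
    rw [Finmap.lookup_erase, Finmap.lookup_eq_none.2 h]
  · rw [Finmap.lookup_erase_ne e, Finmap.lookup_insert_of_ne _ e]

theorem Store.insert_erase_self (μ : Store) (l : Loc) (x : ℕ × Term) :
    (μ.erase l).insert l x = μ.insert l x := by
  refine Finmap.ext_lookup fun k => ?_
  by_cases e : k = l
  · subst e
    rw [Finmap.lookup_insert, Finmap.lookup_insert]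
  · rw [Finmap.lookup_insert_of_ne _ e, Finmap.lookup_insert_of_ne _ e, Finmap.lookup_erase_ne e]

/-- Any cell of a typed store can be taken out. -/
theorem StoreOccTy.erase {M : Multiset Occ} {μ : Store} {S : LocCtx} (h : StoreOccTy M μ S)
    {l : Loc} {i : ℕ} {v : Term} : μ.lookup l = some (i, v) →
    ∃ M' N S' rq τ, M = M' + N ∧ StoreOccTy M' (μ.erase l) S' ∧ v.IsValue ∧
      HasOccTy [] VarCtx.empty N v τ ∧ S' l = none ∧ (rq = .s → i = 1) ∧
      S = S'.extend l (.ofCell rq i τ) := by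
  induction h with
  | nil => intro h; simp at h
  | @cons M₀ N₀ S₀ μ₀ l₀ rq₀ i₀ v₀ τ₀ h hv hN hl hl' hi ih =>
    intro hlook
    rcases eq_or_ne l l₀ with rfl | hne
    · rw [Finmap.lookup_insert] at hlook
      cases hlook
      exact ⟨M₀, N₀, S₀, rq₀, τ₀, rfl, by rwa [Store.erase_insert_self _ hl], hv, hN, hl', hi, rfl⟩
    · rw [Finmap.lookup_insert_of_ne _ hne] at hlook
      obtain ⟨M', N, S', rq, τ, rfl, h', hv', hN', hl'', hi', rfl⟩ := ih hlook
      have hS : S' l₀ = none := by simpa [LocCtx.extend, hne.symm] using hl'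
      -- The cell lies below the top one: take it out of the smaller store and put the top cell
      -- back, using that entries at distinct locations commute.
      refine ⟨M' + N₀, N, S'.extend l₀ (.ofCell rq₀ i₀ τ₀), rq, τ, add_right_comm _ _ _, ?_, hv', hN',
        by simpa [LocCtx.extend, hne] using hl'', hi', LocCtx.extend_comm _ hne _ _⟩
      rw [Store.erase_insert_of_ne _ hne]
      exact .cons h' hv hN (by simp [Finmap.mem_erase, hl]) hS hi

/-- The store `μ` is well-typed, `M` is the multiset of the occurrences in its contents, and its
reference counts account for these and for the occurrences `X` outside of the store. -/
def StoreFits (μ : Store) (M X : Multiset Occ) : Prop :=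
  ∃ S, StoreOccTy M μ S ∧ Describes S (M + X)

theorem LocEntry.ofCell_ne_weak_zero (rq : RefQual) (i : ℕ) (τ τ' : Ty) :
    ofCell rq (i + 1) τ ≠ .weak 0 τ' := by
  cases rq <;> simp [ofCell]

/-- Taking out the cell of a location that occurs outside of the store. -/
theorem StoreFits.exists_erase {μ : Store} {M X : Multiset Occ} {l : Loc} {rq : RefQual} {τ : Ty}
    (h : StoreFits μ M ((l, rq, τ) ::ₘ X)) :
    ∃ k v M' N S Y, μ.lookup l = some (k + 1, v) ∧ M = M' + N ∧ StoreOccTy M' (μ.erase l) S ∧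
      v.IsValue ∧ HasOccTy [] VarCtx.empty N v τ ∧ (rq = .s → k = 0) ∧ Describes S Y ∧
      M' + N + X = Multiset.replicate k (l, rq, τ) + Y := by
  obtain ⟨S, hS, hd⟩ := h
  have hmem : (l, rq, τ) ∈ M + ((l, rq, τ) ::ₘ X) := by simp
  obtain ⟨b, hb, _⟩ := hd.exists_of_mem hmem
  have hl : l ∈ μ := by
    by_contra hl
    rw [(hS.eq_none_iff l).2 hl] at hb
    cases hb
  obtain ⟨⟨i, v⟩, hlook⟩ := Finmap.mem_iff.1 hl
  obtain ⟨M', N, S', rq', τ', rfl, h', hv, hN, hl', hi, rfl⟩ := hS.erase hlook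
  obtain ⟨Y, hY, hd'⟩ := hd.exists_eq_add hl'
  rw [LocEntry.occs_ofCell l hi] at hY
  -- Every occurrence of `l` is accounted for by the cell of `l`, because the rest of the context
  -- has no entry for `l`. Hence occurrence and cell agree in qualifier and type, and the count is
  -- positive.
  have hmem' : (l, rq, τ) ∈ Multiset.replicate i (l, rq', τ') := by
    rw [hY] at hmem
    refine (Multiset.mem_add.1 hmem).resolve_right fun hm => ?_
    obtain ⟨b, hb, _⟩ := hd'.exists_of_mem hm
    rw [hl'] at hb
    cases hb
  obtain ⟨hi0, he⟩ := Multiset.mem_replicate.1 hmem'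
  cases he
  obtain ⟨k, rfl⟩ := Nat.exists_eq_succ_of_ne_zero hi0
  refine ⟨k, v, M', N, S', Y, hlook, rfl, h', hv, hN, fun e => by simpa using hi e, hd', ?_⟩
  -- Cancel the given occurrence of `l` against one unit of the count.
  rw [Multiset.add_cons, Nat.succ_eq_add_one, Multiset.replicate_succ, Multiset.cons_add] at hY
  exact (Multiset.cons_inj_right _).1 hY

/-- Adding a cell. -/
theorem StoreOccTy.storeFits_insert {μ : Store} {M N X Y : Multiset Occ} {S : LocCtx} {l : Loc}
    {rq : RefQual} {k : ℕ} {v : Term} {τ : Ty} (h : StoreOccTy M μ S) (hd : Describes S Y)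
    (hl : l ∉ μ) (hv : v.IsValue) (hN : HasOccTy [] VarCtx.empty N v τ) (hk : rq = .s → k = 0)
    (hX : M + N + X = Multiset.replicate (k + 1) (l, rq, τ) + Y) :
    StoreFits (μ.insert l (k + 1, v)) (M + N) X := by
  have hl' := (h.eq_none_iff l).2 hl
  have hk' : rq = .s → k + 1 = 1 := fun e => by rw [hk e]
  refine ⟨_, h.cons hv hN hl hl' hk', ?_⟩
  rw [hX, ← LocEntry.occs_ofCell l hk']
  exact hd.extend hl' (LocEntry.ofCell_ne_weak_zero _ _ _)

/-- The occurrences in `v` move from the term into the store, and the fresh location gets its only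
occurrence in the term. -/
theorem StoreFits.new {μ : Store} {M N X : Multiset Occ} {l : Loc} {v : Term} {τ : Ty}
    (h : StoreFits μ M (N + X)) (rq : RefQual) (hl : l ∉ μ) (hv : v.IsValue)
    (hN : HasOccTy [] VarCtx.empty N v τ) :
    StoreFits (μ.insert l (1, v)) (M + N) ((l, rq, τ) ::ₘ X) := by
  obtain ⟨S, hS, hd⟩ := h
  refine hS.storeFits_insert hd hl hv hN (rq := rq) (k := 0) (fun _ => rfl) ?_
  rw [Multiset.add_cons, add_assoc]
  rfl

/-- Exchanging the contents of a cell; the type of a strong cell may change. -/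
theorem StoreFits.swap {μ : Store} {M N₂ X : Multiset Occ} {l : Loc} {rq : RefQual} {i : ℕ}
    {v₁ v₂ : Term} {τ₁ τ₂ : Ty} (h : StoreFits μ M ((l, rq, τ₁) ::ₘ (N₂ + X)))
    (hl : μ.lookup l = some (i, v₁)) (hv₂ : v₂.IsValue) (hN₂ : HasOccTy [] VarCtx.empty N₂ v₂ τ₂)
    (hτ : rq = .s ∨ τ₁ = τ₂) :
    ∃ M' N₁, HasOccTy [] VarCtx.empty N₁ v₁ τ₁ ∧
      StoreFits (μ.insert l (i, v₂)) M' ((l, rq, τ₂) ::ₘ (N₁ + X)) := by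
  obtain ⟨k, v, M', N₁, S, Y, hl', rfl, hS, hv, hN₁, hk, hd, hY⟩ := h.exists_erase
  rw [hl] at hl'
  cases hl'
  refine ⟨M' + N₂, N₁, hN₁, ?_⟩
  rw [← Store.insert_erase_self]
  refine hS.storeFits_insert hd Finmap.notMem_erase_self hv₂ hN₂ hk ?_
  rw [Multiset.add_cons, Multiset.replicate_succ, Multiset.cons_add]
  congr 1
  -- No remaining occurrence sees a change of type: a strong cell has no others, and a weak cell
  -- keeps its type.
  have e : Multiset.replicate k (l, rq, τ₂) = Multiset.replicate k (l, rq, τ₁) := by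
    rcases hτ with hs | rfl
    · simp [hk hs]
    · rfl
  rw [e, ← hY]
  abel

/-- With count one, the given occurrence of `l` is the last. The occurrences in the contents move
out of the store. -/
theorem StoreFits.erase {μ : Store} {M X : Multiset Occ} {l : Loc} {rq : RefQual} {v : Term}
    {τ : Ty} (h : StoreFits μ M ((l, rq, τ) ::ₘ X)) (hl : μ.lookup l = some (1, v)) :
    ∃ M' N, M = M' + N ∧ HasOccTy [] VarCtx.empty N v τ ∧ StoreFits (μ.erase l) M' (N + X) := by
  obtain ⟨k, v', M', N, S, Y, hl', rfl, hS, hv, hN, hk, hd, hY⟩ := h.exists_erase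
  rw [hl] at hl'
  cases hl'
  refine ⟨M', N, rfl, hN, S, hS, ?_⟩
  rw [← add_assoc, hY]
  simpa using hd

theorem StoreFits.decr {μ : Store} {M X : Multiset Occ} {l : Loc} {rq : RefQual} {i : ℕ}
    {v : Term} {τ : Ty} (h : StoreFits μ M ((l, rq, τ) ::ₘ X)) (hl : μ.lookup l = some (i, v))
    (hi : 1 < i) : StoreFits (μ.insert l (i - 1, v)) M X := by
  obtain ⟨k, v', M', N, S, Y, hl', rfl, hS, hv, hN, hk, hd, hY⟩ := h.exists_erase
  rw [hl] at hl'
  cases hl'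
  -- The count is `k + 1 > 1`, so after giving up one occurrence it is still positive, as
  -- `Describes` requires.
  obtain ⟨j, rfl⟩ := Nat.exists_eq_succ_of_ne_zero (show k ≠ 0 by omega)
  rw [← Store.insert_erase_self]
  exact hS.storeFits_insert hd Finmap.notMem_erase_self hv hN (fun e => by simpa using hk e) hY

/-- An existing weak occurrence witnesses the cell and its type; a weak cell may have any positive
count. -/
theorem StoreFits.incr {μ : Store} {M X : Multiset Occ} {l : Loc} {i : ℕ} {v : Term} {τ : Ty}
    (h : StoreFits μ M X) (hX : (l, .w, τ) ∈ X) (hl : μ.lookup l = some (i, v)) :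
    StoreFits (μ.insert l (i + 1, v)) M ((l, .w, τ) ::ₘ X) := by
  obtain ⟨X, rfl⟩ := Multiset.exists_cons_of_mem hX
  obtain ⟨k, v', M', N, S, Y, hl', rfl, hS, hv, hN, hk, hd, hY⟩ := h.exists_erase
  rw [hl] at hl'
  cases hl'
  rw [← Store.insert_erase_self]
  refine hS.storeFits_insert hd Finmap.notMem_erase_self hv hN (rq := .w) (by simp) ?_
  rw [Multiset.add_cons, Multiset.add_cons, hY, Multiset.replicate_succ, Multiset.replicate_succ,
    Multiset.cons_add, Multiset.cons_add]

theorem StoreFits.exists_lookup {μ : Store} {M X : Multiset Occ} {a : Occ}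
    (h : StoreFits μ M (a ::ₘ X)) :
    ∃ k v, μ.lookup a.1 = some (k + 1, v) ∧ v.IsValue ∧ (a.2.1 = .s → k = 0) := by
  obtain ⟨k, v, _, _, _, _, hl, _, _, hv, _, hk, _⟩ := h.exists_erase
  exact ⟨k, v, hl, hv, hk⟩

/-! ## Iterated increments and decrements -/

/-- Evaluation may list the locations of a value in any order. Such a listing lifts to one of the
typed occurrences, on which the invariant is stated. -/
theorem exists_list_map_eq {α β : Type*} {f : α → β} {ls : List β} {M : Multiset α}
    (h : (ls : Multiset β) = M.map f) : ∃ D : List α, (D : Multiset α) = M ∧ D.map f = ls := by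
  induction ls generalizing M with
  | nil => exact ⟨[], (Multiset.map_eq_zero.1 h.symm).symm, rfl⟩
  | cons b ls ih =>
    rw [← Multiset.cons_coe] at h
    obtain ⟨a, ha, rfl⟩ := Multiset.mem_map.1 (h ▸ Multiset.mem_cons_self b _)
    obtain ⟨M, rfl⟩ := Multiset.exists_cons_of_mem ha
    rw [Multiset.map_cons, Multiset.cons_inj_right] at h
    obtain ⟨D, rfl, rfl⟩ := ih h
    exact ⟨a :: D, rfl, rfl⟩

/-- Increments only add occurrences, so the original ones in `X` stay available as witnesses for
every step of the iteration. -/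
theorem StoreFits.of_incr {μ : Store} {M X : Multiset Occ} (h : StoreFits μ M X) :
    ∀ {D : List Occ} {μ' : Store}, (∀ a ∈ D, a ∈ X ∧ a.2.1 = .w) → Incr (D.map Prod.fst) μ μ' →
      StoreFits μ' M (D + X) := by
  intro D
  induction D with
  | nil =>
    intro μ' _ hI
    cases hI
    simpa using h
  | cons a D ih =>
    intro μ' hD hI
    obtain ⟨l, rq, τ⟩ := a
    obtain ⟨haX, hw⟩ := hD _ List.mem_cons_self
    simp only at hw
    subst hw
    cases hI with
    | cons hI hl =>
      have := ih (fun b hb => hD b (List.mem_cons_of_mem _ hb)) hI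
      rw [← Multiset.cons_coe, Multiset.cons_add]
      exact this.incr (Multiset.mem_add.2 (.inr haX)) hl

theorem StoreFits.exists_incr {μ : Store} {M X : Multiset Occ} (h : StoreFits μ M X) :
    ∀ {D : List Occ}, (∀ a ∈ D, a ∈ X ∧ a.2.1 = .w) → ∃ μ', Incr (D.map Prod.fst) μ μ' := by
  intro D
  induction D with
  | nil => exact fun _ => ⟨μ, .nil μ⟩
  | cons a D ih =>
    intro hD
    have hD' := fun b hb => hD b (List.mem_cons_of_mem _ hb)
    obtain ⟨μ', hI⟩ := ih hD'
    have hf := h.of_incr hD' hI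
    obtain ⟨Y, hY⟩ := Multiset.exists_cons_of_mem
      (Multiset.mem_add.2 (.inr (hD a List.mem_cons_self).1) : a ∈ (D : Multiset Occ) + X)
    rw [hY] at hf
    obtain ⟨k, v, hl, _⟩ := hf.exists_lookup
    exact ⟨_, .cons hI hl⟩

/-- When a cell is freed, the occurrences in its contents become the outside occurrences that the
nested decrements consume. The bound on cardinalities is the measure needed to show that the cascade
is defined. -/
theorem StoreFits.of_decr {ls : List Loc} {μ μ' : Store} (hD : Decr ls μ μ') :
    ∀ {D : List Occ} {M X : Multiset Occ}, D.map Prod.fst = ls → StoreFits μ M (D + X) →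
      ∃ M', StoreFits μ' M' X ∧ Multiset.card M' ≤ Multiset.card M + D.length := by
  induction hD with
  | nil μ =>
    intro D M X hD h
    obtain rfl := List.map_eq_nil_iff.1 hD
    exact ⟨M, by simpa using h, by simp⟩
  | last _ hl hls _ ih₁ ih₂ =>
    intro D M X hD h
    obtain ⟨a, D, rfl, rfl, hD₁⟩ := List.map_eq_cons_iff.1 hD
    -- The tail of the list is decremented first; meanwhile the occurrence at the head waits among
    -- the outside ones.
    rw [← Multiset.cons_coe, Multiset.cons_add, ← Multiset.add_cons] at h
    obtain ⟨M₁, h₁, hc₁⟩ := ih₁ hD₁ h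
    obtain ⟨M₂, N, rfl, hN, h₂⟩ := h₁.erase hl
    rw [hN.locs_eq] at hls
    obtain ⟨D', rfl, hD'⟩ := exists_list_map_eq hls
    obtain ⟨M₃, h₃, hc₃⟩ := ih₂ hD' h₂
    refine ⟨M₃, h₃, ?_⟩
    simp only [Multiset.card_add, Multiset.coe_card, List.length_cons] at hc₁ ⊢
    omega
  | more _ hl hj ih =>
    intro D M X hD h
    obtain ⟨a, D, rfl, rfl, hD₁⟩ := List.map_eq_cons_iff.1 hD
    rw [← Multiset.cons_coe, Multiset.cons_add, ← Multiset.add_cons] at h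
    obtain ⟨M₁, h₁, hc₁⟩ := ih hD₁ h
    exact ⟨M₁, h₁.decr hl hj, hc₁.trans (by simp)⟩

/-- Induction on a bound for the stored plus the pending occurrences. A decrement consumes one
pending occurrence, and freeing a cell only turns stored occurrences into pending ones, so even
cyclic stores cause no infinite cascade. -/
theorem StoreFits.exists_decr (n : ℕ) : ∀ {μ : Store} {D : List Occ} {M X : Multiset Occ},
    Multiset.card M + D.length ≤ n → StoreFits μ M (D + X) →
    ∃ μ', Decr (D.map Prod.fst) μ μ' := by
  induction n with
  | zero =>
    intro μ D M X hn _
    obtain rfl : D = [] := List.length_eq_zero_iff.1 (by omega)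
    exact ⟨μ, .nil μ⟩
  | succ n ih =>
    intro μ D M X hn h
    cases D with
    | nil => exact ⟨μ, .nil μ⟩
    | cons a D =>
      rw [List.length_cons] at hn
      rw [← Multiset.cons_coe, Multiset.cons_add, ← Multiset.add_cons] at h
      obtain ⟨μ₁, hd₁⟩ := ih (by omega) h
      obtain ⟨M₁, h₁, hc₁⟩ := h.of_decr hd₁ rfl
      obtain ⟨k, v, hl, _⟩ := h₁.exists_lookup
      cases k with
      | zero =>
        obtain ⟨M₂, N, rfl, hN, h₂⟩ := h₁.erase hl
        obtain ⟨D', hD'⟩ := Quotient.exists_rep N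
        change (D' : Multiset Occ) = N at hD'
        subst hD'
        simp only [Multiset.card_add, Multiset.coe_card] at hc₁
        obtain ⟨μ₂, hd₂⟩ := ih (by omega) h₂
        exact ⟨μ₂, .last hd₁ hl (by simp [hN.locs_eq]) hd₂⟩
      | succ k => exact ⟨_, .more hd₁ hl (by omega)⟩

/-! ## Canonical forms -/

section Canonical

variable {P : Constraint} {Γ : VarCtx} {M : Multiset Occ} {v : Term}

/-- A value of any other shape has, by inversion, a type identified with one of a different head
constructor, which `TyEq.headEq` refutes. The other canonical forms follow in the same way. -/
theorem HasOccTy.canonical_arrow {aq : ArrowQual} {τ₁ τ₂ : Ty} (hv : v.IsValue)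
    (h : HasOccTy P Γ M v (.arrow aq τ₁ τ₂)) : ∃ aq' τ e, v = .lam aq' τ e := by
  cases hv with
  | lam => exact ⟨_, _, _, rfl⟩
  | tabs => obtain ⟨_, _, _, _, he⟩ := h.inv_tabs; exact he.headEq.elim
  | pair => obtain ⟨_, _, _, _, _, _, _, _, _, _, he⟩ := h.inv_pair; exact he.headEq.elim
  | inl => obtain ⟨_, _, _, he⟩ := h.inv_inl; exact he.headEq.elim
  | inr => obtain ⟨_, _, _, he⟩ := h.inv_inr; exact he.headEq.elim
  | loc => obtain ⟨_, _, _, he⟩ := h.inv_loc; exact he.headEq.elim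
  | unit => exact h.inv_unit.2.headEq.elim

theorem HasOccTy.canonical_all {n : ℕ} {P₂ : Constraint} {τ : Ty} (hv : v.IsValue)
    (h : HasOccTy P Γ M v (.all n P₂ τ)) : ∃ P₂' v', v = .tabs n P₂' v' ∧ v'.IsValue := by
  cases hv with
  | lam => obtain ⟨_, _, _, he⟩ := h.inv_lam; exact he.headEq.elim
  | tabs =>
    obtain ⟨_, hv, _, _, he⟩ := h.inv_tabs
    obtain ⟨rfl, _⟩ := he.headEq
    exact ⟨_, _, rfl, hv⟩
  | pair => obtain ⟨_, _, _, _, _, _, _, _, _, _, he⟩ := h.inv_pair; exact he.headEq.elim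
  | inl => obtain ⟨_, _, _, he⟩ := h.inv_inl; exact he.headEq.elim
  | inr => obtain ⟨_, _, _, he⟩ := h.inv_inr; exact he.headEq.elim
  | loc => obtain ⟨_, _, _, he⟩ := h.inv_loc; exact he.headEq.elim
  | unit => exact h.inv_unit.2.headEq.elim

theorem HasOccTy.canonical_prod {τ₁ τ₂ : Ty} (hv : v.IsValue)
    (h : HasOccTy P Γ M v (.prod τ₁ τ₂)) :
    ∃ v₁ v₂, v = .pair v₁ v₂ ∧ v₁.IsValue ∧ v₂.IsValue := by
  cases hv with
  | lam => obtain ⟨_, _, _, he⟩ := h.inv_lam; exact he.headEq.elim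
  | tabs => obtain ⟨_, _, _, _, he⟩ := h.inv_tabs; exact he.headEq.elim
  | pair hv₁ hv₂ => exact ⟨_, _, rfl, hv₁, hv₂⟩
  | inl => obtain ⟨_, _, _, he⟩ := h.inv_inl; exact he.headEq.elim
  | inr => obtain ⟨_, _, _, he⟩ := h.inv_inr; exact he.headEq.elim
  | loc => obtain ⟨_, _, _, he⟩ := h.inv_loc; exact he.headEq.elim
  | unit => exact h.inv_unit.2.headEq.elim

theorem HasOccTy.canonical_sum {τ₁ τ₂ : Ty} (hv : v.IsValue)
    (h : HasOccTy P Γ M v (.sum τ₁ τ₂)) : ∃ v', v'.IsValue ∧ (v = .inl v' ∨ v = .inr v') := by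
  cases hv with
  | lam => obtain ⟨_, _, _, he⟩ := h.inv_lam; exact he.headEq.elim
  | tabs => obtain ⟨_, _, _, _, he⟩ := h.inv_tabs; exact he.headEq.elim
  | pair => obtain ⟨_, _, _, _, _, _, _, _, _, _, he⟩ := h.inv_pair; exact he.headEq.elim
  | inl hv => exact ⟨_, hv, .inl rfl⟩
  | inr hv => exact ⟨_, hv, .inr rfl⟩
  | loc => obtain ⟨_, _, _, he⟩ := h.inv_loc; exact he.headEq.elim
  | unit => exact h.inv_unit.2.headEq.elim

theorem HasOccTy.canonical_ref {rq : RefQual} {τ : Ty} (hv : v.IsValue)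
    (h : HasOccTy P Γ M v (.ref rq τ)) : ∃ l τ₀, v = .loc l ∧ M = {(l, rq, τ₀)} := by
  cases hv with
  | lam => obtain ⟨_, _, _, he⟩ := h.inv_lam; exact he.headEq.elim
  | tabs => obtain ⟨_, _, _, _, he⟩ := h.inv_tabs; exact he.headEq.elim
  | pair => obtain ⟨_, _, _, _, _, _, _, _, _, _, he⟩ := h.inv_pair; exact he.headEq.elim
  | inl => obtain ⟨_, _, _, he⟩ := h.inv_inl; exact he.headEq.elim
  | inr => obtain ⟨_, _, _, he⟩ := h.inv_inr; exact he.headEq.elim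
  | loc =>
    obtain ⟨_, _, hM, he⟩ := h.inv_loc
    obtain ⟨rfl, _⟩ := he.headEq
    exact ⟨_, _, rfl, hM⟩
  | unit => exact h.inv_unit.2.headEq.elim

/-- All locations in a duplicable value are weak. -/
theorem HasOccTy.eq_w_of_dup {τ : Ty} (hv : v.IsValue) (hP : P.OnVars)
    (h : HasOccTy P Γ M v τ) (hE : Entails P .Dup τ) : ∀ a ∈ M, a.2.1 = .w := by
  rintro ⟨l, rq, τ₀⟩ ha
  have := h.entails_occ hv hP hE _ ha
  cases rq with
  | w => rfl
  | s => exact (this.not_dup_ref_s hP).elim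

end Canonical

/-! ## Preservation -/

theorem Constraint.onVars_nil : Constraint.OnVars [] := by simp [Constraint.OnVars]

/-- A typed term in an evaluation context can be replaced by any term of the same type. -/
theorem HasOccTy.plug (E : ECtx) {e : Term} : ∀ {M : Multiset Occ} {τ : Ty},
    HasOccTy [] VarCtx.empty M (E.plug e) τ → ∃ N F τ₀, M = N + F ∧
      HasOccTy [] VarCtx.empty N e τ₀ ∧ ∀ {N' e'}, HasOccTy [] VarCtx.empty N' e' τ₀ →
        HasOccTy [] VarCtx.empty (N' + F) (E.plug e') τ := by
  induction E with
  | hole => exact fun h => ⟨_, 0, _, (add_zero _).symm, h, fun h' => by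
      rw [add_zero]; exact h'⟩
  | appL E e₂ ih =>
    intro M τ h
    obtain ⟨_, _, M₁, M₂, _, _, hΓ, rfl, h₁, h₂⟩ := h.inv_app
    obtain ⟨rfl, rfl⟩ := hΓ.of_empty
    obtain ⟨N, F, τ₀, rfl, h₀, H⟩ := ih h₁
    exact ⟨N, F + M₂, τ₀, add_assoc _ _ _, h₀, fun h' => by
      rw [← add_assoc]; exact .app (H h') h₂ hΓ⟩
  | appR v hv E ih =>
    intro M τ h
    obtain ⟨_, _, M₁, M₂, _, _, hΓ, rfl, h₁, h₂⟩ := h.inv_app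
    obtain ⟨rfl, rfl⟩ := hΓ.of_empty
    obtain ⟨N, F, τ₀, rfl, h₀, H⟩ := ih h₂
    exact ⟨N, M₁ + F, τ₀, add_left_comm _ _ _, h₀, fun h' => by
      rw [add_left_comm]; exact .app h₁ (H h') hΓ⟩
  | tapp E τs ih =>
    intro M τ h
    obtain ⟨P₂, τ₁, h, hE, hτ⟩ := h.inv_tapp
    obtain ⟨N, F, τ₀, rfl, h₀, H⟩ := ih h
    exact ⟨N, F, τ₀, rfl, h₀, fun h' => (HasOccTy.tapp (H h') rfl hE).conv hτ⟩
  | pairL E e₂ ih =>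
    intro M τ h
    obtain ⟨_, _, M₁, M₂, _, _, hΓ, rfl, h₁, h₂, hτ⟩ := h.inv_pair
    obtain ⟨rfl, rfl⟩ := hΓ.of_empty
    obtain ⟨N, F, τ₀, rfl, h₀, H⟩ := ih h₁
    exact ⟨N, F + M₂, τ₀, add_assoc _ _ _, h₀, fun h' => by
      rw [← add_assoc]; exact (HasOccTy.pair (H h') h₂ hΓ).conv hτ⟩
  | pairR v hv E ih =>
    intro M τ h
    obtain ⟨_, _, M₁, M₂, _, _, hΓ, rfl, h₁, h₂, hτ⟩ := h.inv_pair
    obtain ⟨rfl, rfl⟩ := hΓ.of_empty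
    obtain ⟨N, F, τ₀, rfl, h₀, H⟩ := ih h₂
    exact ⟨N, M₁ + F, τ₀, add_left_comm _ _ _, h₀, fun h' => by
      rw [add_left_comm]; exact (HasOccTy.pair h₁ (H h') hΓ).conv hτ⟩
  | inl E ih =>
    intro M τ h
    obtain ⟨_, _, h, hτ⟩ := h.inv_inl
    obtain ⟨N, F, τ₀, rfl, h₀, H⟩ := ih h
    exact ⟨N, F, τ₀, rfl, h₀, fun h' => (HasOccTy.inl (H h')).conv hτ⟩
  | inr E ih =>
    intro M τ h
    obtain ⟨_, _, h, hτ⟩ := h.inv_inr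
    obtain ⟨N, F, τ₀, rfl, h₀, H⟩ := ih h
    exact ⟨N, F, τ₀, rfl, h₀, fun h' => (HasOccTy.inr (H h')).conv hτ⟩
  | caseOf E e₁ e₂ ih =>
    intro M τ h
    obtain ⟨_, _, M₁, M₂, _, _, hΓ, rfl, h₁, h₂, h₃⟩ := h.inv_caseOf
    obtain ⟨rfl, rfl⟩ := hΓ.of_empty
    obtain ⟨N, F, τ₀, rfl, h₀, H⟩ := ih h₁
    exact ⟨N, F + M₂, τ₀, add_assoc _ _ _, h₀, fun h' => by
      rw [← add_assoc]; exact .caseOf (H h') h₂ h₃ hΓ⟩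
  | letPair E e₂ ih =>
    intro M τ h
    obtain ⟨_, _, M₁, M₂, _, _, hΓ, rfl, h₁, h₂⟩ := h.inv_letPair
    obtain ⟨rfl, rfl⟩ := hΓ.of_empty
    obtain ⟨N, F, τ₀, rfl, h₀, H⟩ := ih h₁
    exact ⟨N, F + M₂, τ₀, add_assoc _ _ _, h₀, fun h' => by
      rw [← add_assoc]; exact .letPair (H h') h₂ hΓ⟩
  | new rq E ih =>
    intro M τ h
    obtain ⟨_, h, hτ⟩ := h.inv_new
    obtain ⟨N, F, τ₀, rfl, h₀, H⟩ := ih h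
    exact ⟨N, F, τ₀, rfl, h₀, fun h' => (HasOccTy.new (H h')).conv hτ⟩
  | release rq E ih =>
    intro M τ h
    cases rq with
    | w =>
      obtain ⟨_, _, h, hτ⟩ := h.inv_releaseW
      obtain ⟨N, F, τ₀, rfl, h₀, H⟩ := ih h
      exact ⟨N, F, τ₀, rfl, h₀, fun h' => (HasOccTy.releaseW (H h')).conv hτ⟩
    | s =>
      obtain ⟨N, F, τ₀, rfl, h₀, H⟩ := ih h.inv_releaseS
      exact ⟨N, F, τ₀, rfl, h₀, fun h' => HasOccTy.releaseS (H h')⟩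
  | swapL rq E e₂ ih =>
    intro M τ h
    cases rq with
    | w =>
      obtain ⟨_, _, M₁, M₂, _, _, hΓ, rfl, h₁, h₂, hτ⟩ := h.inv_swapW
      obtain ⟨rfl, rfl⟩ := hΓ.of_empty
      obtain ⟨N, F, τ₀, rfl, h₀, H⟩ := ih h₁
      exact ⟨N, F + M₂, τ₀, add_assoc _ _ _, h₀, fun h' => by
        rw [← add_assoc]; exact (HasOccTy.swapW (H h') h₂ hΓ).conv hτ⟩
    | s =>
      obtain ⟨_, _, M₁, M₂, _, _, hΓ, rfl, h₁, h₂, hτ⟩ := h.inv_swapS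
      obtain ⟨rfl, rfl⟩ := hΓ.of_empty
      obtain ⟨N, F, τ₀, rfl, h₀, H⟩ := ih h₁
      exact ⟨N, F + M₂, τ₀, add_assoc _ _ _, h₀, fun h' => by
        rw [← add_assoc]; exact (HasOccTy.swapS (H h') h₂ hΓ).conv hτ⟩
  | swapR rq v hv E ih =>
    intro M τ h
    cases rq with
    | w =>
      obtain ⟨_, _, M₁, M₂, _, _, hΓ, rfl, h₁, h₂, hτ⟩ := h.inv_swapW
      obtain ⟨rfl, rfl⟩ := hΓ.of_empty
      obtain ⟨N, F, τ₀, rfl, h₀, H⟩ := ih h₂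
      exact ⟨N, M₁ + F, τ₀, add_left_comm _ _ _, h₀, fun h' => by
        rw [add_left_comm]; exact (HasOccTy.swapW h₁ (H h') hΓ).conv hτ⟩
    | s =>
      obtain ⟨_, _, M₁, M₂, _, _, hΓ, rfl, h₁, h₂, hτ⟩ := h.inv_swapS
      obtain ⟨rfl, rfl⟩ := hΓ.of_empty
      obtain ⟨N, F, τ₀, rfl, h₀, H⟩ := ih h₂
      exact ⟨N, M₁ + F, τ₀, add_left_comm _ _ _, h₀, fun h' => by
        rw [add_left_comm]; exact (HasOccTy.swapS h₁ (H h') hΓ).conv hτ⟩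
  | dup E e₂ ih =>
    intro M τ h
    obtain ⟨_, _, M₁, M₂, _, hΓ, rfl, h₁, h₂, hE⟩ := h.inv_dup
    obtain ⟨rfl, rfl⟩ := hΓ.of_empty
    obtain ⟨N, F, τ₀, rfl, h₀, H⟩ := ih h₁
    exact ⟨N, F + M₂, τ₀, add_assoc _ _ _, h₀, fun h' => by
      rw [← add_assoc]; exact .dup (H h') h₂ hE hΓ⟩
  | drop E e₂ ih =>
    intro M τ h
    obtain ⟨_, _, M₁, M₂, _, hΓ, rfl, h₁, h₂, hE⟩ := h.inv_drop
    obtain ⟨rfl, rfl⟩ := hΓ.of_empty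
    obtain ⟨N, F, τ₀, rfl, h₀, H⟩ := ih h₁
    exact ⟨N, F + M₂, τ₀, add_assoc _ _ _, h₀, fun h' => by
      rw [← add_assoc]; exact .drop (H h') h₂ hE hΓ⟩

theorem Occ.map_shift_subst_instTys (M : Multiset Occ) (τs : List Ty) :
    (M.map (Occ.shift τs.length)).map (Occ.subst (instTys τs)) = M := by
  rw [Multiset.map_map]
  conv_rhs => rw [← Multiset.map_id M]
  exact Multiset.map_congr rfl fun a _ => by simp [Occ.shift, Occ.subst, Ty.shift_subst_instTys]

/-- Type substitution discharges the constraints of the abstraction, and instantiation undoes the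
shift of the location types. -/
theorem HasOccTy.tbeta {M : Multiset Occ} {P : Constraint} {v : Term} {τs : List Ty} {τ : Ty}
    (h : HasOccTy [] VarCtx.empty M (.tapp (.tabs τs.length P v) τs) τ) :
    HasOccTy [] VarCtx.empty M (v.tsubst (instTys τs)) τ := by
  obtain ⟨P₂, τ₁, h, hE, hτ⟩ := h.inv_tapp
  obtain ⟨τ₀, hv, h, hP, he⟩ := h.inv_tabs
  obtain ⟨_, hPP, hττ⟩ := he.headEq
  have := h.tsubst (s := instTys τs) (Q := []) (by
    intro c hc
    rw [Constraint.subst_eq_map] at hc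
    obtain ⟨d, hd, rfl⟩ := List.mem_map.1 hc
    -- The application checked the constraints of a type merely identified with that of the
    -- abstraction; each constraint in `P` has a counterpart there.
    obtain ⟨d', hd', e₁, e₂⟩ := hPP.1 d (by simpa [Constraint.shift] using hd)
    have := hE (d'.1, d'.2.subst (instTys τs)) (by
      rw [Constraint.subst_eq_map]
      exact List.mem_map.2 ⟨d', hd', rfl⟩)
    rw [e₁] at this
    exact this.congr (e₂.symm.subst _))
  rw [Occ.map_shift_subst_instTys] at this
  exact this.conv ((hττ.subst _).trans hτ)

/-- The frame `F` stands for occurrences in the surrounding evaluation context. It belongs to the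
accounting of the store but is not touched by the step, which is what the context rule needs. -/
theorem Step.preservation {c c' : Config} (hs : Step c c') : ∀ {M N F : Multiset Occ} {τ : Ty},
    StoreFits c.1 M (N + F) → HasOccTy [] VarCtx.empty N c.2 τ →
    ∃ M' N', StoreFits c'.1 M' (N' + F) ∧ HasOccTy [] VarCtx.empty N' c'.2 τ := by
  induction hs with
  | beta hv =>
    intro M N F τ hμ h
    obtain ⟨_, _, M₁, M₂, _, τ₂, hΓ, rfl, h₁, h₂⟩ := h.inv_app
    obtain ⟨rfl, rfl⟩ := hΓ.of_empty
    obtain ⟨τ', h₁, _, hτ⟩ := h₁.inv_lam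
    obtain ⟨_, e₁, e₂⟩ := hτ.headEq
    exact ⟨M, _, hμ, (h₁.subst1 Constraint.onVars_nil hv (h₂.conv e₁.symm)).conv e₂⟩
  | tbeta hv hn =>
    intro M N F τ hμ h
    subst hn
    exact ⟨M, N, hμ, h.tbeta⟩
  | letPair hv₁ hv₂ =>
    intro M N F τ hμ h
    obtain ⟨_, _, M₁, M₂, τ₁, τ₂, hΓ, rfl, h₁, h₂⟩ := h.inv_letPair
    obtain ⟨rfl, rfl⟩ := hΓ.of_empty
    obtain ⟨_, _, R₁, R₂, _, _, hΓ, rfl, h₁₁, h₁₂, hτ⟩ := h₁.inv_pair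
    obtain ⟨rfl, rfl⟩ := hΓ.of_empty
    obtain ⟨e₁, e₂⟩ := hτ.headEq
    refine ⟨M, _, ?_, h₂.subst2 Constraint.onVars_nil hv₁ hv₂ (h₁₁.conv e₁) (h₁₂.conv e₂)⟩
    rwa [add_assoc M₂, add_comm M₂]
  | caseInl hv =>
    intro M N F τ hμ h
    obtain ⟨_, _, M₁, M₂, _, _, hΓ, rfl, h₁, h₂, _⟩ := h.inv_caseOf
    obtain ⟨rfl, rfl⟩ := hΓ.of_empty
    obtain ⟨_, _, h₁, hτ⟩ := h₁.inv_inl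
    refine ⟨M, _, ?_, h₂.subst1 Constraint.onVars_nil hv (h₁.conv hτ.headEq.1)⟩
    rwa [add_comm M₂]
  | caseInr hv =>
    intro M N F τ hμ h
    obtain ⟨_, _, M₁, M₂, _, _, hΓ, rfl, h₁, _, h₂⟩ := h.inv_caseOf
    obtain ⟨rfl, rfl⟩ := hΓ.of_empty
    obtain ⟨_, _, h₁, hτ⟩ := h₁.inv_inr
    refine ⟨M, _, ?_, h₂.subst1 Constraint.onVars_nil hv (h₁.conv hτ.headEq.2)⟩
    rwa [add_comm M₂]
  | new hv hl =>
    intro M N F τ hμ h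
    obtain ⟨τ₀, h, hτ⟩ := h.inv_new
    exact ⟨_, _, hμ.new _ hl hv h, HasOccTy.loc.conv hτ⟩
  | @swap μ rq l i v₁ v₂ hv₂ hl =>
    intro M N F τ hμ h
    cases rq with
    | w =>
      obtain ⟨_, _, M₁, M₂, rq, τ₁, hΓ, rfl, h₁, h₂, hτ⟩ := h.inv_swapW
      obtain ⟨rfl, rfl⟩ := hΓ.of_empty
      obtain ⟨rq', τ₀, rfl, hτ₁⟩ := h₁.inv_loc
      obtain ⟨rfl, e⟩ := hτ₁.headEq
      rw [add_assoc, Multiset.singleton_add] at hμ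
      -- The new contents are converted to the exact type recorded for the cell, so that other weak
      -- occurrences stay valid.
      obtain ⟨M', N₁, hN₁, hμ'⟩ := hμ.swap hl hv₂ (h₂.conv e.symm) (.inr rfl)
      refine ⟨M', _, ?_, (HasOccTy.pair (HasOccTy.loc.conv hτ₁) (hN₁.conv e) hΓ).conv hτ⟩
      rwa [add_assoc, Multiset.singleton_add]
    | s =>
      obtain ⟨_, _, M₁, M₂, τ₁, τ₂, hΓ, rfl, h₁, h₂, hτ⟩ := h.inv_swapS
      obtain ⟨rfl, rfl⟩ := hΓ.of_empty
      obtain ⟨rq', τ₀, rfl, hτ₁⟩ := h₁.inv_loc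
      obtain ⟨rfl, e⟩ := hτ₁.headEq
      rw [add_assoc, Multiset.singleton_add] at hμ
      obtain ⟨M', N₁, hN₁, hμ'⟩ := hμ.swap hl hv₂ h₂ (.inl rfl)
      refine ⟨M', _, ?_, (HasOccTy.pair HasOccTy.loc (hN₁.conv e) hΓ).conv hτ⟩
      rwa [add_assoc, Multiset.singleton_add]
  | releaseWLast hl =>
    intro M N F τ hμ h
    obtain ⟨rq, τ₁, h, hτ⟩ := h.inv_releaseW
    obtain ⟨rq', τ₀, rfl, hτ₁⟩ := h.inv_loc
    rw [Multiset.singleton_add] at hμ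
    obtain ⟨M', N', _, hN, hμ'⟩ := hμ.erase hl
    exact ⟨M', N', hμ', ((hN.conv hτ₁.headEq.2).inl).conv hτ⟩
  | releaseWMore hl hi =>
    intro M N F τ hμ h
    obtain ⟨rq, τ₁, h, hτ⟩ := h.inv_releaseW
    obtain ⟨rq', τ₀, rfl, hτ₁⟩ := h.inv_loc
    rw [Multiset.singleton_add] at hμ
    exact ⟨M, 0, by simpa using hμ.decr hl hi, (HasOccTy.unit.inr).conv hτ⟩
  | releaseS hl =>
    intro M N F τ hμ h
    obtain ⟨rq', τ₀, rfl, hτ₁⟩ := h.inv_releaseS.inv_loc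
    rw [Multiset.singleton_add] at hμ
    obtain ⟨M', N', _, hN, hμ'⟩ := hμ.erase hl
    exact ⟨M', N', hμ', hN.conv hτ₁.headEq.2⟩
  | dup hv hls hI =>
    intro M N F τ hμ h
    obtain ⟨_, _, M₁, M₂, τ₁, hΓ, rfl, h₁, h₂, hE⟩ := h.inv_dup
    obtain ⟨rfl, rfl⟩ := hΓ.of_empty
    have hw := h₁.eq_w_of_dup hv Constraint.onVars_nil hE
    rw [h₁.locs_eq] at hls
    obtain ⟨D, rfl, rfl⟩ := exists_list_map_eq hls
    refine ⟨M, _, ?_, h₂.subst2 Constraint.onVars_nil hv hv h₁ h₁⟩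
    have := hμ.of_incr (D := D) (fun a ha => ⟨by simp [ha], hw a (by simpa using ha)⟩) hI
    -- The value is substituted twice; the increments have supplied the second copy of its
    -- occurrences.
    have e : M₂ + (D : Multiset Occ) + D + F = D + (D + M₂ + F) := by abel
    rw [e]
    exact this
  | drop hv hls hD =>
    intro M N F τ hμ h
    obtain ⟨_, _, M₁, M₂, τ₁, hΓ, rfl, h₁, h₂, hE⟩ := h.inv_drop
    obtain ⟨rfl, rfl⟩ := hΓ.of_empty
    rw [h₁.locs_eq] at hls
    obtain ⟨D, rfl, rfl⟩ := exists_list_map_eq hls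
    rw [add_assoc] at hμ
    obtain ⟨M', hμ', _⟩ := hμ.of_decr hD rfl
    exact ⟨M', M₂, hμ', h₂⟩
  | ctx E _ ih =>
    intro M N F τ hμ h
    obtain ⟨N₀, F₀, τ₀, rfl, h₀, H⟩ := h.plug
    rw [add_assoc] at hμ
    obtain ⟨M', N', hμ', h'⟩ := ih hμ h₀
    exact ⟨M', N' + F₀, by rwa [add_assoc], H h'⟩

/-! ## Progress -/

/-- The store must fit the whole term, not just the subterm that steps; the occurrences in the other
subterms join the frame `F`. -/
theorem HasOccTy.progress (e : Term) : ∀ {μ : Store} {M N F : Multiset Occ} {τ : Ty},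
    StoreFits μ M (N + F) → HasOccTy [] VarCtx.empty N e τ →
    e.IsValue ∨ ∃ c, Step (μ, e) c := by
  induction e with
  | var i =>
    intro μ M N F τ _ h
    obtain ⟨τ', hΓ⟩ := h.inv_var
    have := congrFun hΓ i
    simp [VarCtx.empty, VarCtx.single] at this
  | lam | loc | unit => exact fun _ _ => .inl (by constructor)
  | tabs n P v =>
    intro μ M N F τ _ h
    obtain ⟨_, hv, _⟩ := h.inv_tabs
    exact .inl (.tabs _ _ hv)
  | app e₁ e₂ ih₁ ih₂ =>
    intro μ M N F τ hμ h
    obtain ⟨_, _, M₁, M₂, _, τ₂, hΓ, rfl, h₁, h₂⟩ := h.inv_app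
    obtain ⟨rfl, rfl⟩ := hΓ.of_empty
    refine .inr ?_
    rcases ih₁ (add_assoc M₁ M₂ F ▸ hμ) h₁ with hv₁ | ⟨c, hc⟩
    · rcases ih₂ (add_left_comm M₂ M₁ F ▸ add_assoc M₁ M₂ F ▸ hμ) h₂ with hv₂ | ⟨c, hc⟩
      · obtain ⟨_, _, _, rfl⟩ := h₁.canonical_arrow hv₁
        exact ⟨_, .beta hv₂⟩
      · exact ⟨_, .ctx (.appR e₁ hv₁ .hole) hc⟩
    · exact ⟨_, .ctx (.appL .hole e₂) hc⟩
  | tapp e τs ih =>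
    intro μ M N F τ hμ h
    obtain ⟨P₂, τ₁, h, _, _⟩ := h.inv_tapp
    refine .inr ?_
    rcases ih hμ h with hv | ⟨c, hc⟩
    · obtain ⟨P, v, rfl, hv'⟩ := h.canonical_all hv
      exact ⟨_, .tbeta hv' rfl⟩
    · exact ⟨_, .ctx (.tapp .hole τs) hc⟩
  | pair e₁ e₂ ih₁ ih₂ =>
    intro μ M N F τ hμ h
    obtain ⟨_, _, M₁, M₂, _, τ₂, hΓ, rfl, h₁, h₂, _⟩ := h.inv_pair
    obtain ⟨rfl, rfl⟩ := hΓ.of_empty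
    rcases ih₁ (add_assoc M₁ M₂ F ▸ hμ) h₁ with hv₁ | ⟨c, hc⟩
    · rcases ih₂ (add_left_comm M₂ M₁ F ▸ add_assoc M₁ M₂ F ▸ hμ) h₂ with hv₂ | ⟨c, hc⟩
      · exact .inl (.pair hv₁ hv₂)
      · exact .inr ⟨_, .ctx (.pairR e₁ hv₁ .hole) hc⟩
    · exact .inr ⟨_, .ctx (.pairL .hole e₂) hc⟩
  | letPair e₁ e₂ ih₁ _ =>
    intro μ M N F τ hμ h
    obtain ⟨_, _, M₁, M₂, _, τ₂, hΓ, rfl, h₁, _⟩ := h.inv_letPair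
    obtain ⟨rfl, rfl⟩ := hΓ.of_empty
    refine .inr ?_
    rcases ih₁ (add_assoc M₁ M₂ F ▸ hμ) h₁ with hv₁ | ⟨c, hc⟩
    · obtain ⟨v₁, v₂, rfl, hv₁, hv₂⟩ := h₁.canonical_prod hv₁
      exact ⟨_, .letPair hv₁ hv₂⟩
    · exact ⟨_, .ctx (.letPair .hole e₂) hc⟩
  | inl e ih =>
    intro μ M N F τ hμ h
    obtain ⟨_, _, h, _⟩ := h.inv_inl
    exact (ih hμ h).imp .inl fun ⟨c, hc⟩ => ⟨_, .ctx (.inl .hole) hc⟩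
  | inr e ih =>
    intro μ M N F τ hμ h
    obtain ⟨_, _, h, _⟩ := h.inv_inr
    exact (ih hμ h).imp .inr fun ⟨c, hc⟩ => ⟨_, .ctx (.inr .hole) hc⟩
  | caseOf e₁ e₂ e₃ ih₁ _ _ =>
    intro μ M N F τ hμ h
    obtain ⟨_, _, M₁, M₂, _, τ₂, hΓ, rfl, h₁, _, _⟩ := h.inv_caseOf
    obtain ⟨rfl, rfl⟩ := hΓ.of_empty
    refine .inr ?_
    rcases ih₁ (add_assoc M₁ M₂ F ▸ hμ) h₁ with hv₁ | ⟨c, hc⟩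
    · obtain ⟨v, hv, rfl | rfl⟩ := h₁.canonical_sum hv₁
      · exact ⟨_, .caseInl hv⟩
      · exact ⟨_, .caseInr hv⟩
    · exact ⟨_, .ctx (.caseOf .hole e₂ e₃) hc⟩
  | new rq e ih =>
    intro μ M N F τ hμ h
    obtain ⟨_, h, _⟩ := h.inv_new
    refine .inr ?_
    rcases ih hμ h with hv | ⟨c, hc⟩
    -- A store is finite, so a fresh location exists.
    · obtain ⟨l, hl⟩ := Infinite.exists_notMem_finset μ.keys
      exact ⟨_, .new hv (by rwa [Finmap.mem_keys] at hl)⟩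
    · exact ⟨_, .ctx (.new rq .hole) hc⟩
  | release rq e ih =>
    intro μ M N F τ hμ h
    refine .inr ?_
    cases rq with
    | w =>
      obtain ⟨rq, _, h, _⟩ := h.inv_releaseW
      rcases ih hμ h with hv | ⟨c, hc⟩
      · obtain ⟨l, τ₀, rfl, rfl⟩ := h.canonical_ref hv
        rw [Multiset.singleton_add] at hμ
        obtain ⟨k, v, hl, _, _⟩ := hμ.exists_lookup
        rcases k with _ | k
        · exact ⟨_, .releaseWLast hl⟩
        · exact ⟨_, .releaseWMore hl (by omega)⟩
      · exact ⟨_, .ctx (.release .w .hole) hc⟩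
    | s =>
      have h := h.inv_releaseS
      rcases ih hμ h with hv | ⟨c, hc⟩
      · obtain ⟨l, τ₀, rfl, rfl⟩ := h.canonical_ref hv
        rw [Multiset.singleton_add] at hμ
        obtain ⟨k, v, hl, _, hk⟩ := hμ.exists_lookup
        -- A strong cell has count one, the only count at which strong release is defined.
        obtain rfl := hk rfl
        exact ⟨_, .releaseS hl⟩
      · exact ⟨_, .ctx (.release .s .hole) hc⟩
  | swap rq e₁ e₂ ih₁ ih₂ =>
    intro μ M N F τ hμ h
    obtain ⟨M₁, M₂, rq', τ₁, τ₂, rfl, h₁, h₂⟩ : ∃ M₁ M₂ rq' τ₁ τ₂, N = M₁ + M₂ ∧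
        HasOccTy [] VarCtx.empty M₁ e₁ (.ref rq' τ₁) ∧ HasOccTy [] VarCtx.empty M₂ e₂ τ₂ := by
      cases rq with
      | w =>
        obtain ⟨_, _, M₁, M₂, _, _, hΓ, rfl, h₁, h₂, _⟩ := h.inv_swapW
        obtain ⟨rfl, rfl⟩ := hΓ.of_empty
        exact ⟨_, _, _, _, _, rfl, h₁, h₂⟩
      | s =>
        obtain ⟨_, _, M₁, M₂, _, _, hΓ, rfl, h₁, h₂, _⟩ := h.inv_swapS
        obtain ⟨rfl, rfl⟩ := hΓ.of_empty
        exact ⟨_, _, _, _, _, rfl, h₁, h₂⟩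
    refine .inr ?_
    rcases ih₁ (add_assoc M₁ M₂ F ▸ hμ) h₁ with hv₁ | ⟨c, hc⟩
    · rcases ih₂ (add_left_comm M₂ M₁ F ▸ add_assoc M₁ M₂ F ▸ hμ) h₂ with hv₂ | ⟨c, hc⟩
      · obtain ⟨l, τ₀, rfl, rfl⟩ := h₁.canonical_ref hv₁
        rw [add_assoc, Multiset.singleton_add] at hμ
        obtain ⟨k, v, hl, _, _⟩ := hμ.exists_lookup
        exact ⟨_, .swap hv₂ hl⟩
      · exact ⟨_, .ctx (.swapR rq e₁ hv₁ .hole) hc⟩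
    · exact ⟨_, .ctx (.swapL rq .hole e₂) hc⟩
  | dup e₁ e₂ ih₁ _ =>
    intro μ M N F τ hμ h
    obtain ⟨_, _, M₁, M₂, τ₁, hΓ, rfl, h₁, h₂, hE⟩ := h.inv_dup
    obtain ⟨rfl, rfl⟩ := hΓ.of_empty
    refine .inr ?_
    rcases ih₁ (add_assoc M₁ M₂ F ▸ hμ) h₁ with hv | ⟨c, hc⟩
    · have hw := h₁.eq_w_of_dup hv Constraint.onVars_nil hE
      obtain ⟨D, rfl⟩ := Quotient.exists_rep M₁
      -- All locations of the duplicable value are weak and still occur in the term, so each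
      -- increment finds its cell.
      obtain ⟨μ', hI⟩ := hμ.exists_incr (D := D) fun a ha =>
        ⟨Multiset.mem_add.2 (.inl (Multiset.mem_add.2 (.inl ha))), hw a ha⟩
      exact ⟨_, .dup hv h₁.locs_eq.symm hI⟩
    · exact ⟨_, .ctx (.dup .hole e₂) hc⟩
  | drop e₁ e₂ ih₁ _ =>
    intro μ M N F τ hμ h
    obtain ⟨_, _, M₁, M₂, τ₁, hΓ, rfl, h₁, h₂, hE⟩ := h.inv_drop
    obtain ⟨rfl, rfl⟩ := hΓ.of_empty
    refine .inr ?_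
    rcases ih₁ (add_assoc M₁ M₂ F ▸ hμ) h₁ with hv | ⟨c, hc⟩
    · obtain ⟨D, rfl⟩ := Quotient.exists_rep M₁
      obtain ⟨μ', hD⟩ := StoreFits.exists_decr _ (D := D) le_rfl (add_assoc _ M₂ F ▸ hμ)
      exact ⟨_, .drop hv h₁.locs_eq.symm hD⟩
    · exact ⟨_, .ctx (.drop .hole e₂) hc⟩

/-! ## Type soundness -/

/-- The only bridge between the declarative configuration typing and the counting invariant;
everything after it is stated in declarative terms. -/
theorem confTy_iff {μ : Store} {e : Term} {τ : Ty} : ConfTy (μ, e) τ ↔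
    ∃ M N, StoreFits μ M N ∧ HasOccTy [] VarCtx.empty N e τ := by
  constructor
  · rintro ⟨hμ, hS, he⟩
    obtain ⟨M, hM, hμ⟩ := hμ.exists_storeOccTy
    obtain ⟨N, hN, he⟩ := he.exists_hasOccTy
    exact ⟨M, N, ⟨_, hμ, hM.join hN hS⟩, he⟩
  · rintro ⟨M, N, ⟨S, hμ, hd⟩, he⟩
    obtain ⟨S₁, S₂, h₁, h₂, hS⟩ := hd.split
    exact .mk (hμ.storeTy h₁) hS (he.hasTy h₂)

theorem ConfTy.step {c c' : Config} {τ : Ty} (h : ConfTy c τ) (hs : Step c c') :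
    ConfTy c' τ := by
  obtain ⟨M, N, hμ, he⟩ := confTy_iff.1 h
  obtain ⟨M', N', hμ', he'⟩ := hs.preservation (F := 0) (by rwa [add_zero]) he
  exact confTy_iff.2 ⟨M', N', by rwa [add_zero] at hμ', he'⟩

theorem ConfTy.steps {c c' : Config} {τ : Ty} (h : ConfTy c τ) (hs : Steps c c') :
    ConfTy c' τ := by
  induction hs with
  | refl => exact h
  | tail _ hs ih => exact ih.step hs

theorem ConfTy.progress {c : Config} {τ : Ty} (h : ConfTy c τ) :
    c.2.IsValue ∨ ∃ c', Step c c' := by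
  obtain ⟨M, N, hμ, he⟩ := confTy_iff.1 h
  exact HasOccTy.progress c.2 (F := 0) (by rwa [add_zero]) he

/-- Dependent choice, run on configurations bundled with a proof that they are reachable. -/
theorem diverges_of_forall_steps {c : Config} (h : ∀ c', Steps c c' → ∃ c'', Step c' c'') :
    Diverges c := by
  choose f hf using h
  let g : ℕ → {c' // Steps c c'} :=
    Nat.rec ⟨c, .refl⟩ fun _ d => ⟨f d.1 d.2, d.2.tail (hf d.1 d.2)⟩
  exact ⟨fun n => (g n).1, rfl, fun n => hf (g n).1 (g n).2⟩

end LambdaCl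

theorem mainTheorem1 (e : LambdaCl.Term) (τ : LambdaCl.Ty)
    (h : LambdaCl.ConfTy ((∅ : LambdaCl.Store), e) τ) :
    (LambdaCl.Diverges ((∅ : LambdaCl.Store), e) ∨
      ∃ (μ : LambdaCl.Store) (v : LambdaCl.Term),
        LambdaCl.Steps ((∅ : LambdaCl.Store), e) (μ, v) ∧ v.IsValue ∧
          LambdaCl.ConfTy (μ, v) τ) ∧
    (∀ (μ : LambdaCl.Store) (e' : LambdaCl.Term),
      LambdaCl.Steps ((∅ : LambdaCl.Store), e) (μ, e') →
      (¬ ∃ c, LambdaCl.Step (μ, e') c) →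
        e'.IsValue ∧ LambdaCl.ConfTy (μ, e') τ) := by
  constructor
  -- If no value is reachable, progress leaves only the possibility of a further step at every
  -- reachable configuration.
  · by_cases hv : ∃ c, LambdaCl.Steps ((∅ : LambdaCl.Store), e) c ∧ c.2.IsValue
    · obtain ⟨⟨μ, v⟩, hs, hv⟩ := hv
      exact .inr ⟨μ, v, hs, hv, h.steps hs⟩
    · refine .inl (LambdaCl.diverges_of_forall_steps fun c hs => ?_)
      exact (h.steps hs).progress.resolve_left fun hc => hv ⟨c, hs, hc⟩
  · intro μ e' hs hstuck
    exact ⟨(h.steps hs).progress.resolve_right hstuck, h.steps hs⟩
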